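/- **Setting.** Let $\Bbbk=\mathbb R$ or $\mathbb C$, and let $V=\bigoplus_{n\in\mathbb Z}V_n$ be a graded $\Bbbk$-vector space with every $V_n$ finite-dimensional, equipped with an odd symplectic form $\omega$ of degree $-1$ (bilinear, graded-antisymmetric, nondegenerate, with $\omega(V_a,V_b)=0$ unless $a+b=1$). Let $(e_i)$ be a homogeneous basis of $V$, $\phi^i$ the dual coordinates, $|\phi^i|=-|e_i|$, $\omega_{ij}=\omega(e_i,e_j)$ and $(\omega^{ij})$ the inverse matrix. On formal series in the graded-commutative variables $\phi^i$ and in $\hbar^{\pm1}$ put $$\Delta F=\tfrac12\sum_{i,j}(-1)^{|\phi^i|}\omega^{ij}\frac{\partial_L^2F}{\partial\phi^i\partial\phi^j},\qquad \{F,G\}=\sum_{i,j}\frac{\partial_RF}{\partial\phi^i}\,\omega^{ij}\,\frac{\partial_LG}{\partial\phi^j}.$$ A monomial $\hbar^g\phi^{i_1}\cdots\phi^{i_n}$ has weight $2g+n$, and $$\mathcal F_{+}(V)=\prod_{w\ge1}\ \bigoplus_{2g+n=w}\hbar^g(V^\ast)^{\odot n}\qquad(g\in\mathbb Z,\ n\ge0)$$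 ($V^\ast$ the graded dual). Fix $S_{\rm free}\in(V^\ast)^{\odot2}$ of degree $0$. Let $S_0,S_1$ be two actions, that is, for $i=0,1$: $S_i$ has degree $0$, $S_i/\hbar\in\mathcal F_+(V)$ (so $S_i$ has weight at least $3$), and $S=S_{\rm free}+S_i$ solves the quantum master equation $2\hbar\Delta S+\{S,S\}=0$. **Theorem.** The following are equivalent. 1. There is $F\in\mathcal F_+(V)$ with $e^{S_0/\hbar}-e^{S_1/\hbar}=(\{S_{\rm free},-\}+\hbar\Delta)F$. 2. $S_0$ and $S_1$ are homotopic: there are $A(t)$ of degree $0$ and $B(t)$ of degree $-1$ with $A/\hbar$ and $B/\hbar$ in $\prod_{w\ge1}\bigl[\bigl(\bigoplus_{2g+n=w}\hbar^g(V^\ast)^{\odot n}\bigr)\otimes C^\infty([0,1])\bigr]$, with $A(0)=S_0$, $A(1)=S_1$ and $$(\{S_{\rm free},-\}+\hbar\Delta+d_{\rm dR})\,e^{(A(t)+B(t)\,dt)/\hbar}=0 .$$ 3. There is a degree-preserving formal symplectic diffeomorphism $\Phi$ of $V$ of the form $1+(\text{terms of positive weight})$ with $$e^{(S_{\rm free}+S_0)/\hbar}\,d^{\frac12}V=\Phi^\ast\bigl(e^{(S_{\rm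 free}+S_1)/\hbar}\,d^{\frac12}V\bigr).$$ In 3, $\Phi$ is given by series $f^i=\Phi^\ast\phi^i$ of degree $|\phi^i|$ such that $f^i-\phi^i$ only has terms of weight at least $2$ and, for each $w$, the weight-$w$ parts of all the $f^i-\phi^i$ together involve only finitely many monomials (so that $\Phi-1$ lies in the weight-wise completion of functions tensored with $V$); $\Phi$ symplectic means $\{f^i,f^j\}=\omega^{ij}$ for all $i,j$; and half-densities pull back by $\Phi^\ast(G\,d^{\frac12}V)=\Phi^\ast(G)\,\operatorname{Ber}(\partial\Phi)^{\frac12}\,d^{\frac12}V$, where $\partial\Phi=(\partial_Lf^j/\partial\phi^i)_{i,j}$ and $\operatorname{Ber}(\partial\Phi)^{c}=\exp(c\operatorname{str}\log\partial\Phi)$. -/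

import Mathlib

noncomputable section

namespace QuantumBV

/-! ## Odd symplectic graded vector spaces -/

/-- `ω` is an odd symplectic form of degree `-1` on the graded vector space `V = ⨁ₙ 𝒱 n`. -/
structure IsOddSymplectic {𝕜 V : Type*} [Field 𝕜] [AddCommGroup V] [Module 𝕜 V]
    (𝒱 : ℤ → Submodule 𝕜 V) (ω : V →ₗ[𝕜] V →ₗ[𝕜] 𝕜) : Prop where
  /-- degree `-1`: `ω` pairs `𝒱 a` with `𝒱 b` only if `a + b = 1` -/
  degree : ∀ a b : ℤ, ∀ x ∈ 𝒱 a, ∀ y ∈ 𝒱 b, a + b ≠ 1 → ω x y = 0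
  /-- graded antisymmetry -/
  antisymm : ∀ a b : ℤ, ∀ x ∈ 𝒱 a, ∀ y ∈ 𝒱 b, ω x y = -((-1 : 𝕜) ^ (a * b) * ω y x)
  /-- nondegeneracy -/
  nondegenerate : ∀ x : V, (∀ y : V, ω x y = 0) → x = 0

theorem eq_zero_of_homogeneous {𝕜 V : Type*} [Field 𝕜] [AddCommGroup V] [Module 𝕜 V]
    (𝒱 : ℤ → Submodule 𝕜 V) [DirectSum.Decomposition 𝒱] (f : V →ₗ[𝕜] 𝕜)
    (h : ∀ n, ∀ x ∈ 𝒱 n, f x = 0) (y : V) : f y = 0 := by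
  induction y using DirectSum.Decomposition.inductionOn 𝒱 with
  | zero => simp
  | homogeneous x => exact h _ _ x.2
  | add x y hx hy => simp [hx, hy]

/-- By nondegeneracy and degreewise finite dimension, `ω` has dual vectors, so that `invForm` below is
the inverse matrix of `ω`. -/
theorem exists_dual_vector {𝕜 V ι : Type*} [Field 𝕜] [AddCommGroup V] [Module 𝕜 V]
    (𝒱 : ℤ → Submodule 𝕜 V) [DirectSum.Decomposition 𝒱] (hfin : ∀ n, FiniteDimensional 𝕜 (𝒱 n))
    (ω : V →ₗ[𝕜] V →ₗ[𝕜] 𝕜) (hω : IsOddSymplectic 𝒱 ω) (e : Module.Basis ι 𝕜 V) (deg : ι → ℤ)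
    (he : ∀ i, e i ∈ 𝒱 (deg i)) [DecidableEq ι] (j : ι) :
    ∃ u : V, ∀ i, ω (e i) u = if i = j then 1 else 0 := by
  have hinj : ∀ a : ℤ, Function.Injective
      ((Submodule.dualRestrict (𝒱 a)) ∘ₗ ω.flip ∘ₗ (𝒱 (1 - a)).subtype) := by
    intro a
    rw [← LinearMap.ker_eq_bot, LinearMap.ker_eq_bot']
    intro u hu
    have h1 : ∀ x ∈ 𝒱 a, ω x u = 0 := fun x hx => by
      have := LinearMap.congr_fun hu ⟨x, hx⟩
      simpa using this
    have h2 : ∀ n, ∀ x ∈ 𝒱 n, ω x u = 0 := fun n x hx => by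
      by_cases hn : n = a
      · subst hn; exact h1 x hx
      · exact hω.degree _ _ x hx u u.2 (by omega)
    apply Subtype.ext
    apply hω.nondegenerate
    intro y
    refine eq_zero_of_homogeneous 𝒱 (ω u) (fun n x hx => ?_) y
    rw [hω.antisymm _ _ _ u.2 x hx, h2 n x hx]; simp
  have hle : ∀ a : ℤ, Module.finrank 𝕜 (𝒱 (1 - a)) ≤ Module.finrank 𝕜 (𝒱 a) := fun a => by
    have := hfin a
    have := LinearMap.finrank_le_finrank_of_injective (hinj a)
    rwa [Subspace.dual_finrank_eq] at this
  have hsurj : Function.Surjective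
      ((Submodule.dualRestrict (𝒱 (deg j))) ∘ₗ ω.flip ∘ₗ (𝒱 (1 - deg j)).subtype) := by
    have h1 := hfin (deg j)
    have h2 := hfin (1 - deg j)
    refine (LinearMap.injective_iff_surjective_of_finrank_eq_finrank ?_).1 (hinj _)
    rw [Subspace.dual_finrank_eq]
    refine le_antisymm (hle _) ?_
    have := hle (1 - deg j)
    rwa [sub_sub_cancel] at this
  obtain ⟨u, hu⟩ := hsurj (Submodule.dualRestrict (𝒱 (deg j)) (e.coord j))
  refine ⟨u, fun i => ?_⟩
  by_cases hi : deg i = deg j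
  · have := LinearMap.congr_fun hu ⟨e i, hi ▸ he i⟩
    simp [Finsupp.single_apply] at this
    simpa using this
  · rw [hω.degree _ _ _ (he i) u u.2 (by omega), if_neg]
    rintro rfl; exact hi rfl

open Classical in
/-- The inverse matrix `ω^{kj}` of `ω_{ij} = ω (e i) (e j)`: its `j`-th column consists of the
coordinates of the vector `u` with `ω (e i) u = δ_{ij}` for all `i`. -/
def invForm {𝕜 V ι : Type*} [Field 𝕜] [AddCommGroup V] [Module 𝕜 V]
    (ω : V →ₗ[𝕜] V →ₗ[𝕜] 𝕜) (e : Module.Basis ι 𝕜 V) (k j : ι) : 𝕜 :=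
  if h : ∃ u : V, ∀ i, ω (e i) u = if i = j then 1 else 0 then e.repr h.choose k else 0

/-! ## Formal functions

`φ^i`, `i : ι`, are the coordinates dual to a homogeneous basis `e i` of `V`, and `d i` is the
degree of `φ^i`, i.e. minus the degree of `e i`.  A monomial is written in increasing order of the
indices, `φ^m = ∏_{i increasing} (φ^i)^{m i}`. -/

/-- Coefficient arrays: `F g m` is the coefficient of `ħ^g φ^m`, where `g : ℤ` is the genus. -/
abbrev Fun (ι 𝕜 : Type*) := ℤ → (ι →₀ ℕ) → 𝕜

section Algebra

variable {ι 𝕜 : Type*} [LinearOrder ι] [Field 𝕜] (d : ι → ℤ)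

/-- In the graded symmetric algebra an odd coordinate occurs at most once in a monomial. -/
def Admissible (m : ι →₀ ℕ) : Prop := ∀ i, Odd (d i) → m i ≤ 1

/-- The degree of the monomial `φ^m`. -/
def monDeg (m : ι →₀ ℕ) : ℤ := m.sum fun i k => (k : ℤ) * d i

/-- The weight `2 g + n` of a monomial of genus `g` and polynomial degree `n`. -/
def weight (g : ℤ) (m : ι →₀ ℕ) : ℤ := 2 * g + (m.degree : ℤ)

/-- The array `F` only involves monomials of the graded symmetric algebra. -/
def IsGradedSymm (F : Fun ι 𝕜) : Prop := ∀ g m, F g m ≠ 0 → Admissible d m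

/-- `F` is homogeneous of degree `n`. -/
def IsHomogeneous (n : ℤ) (F : Fun ι 𝕜) : Prop := ∀ g m, F g m ≠ 0 → monDeg d m = n

/-- Every term of `F` has weight at least `w`. -/
def WeightGE (w : ℤ) (F : Fun ι 𝕜) : Prop := ∀ g m, F g m ≠ 0 → w ≤ weight g m

/-- The space of formal functions of positive weight
`∏_{w ≥ 1} ⨁_{2 g + n = w} ħ^g (V^*)^{⊙ n}` (with `g : ℤ`): only weights `w ≥ 1` occur, and each
weight component is a finite sum of monomials. -/
def IsFunPos (F : Fun ι 𝕜) : Prop :=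
  IsGradedSymm d F ∧ WeightGE 1 F ∧
    ∀ w : ℤ, {p : ℤ × (ι →₀ ℕ) | weight p.1 p.2 = w ∧ F p.1 p.2 ≠ 0}.Finite

/-- Multiplication by `ħ^k`. -/
def hbarPow (k : ℤ) (F : Fun ι 𝕜) : Fun ι 𝕜 := fun g m => F (g - k) m

/-- The constant function `1`. -/
def one : Fun ι 𝕜 := fun g m => if g = 0 ∧ m = 0 then 1 else 0

/-- The coordinate function `φ^i`. -/
def coord (i : ι) : Fun ι 𝕜 := fun g m => if g = 0 ∧ m = Finsupp.single i 1 then 1 else 0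

/-- The Koszul sign in `φ^a φ^b = ± φ^{a + b}`. -/
def koszul (a b : ι →₀ ℕ) : 𝕜 :=
  (-1) ^ (a.sum fun i p => b.sum fun j q => if j < i then (p : ℤ) * d i * ((q : ℤ) * d j) else 0)

open Classical in
/-- The graded commutative product.  The sum over the genus `h` is finite for functions whose
weights are bounded below. -/
def mul (F G : Fun ι 𝕜) : Fun ι 𝕜 := fun g m =>
  if Admissible d m then
    ∑ p ∈ Finset.HasAntidiagonal.antidiagonal m, koszul d p.1 p.2 * ∑ᶠ h : ℤ, F h p.1 * G (g - h) p.2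
  else 0

/-- Powers with respect to `mul`. -/
def pow (F : Fun ι 𝕜) : ℕ → Fun ι 𝕜
  | 0 => one
  | k + 1 => mul d F (pow F k)

/-- The exponential series.  It is used for functions `F` of nonnegative weight without constant term
of weight `0`; for these only finitely many powers contribute to each coefficient. -/
def exp (F : Fun ι 𝕜) : Fun ι 𝕜 := fun g m => ∑ᶠ k : ℕ, (k.factorial : 𝕜)⁻¹ * pow d F k g m

/-- The graded left derivative `∂_L / ∂φ^i`. -/
def dL (i : ι) (F : Fun ι 𝕜) : Fun ι 𝕜 := fun g m =>
  (-1) ^ (d i * m.sum fun j k => if j < i then (k : ℤ) * d j else 0) *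
    ((m i : 𝕜) + 1) * F g (m + Finsupp.single i 1)

/-- The graded right derivative `∂_R / ∂φ^i`. -/
def dR (i : ι) (F : Fun ι 𝕜) : Fun ι 𝕜 := fun g m =>
  (-1) ^ (d i * m.sum fun j k => if i < j then (k : ℤ) * d j else 0) *
    ((m i : 𝕜) + 1) * F g (m + Finsupp.single i 1)

/-- The BV Laplacian `Δ F = ½ ∑_{i,j} (-1)^{|φ^i|} ω^{ij} ∂_L² F / ∂φ^i ∂φ^j`, where
`P i j = ω^{ij}`. -/
def laplacian (P : ι → ι → 𝕜) (F : Fun ι 𝕜) : Fun ι 𝕜 := fun g m =>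
  2⁻¹ * ∑ᶠ p : ι × ι, (-1) ^ d p.1 * P p.1 p.2 * dL d p.1 (dL d p.2 F) g m

/-- The BV bracket `{F, G} = ∑_{i,j} (∂_R F / ∂φ^i) ω^{ij} (∂_L G / ∂φ^j)`. -/
def bracket (P : ι → ι → 𝕜) (F G : Fun ι 𝕜) : Fun ι 𝕜 := fun g m =>
  ∑ᶠ p : ι × ι, P p.1 p.2 * mul d (dR d p.1 F) (dL d p.2 G) g m

/-- The operator `{S_free, -} + ħ Δ`. -/
def twisted (P : ι → ι → 𝕜) (Sfree F : Fun ι 𝕜) : Fun ι 𝕜 :=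
  bracket d P Sfree F + hbarPow 1 (laplacian d P F)

/-- The quantum master equation `2 ħ Δ S + {S, S} = 0`. -/
def MasterEquation (P : ι → ι → 𝕜) (S : Fun ι 𝕜) : Prop :=
  2 • hbarPow 1 (laplacian d P S) + bracket d P S S = 0

/-- `Sfree` is a kinetic term: a degree `0` element of `(V^*)^{⊙ 2}`, in genus `0`. -/
def IsKinetic (Sfree : Fun ι 𝕜) : Prop :=
  IsGradedSymm d Sfree ∧ IsHomogeneous d 0 Sfree ∧
    (∀ g m, Sfree g m ≠ 0 → g = 0 ∧ m.degree = 2) ∧ {m | Sfree 0 m ≠ 0}.Finite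

/-- `Sint` is an interaction term relative to `Sfree`: it has degree `0`, `Sint / ħ` is a formal
function of positive weight, and `Sfree + Sint` solves the quantum master equation. -/
def IsAction (P : ι → ι → 𝕜) (Sfree Sint : Fun ι 𝕜) : Prop :=
  IsHomogeneous d 0 Sint ∧ IsFunPos d (hbarPow (-1) Sint) ∧ MasterEquation d P (Sfree + Sint)

/-! ## Differential forms on the interval with values in formal functions

At a time `t` a form `a(t) + b(t) dt` is given by the pair `(a(t), b(t))`; `dt` is odd. -/

/-- The parity operator `F ↦ (-1)^{|F|} F`. -/
def parity (F : Fun ι 𝕜) : Fun ι 𝕜 := fun g m => (-1) ^ monDeg d m * F g m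

/-- `(a + b dt) (a' + b' dt) = a a' + (a b' + (-1)^{|a'|} b a') dt`. -/
def formMul (x y : Fun ι 𝕜 × Fun ι 𝕜) : Fun ι 𝕜 × Fun ι 𝕜 :=
  (mul d x.1 y.1, mul d x.1 y.2 + mul d x.2 (parity d y.1))

/-- Powers with respect to `formMul`. -/
def formPow (x : Fun ι 𝕜 × Fun ι 𝕜) : ℕ → Fun ι 𝕜 × Fun ι 𝕜
  | 0 => (one, 0)
  | k + 1 => formMul d x (formPow x k)

/-- The exponential of a form. -/
def formExp (x : Fun ι 𝕜 × Fun ι 𝕜) : Fun ι 𝕜 × Fun ι 𝕜 :=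
  (fun g m => ∑ᶠ k : ℕ, (k.factorial : 𝕜)⁻¹ * (formPow d x k).1 g m,
   fun g m => ∑ᶠ k : ℕ, (k.factorial : 𝕜)⁻¹ * (formPow d x k).2 g m)

/-! ## Formal diffeomorphisms and half-densities

A formal map `Φ : V → V` is given by the functions `f i = Φ^* φ^i`. -/

/-- `Φ` is a (degree preserving) formal map of the form `1 + (terms of positive weight)`: the
difference `Φ - 1` is an element of `∏_{w ≥ 2} (⨁_{2 g + n = w} ħ^g (V^*)^{⊙ n}) ⊗ V`, i.e.
`Φ^* φ^i - φ^i` has weight larger than the weight `1` of `φ^i`, and `Φ - 1` is a finite sum in each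
weight.  Such a map is automatically invertible. -/
def IsUnipotent (f : ι → Fun ι 𝕜) : Prop :=
  (∀ i, IsGradedSymm d (f i) ∧ IsHomogeneous d (d i) (f i) ∧ WeightGE 2 (f i - coord i)) ∧
    ∀ w : ℤ, {p : ι × ℤ × (ι →₀ ℕ) |
      weight p.2.1 p.2.2 = w ∧ f p.1 p.2.1 p.2.2 ≠ coord p.1 p.2.1 p.2.2}.Finite

/-- `Φ` is symplectic: it preserves the bivector `ω^{ij}`. -/
def IsSymplectic (P : ι → ι → 𝕜) (f : ι → Fun ι 𝕜) : Prop :=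
  ∀ i j, bracket d P (f i) (f j) = P i j • one

/-- `Φ^* φ^a`, the ordered product of the powers `(f i)^{a i}`. -/
def pullMon (f : ι → Fun ι 𝕜) (a : ι →₀ ℕ) : Fun ι 𝕜 :=
  (a.support.sort (· ≤ ·)).foldr (fun i F => mul d (pow d (f i) (a i)) F) one

/-- The pullback `Φ^* F` of a function: `ħ^h φ^a ↦ ħ^h Φ^* φ^a`. -/
def pullback (f : ι → Fun ι 𝕜) (F : Fun ι 𝕜) : Fun ι 𝕜 := fun g m =>
  ∑ᶠ p : ℤ × (ι →₀ ℕ), F p.1 p.2 * pullMon d f p.2 (g - p.1) m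

/-- The entries `∂_L f^j / ∂φ^i - δ_i^j` of `∂Φ - 1`. -/
def jacobianSubOne (f : ι → Fun ι 𝕜) (i j : ι) : Fun ι 𝕜 :=
  dL d i (f j) - if i = j then one else 0

/-- Powers of a matrix of formal functions. -/
def matPow (N : ι → ι → Fun ι 𝕜) : ℕ → ι → ι → Fun ι 𝕜
  | 0 => fun i j => if i = j then one else 0
  | k + 1 => fun i j g m => ∑ᶠ l : ι, mul d (N i l) (matPow N k l j) g m

/-- The supertrace `∑_i (-1)^{|φ^i|} M_{ii}`. -/
def supertrace (M : ι → ι → Fun ι 𝕜) : Fun ι 𝕜 := fun g m =>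
  ∑ᶠ i : ι, (-1) ^ d i * M i i g m

/-- `str log ∂Φ = ∑_{k ≥ 1} (-1)^{k+1} / k · str ((∂Φ - 1)^k)`. -/
def strLogJacobian (f : ι → Fun ι 𝕜) : Fun ι 𝕜 := fun g m =>
  ∑ᶠ k : ℕ, (-1) ^ k * ((k : 𝕜) + 1)⁻¹ * supertrace d (matPow d (jacobianSubOne d f) (k + 1)) g m

/-- The power `Ber(∂Φ)^c` of the Berezinian `Ber(∂Φ) = exp (str (log ∂Φ))`. -/
def berezinianPow (c : 𝕜) (f : ι → Fun ι 𝕜) : Fun ι 𝕜 := exp d (c • strLogJacobian d f)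

/-- The pullback of half-densities
`Φ^* (F d^{1/2}V) = Φ^* F · Ber(∂Φ)^{1/2} d^{1/2}V`; a half-density `F d^{1/2}V` is represented by
its coefficient `F`. -/
def pullbackHalfDensity (f : ι → Fun ι 𝕜) (F : Fun ι 𝕜) : Fun ι 𝕜 :=
  mul d (pullback d f F) (berezinianPow d 2⁻¹ f)

end Algebra

/-! ## Homotopies -/

section Homotopy

variable {ι 𝕜 : Type*} [LinearOrder ι] [RCLike 𝕜] (d : ι → ℤ)

/-- The family `F t`, `t ∈ [0, 1]`, is an element of `∏_{w ≥ 1} (⨁_{2 g + n = w} ħ^g (V^*)^{⊙ n}) ⊗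
C^∞([0, 1])`: its coefficients are smooth, and in each weight only finitely many monomials occur. -/
def IsFunPosFamily (F : ℝ → Fun ι 𝕜) : Prop :=
  (∀ t ∈ Set.Icc (0 : ℝ) 1, IsGradedSymm d (F t) ∧ WeightGE 1 (F t)) ∧
  (∀ g m, ContDiffOn ℝ (⊤ : ℕ∞) (fun t => F t g m) (Set.Icc 0 1)) ∧
  ∀ w : ℤ, {p : ℤ × (ι →₀ ℕ) |
    weight p.1 p.2 = w ∧ ∃ t ∈ Set.Icc (0 : ℝ) 1, F t p.1 p.2 ≠ 0}.Finite

/-- The time derivative on `[0, 1]`. -/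
def timeDeriv (F : ℝ → Fun ι 𝕜) (t : ℝ) : Fun ι 𝕜 := fun g m =>
  derivWithin (fun s => F s g m) (Set.Icc 0 1) t

/-- The differential `{S_free, -} + ħ Δ + d_dR` of the form `a(t) + b(t) dt`, at time `t`, where
`d_dR (a(t)) = (-1)^{|a|} a'(t) dt`. -/
def formDiff (P : ι → ι → 𝕜) (Sfree : Fun ι 𝕜) (E : ℝ → Fun ι 𝕜 × Fun ι 𝕜) (t : ℝ) :
    Fun ι 𝕜 × Fun ι 𝕜 :=
  (twisted d P Sfree (E t).1,
   twisted d P Sfree (E t).2 + parity d (timeDeriv (fun s => (E s).1) t))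

/-- `exp ((A(t) + B(t) dt) / ħ)` is a homotopy. -/
def IsHomotopy (P : ι → ι → 𝕜) (Sfree : Fun ι 𝕜) (A B : ℝ → Fun ι 𝕜) : Prop :=
  IsFunPosFamily d (fun t => hbarPow (-1) (A t)) ∧
  IsFunPosFamily d (fun t => hbarPow (-1) (B t)) ∧
  (∀ t ∈ Set.Icc (0 : ℝ) 1, IsHomogeneous d 0 (A t) ∧ IsHomogeneous d (-1) (B t)) ∧
  ∀ t ∈ Set.Icc (0 : ℝ) 1,
    formDiff d P Sfree (fun s => formExp d (hbarPow (-1) (A s), hbarPow (-1) (B s))) t = 0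

end Homotopy

end QuantumBV

end

set_option linter.unusedSectionVars false
set_option linter.unnecessarySeqFocus false
set_option linter.style.longLine false

noncomputable section

namespace QuantumBV

/-! ### Completed graded commutative algebras of formal functions and their level topology -/

section Completed

variable {ι 𝕜 : Type*} [LinearOrder ι] [Field 𝕜]

/-! ## Completed algebras of formal functions -/

/-! Write `D = {S_free, -} + ħ Δ` and `x_i = exp (S_i / ħ)`. Since `S_free` is the lowest weight
part of an action, it solves the master equation by itself (`isMaster_kinetic`). Hence `D² = 0`,
because `D` is `ħ` times the conjugate of `Δ` by `exp (S_free / ħ)` (`tw_tw`), and the master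
equation for `S_free + S_i` becomes the linear statement `D x_i = 0` (`tw_expC`). All three
conditions then say that `x_0 - x_1` is `D`-exact with a primitive of positive weight. As `x_0 -
x_1` has degree `0`, the primitive may be taken of degree `-1` (`tw_dcomp`).

Homotopies. If `x_0 - x_1 = D F`, the segment `x(t) = x_0 + t (x_1 - x_0)` consists of closed
functions with leading term `1`, and `x(t) + F dt` is the exponential of `(A + B dt) / ħ` with `A /
ħ = log x(t)` and `B / ħ = x(t)⁻¹ F`. Conversely, the exponential of a homotopy is `x(t) + y(t) dt`
with `D y = -x'`, and `F = ∫ y dt` is a primitive of `x_0 - x_1`.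

Symplectic maps. Flows are treated without a time variable. Let `E` be the Euler operator, which
multiplies a monomial by its weight. Rescaling by weight joins a unipotent map `f` to the identity,
and the flow equation of this path is encoded by `(E - {H, -}) f^i = f^i`. A function `H` of degree
`-1` and weight at least `3` generates a unipotent symplectic map in this sense
(`exists_unip_of_ham`), and every such map arises in this way, by a Poincaré lemma
(`exists_ham_of_unip`). Existence of solutions comes from a fixed point theorem for maps raising the
level (`exists_fixedPoint`), uniqueness from the invertibility of `E - w` on weights above `w`
(`eq_of_eul`).

Dividing the pulled back half-density by `exp (S_free / ħ)` gives an operator `T` (`transport`) with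
`E T = T E + L_K T`, where `K = H / ħ` and `L_K = ħ {K, -} - (D K) = -[D, K]` (`eul_transport`). The
divergence of the vector field of `H` is `-2 Δ H`, so the square root of the Berezinian contributes
exactly the term `-Δ H` contained in `-D K`. If `x_w` is the weight `w` part of a closed function
`x`, then `u_w = T x_w` solves `(E - w) u_w = L_K u_w` with leading part `x_w`. It is again closed,
so `(E - w) u_w = -D (K u_w)`. As `D` preserves weight, `u_w - x_w = D (E - w)⁻¹ (-K u_w)`, and
summing over `w` shows that `T x - x` is exact (`tsum_sub_eq_tw`). This proves that 3 implies 1.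

For the converse, given `F`, the equations for all `u_w` and the equation `∑_w (E - w)⁻¹ (-K u_w) =
F` are solved together for `K` and the `u_w` (`exists_flow_of_exact`). This is possible since `x`
has leading term `1`, so that `K` is determined by `F` up to corrections of higher weight. The map
generated by `H = ħ K` satisfies `T x_w = u_w` by uniqueness, whence `T x - x = D F`.

Two completions are needed. By weight `2 g + n`, the function `S_free / ħ` has weight zero and no
exponential series; by `g + n` it has level one. The half-densities live in the second completion,
and after division by `exp (S_free / ħ)` everything takes place in the first. -/

/-- The level `c g + n` of a monomial of genus `g` and polynomial degree `n`; for `c = 2` this is the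
weight. -/
def level (c g : ℤ) (m : ι →₀ ℕ) : ℤ := c * g + (m.degree : ℤ)

theorem level_add (c g h : ℤ) (a b : ι →₀ ℕ) :
    level c (g + h) (a + b) = level c g a + level c h b := by
  simp only [level, map_add, Nat.cast_add]; ring

theorem level_two (g : ℤ) (m : ι →₀ ℕ) : level 2 g m = weight g m := rfl

/-- Only finitely many monomials of `F` lie below any given level. -/
def LevelFinite (c : ℤ) (F : Fun ι 𝕜) : Prop :=
  ∀ k : ℤ, {p : ℤ × (ι →₀ ℕ) | level c p.1 p.2 ≤ k ∧ F p.1 p.2 ≠ 0}.Finite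

/-- Only finitely many monomials have level at most `0`, and all others have positive level. The
lower bound is what makes products locally finite although the genus may be negative. -/
theorem LevelFinite.exists_bound {c : ℤ} {F : Fun ι 𝕜} (hF : LevelFinite c F) :
    ∃ k : ℤ, ∀ g m, F g m ≠ 0 → k ≤ level c g m := by
  obtain ⟨k, hk⟩ := ((hF 0).image fun p => level c p.1 p.2).bddBelow
  refine ⟨min k 0, fun g m h => ?_⟩
  by_cases h0 : level c g m ≤ 0
  · exact (min_le_left _ _).trans (hk ⟨(g, m), ⟨h0, h⟩, rfl⟩)
  · exact (min_le_right _ _).trans (by omega)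

/-- The space of formal functions with finitely many monomials below each level. -/
def completedSubmodule (𝕜 : Type*) [Field 𝕜] (c : ℤ) (d : ι → ℤ) : Submodule 𝕜 (Fun ι 𝕜) where
  carrier := {F | IsGradedSymm d F ∧ LevelFinite c F}
  zero_mem' := ⟨fun g m h => absurd rfl h, fun k => by simp⟩
  add_mem' := by
    rintro F G ⟨hF, hF'⟩ ⟨hG, hG'⟩
    have key : ∀ g m, (F + G) g m ≠ 0 → F g m ≠ 0 ∨ G g m ≠ 0 := fun g m h => by
      by_contra hc
      push Not at hc
      exact h (by simp [hc.1, hc.2])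
    refine ⟨fun g m h => (key g m h).elim (hF g m) (hG g m), fun k => ?_⟩
    refine ((hF' k).union (hG' k)).subset fun p hp => ?_
    exact (key _ _ hp.2).imp (fun h => ⟨hp.1, h⟩) fun h => ⟨hp.1, h⟩
  smul_mem' := by
    rintro x F ⟨hF, hF'⟩
    have key : ∀ g m, (x • F) g m ≠ 0 → F g m ≠ 0 := fun g m h hc => h (by simp [hc])
    exact ⟨fun g m h => hF g m (key g m h),
      fun k => (hF' k).subset fun p hp => ⟨hp.1, key _ _ hp.2⟩⟩

/-- The completed algebra of formal functions, with respect to the level `c g + n`. -/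
structure Completed (𝕜 : Type*) [Field 𝕜] (c : ℤ) (d : ι → ℤ) where
  /-- the coefficient array -/
  val : Fun ι 𝕜
  isGradedSymm : IsGradedSymm d val
  isLevelFinite : LevelFinite c val

namespace Completed

variable {c : ℤ} {d : ι → ℤ}

/-- Formal functions as elements of a submodule of all coefficient arrays. -/
def equivSubmodule : Completed 𝕜 c d ≃ completedSubmodule 𝕜 c d where
  toFun a := ⟨a.val, a.isGradedSymm, a.isLevelFinite⟩
  invFun a := ⟨a.1, a.2.1, a.2.2⟩
  left_inv _ := rfl
  right_inv _ := rfl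

instance : AddCommGroup (Completed 𝕜 c d) := equivSubmodule.addCommGroup
instance : Module 𝕜 (Completed 𝕜 c d) := equivSubmodule.module 𝕜

theorem val_injective : Function.Injective (val : Completed 𝕜 c d → Fun ι 𝕜) := by
  rintro ⟨a, _, _⟩ ⟨b, _, _⟩ h
  cases h
  rfl

theorem gradedSymm (a : Completed 𝕜 c d) : IsGradedSymm d a.1 := a.2
theorem levelFinite (a : Completed 𝕜 c d) : LevelFinite c a.1 := a.3

@[ext] theorem ext {a b : Completed 𝕜 c d} (h : ∀ g m, a.1 g m = b.1 g m) : a = b :=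
  val_injective (funext fun g => funext fun m => h g m)

@[simp] theorem val_add (a b : Completed 𝕜 c d) : (a + b).1 = a.1 + b.1 := rfl
@[simp] theorem val_sub (a b : Completed 𝕜 c d) : (a - b).1 = a.1 - b.1 := rfl
@[simp] theorem val_neg (a : Completed 𝕜 c d) : (-a).1 = -a.1 := rfl
@[simp] theorem val_zero : (0 : Completed 𝕜 c d).1 = 0 := rfl
@[simp] theorem val_smul (x : 𝕜) (a : Completed 𝕜 c d) : (x • a).1 = x • a.1 := rfl

/-- Evaluation of a coefficient. -/
def coeff (g : ℤ) (m : ι →₀ ℕ) : Completed 𝕜 c d →ₗ[𝕜] 𝕜 where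
  toFun a := a.1 g m
  map_add' _ _ := rfl
  map_smul' _ _ := rfl

theorem val_sum {α : Type*} (s : Finset α) (f : α → Completed 𝕜 c d) (g : ℤ) (m : ι →₀ ℕ) :
    (∑ i ∈ s, f i).1 g m = ∑ i ∈ s, (f i).1 g m :=
  map_sum (coeff g m) f s

/-- The functions all of whose terms have level at least `k`. -/
def fil (k : ℤ) : Submodule 𝕜 (Completed 𝕜 c d) where
  carrier := {a | ∀ g m, a.1 g m ≠ 0 → k ≤ level c g m}
  zero_mem' := fun g m h => absurd rfl h
  add_mem' := fun {a b} ha hb g m h => by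
    by_cases h1 : a.1 g m = 0
    · exact hb g m fun h2 => h (by simp [h1, h2])
    · exact ha g m h1
  smul_mem' := fun x a ha g m h => ha g m fun h2 => h (by simp [h2])

theorem mem_fil {k : ℤ} {a : Completed 𝕜 c d} :
    a ∈ fil k ↔ ∀ g m, a.1 g m ≠ 0 → k ≤ level c g m := Iff.rfl

theorem mem_fil' {k : ℤ} {a : Completed 𝕜 c d} :
    a ∈ fil k ↔ ∀ g m, level c g m < k → a.1 g m = 0 := by
  refine forall₂_congr fun g m => ?_
  rw [← not_imp_not, not_le, not_not]

theorem fil_anti {k l : ℤ} (h : k ≤ l) : (fil l : Submodule 𝕜 (Completed 𝕜 c d)) ≤ fil k :=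
  fun _ ha g m hm => h.trans (ha g m hm)

theorem exists_mem_fil (a : Completed 𝕜 c d) : ∃ k, a ∈ fil k := a.levelFinite.exists_bound

theorem eq_zero_of_forall_mem_fil {a : Completed 𝕜 c d} (h : ∀ k, a ∈ fil k) : a = 0 := by
  ext g m
  exact mem_fil'.1 (h (level c g m + 1)) g m (by omega)

theorem eq_of_forall_sub_mem_fil {a b : Completed 𝕜 c d} (h : ∀ k, a - b ∈ fil k) : a = b :=
  sub_eq_zero.1 (eq_zero_of_forall_mem_fil h)

/-! ### Monomials -/

open Classical in
/-- The function `x ħ^g φ^m` (which is zero if `m` is not admissible). -/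
def mon (c : ℤ) (d : ι → ℤ) (g : ℤ) (m : ι →₀ ℕ) (x : 𝕜) : Completed 𝕜 c d where
  val g' m' := if Admissible d m ∧ g' = g ∧ m' = m then x else 0
  isGradedSymm g' m' h := by
    by_cases hc : Admissible d m ∧ g' = g ∧ m' = m
    · rw [hc.2.2]; exact hc.1
    · simp [hc] at h
  isLevelFinite k := by
    refine (Set.finite_singleton (g, m)).subset fun p hp => ?_
    by_cases hc : Admissible d m ∧ p.1 = g ∧ p.2 = m
    · exact Prod.ext hc.2.1 hc.2.2
    · exact absurd (if_neg hc) hp.2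

open Classical in
theorem mon_val (g : ℤ) (m : ι →₀ ℕ) (x : 𝕜) (g' : ℤ) (m' : ι →₀ ℕ) :
    (mon c d g m x).1 g' m' = if Admissible d m ∧ g' = g ∧ m' = m then x else 0 := rfl

theorem mon_of_not_admissible {m : ι →₀ ℕ} (h : ¬ Admissible d m) (g : ℤ) (x : 𝕜) :
    mon c d g m x = 0 := by
  ext g' m'
  simp [mon_val, h]

theorem mon_mem_fil (g : ℤ) (m : ι →₀ ℕ) (x : 𝕜) : mon c d g m x ∈ fil (level c g m) := by
  intro g' m' h
  rw [mon_val] at h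
  split_ifs at h with hc
  · rw [hc.2.1, hc.2.2]
  · simp at h

@[simp] theorem mon_zero (g : ℤ) (m : ι →₀ ℕ) : mon c d g m (0 : 𝕜) = 0 := by
  ext g' m'; simp [mon_val]

theorem smul_mon (y : 𝕜) (g : ℤ) (m : ι →₀ ℕ) (x : 𝕜) :
    y • mon c d g m x = mon c d g m (y * x) := by
  ext g' m'
  simp only [val_smul, Pi.smul_apply, mon_val, smul_eq_mul]
  split_ifs <;> simp

theorem mon_add (g : ℤ) (m : ι →₀ ℕ) (x y : 𝕜) :
    mon c d g m (x + y) = mon c d g m x + mon c d g m y := by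
  ext g' m'
  simp only [val_add, Pi.add_apply, mon_val]
  split_ifs <;> simp

/-- Finite sums of monomials are dense in the level topology. With boundedness of the operators this
reduces identities between them to identities on monomials. -/
theorem exists_finset_approx (a : Completed 𝕜 c d) (k : ℤ) :
    ∃ s : Finset (ℤ × (ι →₀ ℕ)), (∀ p ∈ s, level c p.1 p.2 < k ∧ a.1 p.1 p.2 ≠ 0) ∧
      a - ∑ p ∈ s, mon c d p.1 p.2 (a.1 p.1 p.2) ∈ fil k := by
  classical
  refine ⟨(a.levelFinite (k - 1)).toFinset, fun p hp => ?_, mem_fil'.2 fun g m h => ?_⟩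
  · have := (Set.Finite.mem_toFinset _).1 hp
    exact ⟨by have := this.1; omega, this.2⟩
  · simp only [val_sub, Pi.sub_apply]
    rw [val_sum]
    simp only [mon_val]
    by_cases h0 : a.1 g m = 0
    · rw [h0, Finset.sum_eq_zero, sub_zero]
      intro p hp
      split_ifs with hc
      · rw [← hc.2.1, ← hc.2.2, h0]
      · rfl
    · rw [Finset.sum_eq_single (g, m)]
      · simp [a.gradedSymm g m h0]
      · intro p hp hne
        rw [if_neg]
        rintro ⟨-, h1, h2⟩
        exact hne (Prod.ext h1.symm h2.symm)
      · intro hn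
        rw [Set.Finite.mem_toFinset] at hn
        exact absurd ⟨show level c g m ≤ k - 1 by omega, h0⟩ hn

/-- A map shifts levels by a bounded amount. -/
def IsBounded {c' : ℤ} (L : Completed 𝕜 c d → Completed 𝕜 c' d) : Prop :=
  ∀ k : ℤ, ∃ l : ℤ, ∀ a : Completed 𝕜 c d, a ∈ fil l → L a ∈ fil k

/-- Two bounded additive maps agree if they agree on monomials. -/
theorem addMonoidHom_ext {c' : ℤ} {L L' : Completed 𝕜 c d →+ Completed 𝕜 c' d}
    (hL : IsBounded L) (hL' : IsBounded L')
    (h : ∀ g m x, Admissible d m → L (mon c d g m x) = L' (mon c d g m x)) : L = L' := by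
  ext1 a
  refine eq_of_forall_sub_mem_fil fun k => ?_
  obtain ⟨l, hl⟩ := hL k
  obtain ⟨l', hl'⟩ := hL' k
  obtain ⟨s, hs, hs'⟩ := a.exists_finset_approx (max l l')
  have h1 : L a - L' a = L (a - ∑ p ∈ s, mon c d p.1 p.2 (a.1 p.1 p.2))
      - L' (a - ∑ p ∈ s, mon c d p.1 p.2 (a.1 p.1 p.2)) := by
    simp only [map_sub, map_sum]
    rw [Finset.sum_congr rfl fun p hp => h p.1 p.2 _ (a.gradedSymm _ _ (hs p hp).2)]
    abel
  rw [h1]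
  exact sub_mem (hl _ (fil_anti (le_max_left _ _) hs')) (hl' _ (fil_anti (le_max_right _ _) hs'))

end Completed

/-! ### The product -/

/-- The exponent of the Koszul sign. -/
def koszulExp (d : ι → ℤ) (a b : ι →₀ ℕ) : ℤ :=
  a.sum fun i p => b.sum fun j q => if j < i then (p : ℤ) * d i * ((q : ℤ) * d j) else 0

theorem koszul_eq (d : ι → ℤ) (a b : ι →₀ ℕ) : koszul (𝕜 := 𝕜) d a b = (-1) ^ koszulExp d a b := rfl

theorem koszulExp_add_left (d : ι → ℤ) (a a' b : ι →₀ ℕ) :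
    koszulExp d (a + a') b = koszulExp d a b + koszulExp d a' b := by
  refine Finsupp.sum_add_index' (fun i => ?_) fun i p q => ?_
  · simp [Finsupp.sum]
  · rw [← Finsupp.sum_add]
    refine Finsupp.sum_congr fun j _ => ?_
    split_ifs <;> push_cast <;> ring

theorem koszulExp_add_right (d : ι → ℤ) (a b b' : ι →₀ ℕ) :
    koszulExp d a (b + b') = koszulExp d a b + koszulExp d a b' := by
  unfold koszulExp
  rw [← Finsupp.sum_add]
  refine Finsupp.sum_congr fun i _ => Finsupp.sum_add_index' (fun j => ?_) fun j p q => ?_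
  · simp
  · split_ifs <;> push_cast <;> ring

theorem koszul_add_left (d : ι → ℤ) (a a' b : ι →₀ ℕ) :
    koszul (𝕜 := 𝕜) d (a + a') b = koszul d a b * koszul d a' b := by
  simp only [koszul_eq, koszulExp_add_left]
  exact zpow_add₀ (by simp) _ _

theorem koszul_add_right (d : ι → ℤ) (a b b' : ι →₀ ℕ) :
    koszul (𝕜 := 𝕜) d a (b + b') = koszul d a b * koszul d a b' := by
  simp only [koszul_eq, koszulExp_add_right]
  exact zpow_add₀ (by simp) _ _

@[simp] theorem koszul_zero_left (d : ι → ℤ) (b : ι →₀ ℕ) : koszul (𝕜 := 𝕜) d 0 b = 1 := by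
  simp [koszul]

@[simp] theorem koszul_zero_right (d : ι → ℤ) (b : ι →₀ ℕ) : koszul (𝕜 := 𝕜) d b 0 = 1 := by
  simp [koszul, Finsupp.sum]

theorem neg_one_zpow_mul_self (n : ℤ) : ((-1 : 𝕜) ^ n) * (-1) ^ n = 1 := by
  rw [← mul_zpow]; simp

theorem koszul_mul_self (d : ι → ℤ) (a b : ι →₀ ℕ) :
    koszul (𝕜 := 𝕜) d a b * koszul d a b = 1 := neg_one_zpow_mul_self _

theorem Admissible.of_add_left {d : ι → ℤ} {a b : ι →₀ ℕ} (h : Admissible d (a + b)) :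
    Admissible d a := fun i hi => (Nat.le_add_right _ _).trans (h i hi)

theorem Admissible.of_add_right {d : ι → ℤ} {a b : ι →₀ ℕ} (h : Admissible d (a + b)) :
    Admissible d b := fun i hi => (Nat.le_add_left _ _).trans (h i hi)

theorem mul_ne_zero_exists {d : ι → ℤ} {F G : Fun ι 𝕜} {g : ℤ} {m : ι →₀ ℕ} (h : mul d F G g m ≠ 0) :
    Admissible d m ∧ ∃ g₁ g₂ a b, g₁ + g₂ = g ∧ a + b = m ∧ F g₁ a ≠ 0 ∧ G g₂ b ≠ 0 := by
  unfold mul at h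
  split_ifs at h with hm
  · refine ⟨hm, ?_⟩
    obtain ⟨p, hp, hp'⟩ := Finset.exists_ne_zero_of_sum_ne_zero h
    obtain ⟨h, hh⟩ : ∃ h : ℤ, F h p.1 * G (g - h) p.2 ≠ 0 := by
      by_contra hc
      push Not at hc
      exact right_ne_zero_of_mul hp' (by simp only [hc, finsum_zero])
    exact ⟨h, g - h, p.1, p.2, by ring, Finset.HasAntidiagonal.mem_antidiagonal.1 hp, left_ne_zero_of_mul hh,
      right_ne_zero_of_mul hh⟩
  · simp at h

theorem mul_gradedSymm (d : ι → ℤ) (F G : Fun ι 𝕜) : IsGradedSymm d (mul d F G) :=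
  fun _ _ h => (mul_ne_zero_exists h).1

theorem LevelFinite.mul {c : ℤ} {d : ι → ℤ} {F G : Fun ι 𝕜} (hF : LevelFinite c F)
    (hG : LevelFinite c G) : LevelFinite c (mul d F G) := by
  obtain ⟨kF, hkF⟩ := hF.exists_bound
  obtain ⟨kG, hkG⟩ := hG.exists_bound
  intro k
  refine (((hF (k - kG)).prod (hG (k - kF))).image
    fun p : (ℤ × (ι →₀ ℕ)) × (ℤ × (ι →₀ ℕ)) => p.1 + p.2).subset ?_
  rintro ⟨g, m⟩ ⟨hp, hp'⟩
  obtain ⟨-, g₁, g₂, a, b, rfl, rfl, ha, hb⟩ := mul_ne_zero_exists hp'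
  simp only [level_add] at hp
  have h1 := hkF _ _ ha
  have h2 := hkG _ _ hb
  exact ⟨((g₁, a), (g₂, b)), ⟨⟨by simp only; omega, ha⟩, ⟨by simp only; omega, hb⟩⟩, rfl⟩

/-- The genus sum in `mul` is a `finsum`, which is zero by convention on infinite support. The lower
bound for the levels of `G` bounds the levels of the contributing terms of `F` from above, so the
sum is a genuine one and is additive. -/
theorem LevelFinite.mul_support_finite {c : ℤ} {F G : Fun ι 𝕜} (hF : LevelFinite c F)
    (hG : LevelFinite c G) (g : ℤ) (a b : ι →₀ ℕ) :
    (Function.support fun h : ℤ => F h a * G (g - h) b).Finite := by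
  obtain ⟨kG, hkG⟩ := hG.exists_bound
  refine ((hF (level c g (a + b) - kG)).image Prod.fst).subset fun h hh => ?_
  have h1 := hkG _ _ (right_ne_zero_of_mul hh)
  have h2 := level_add c h (g - h) a b
  rw [add_sub_cancel] at h2
  exact ⟨(h, a), ⟨by simp only; omega, left_ne_zero_of_mul hh⟩, rfl⟩

namespace Completed

variable {c : ℤ} {d : ι → ℤ}

instance : Mul (Completed 𝕜 c d) :=
  ⟨fun a b => ⟨mul d a.1 b.1, mul_gradedSymm d _ _, a.levelFinite.mul b.levelFinite⟩⟩

@[simp] theorem val_mul (a b : Completed 𝕜 c d) : (a * b).1 = mul d a.1 b.1 := rfl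

theorem mul_add_aux (a b b' : Completed 𝕜 c d) : a * (b + b') = a * b + a * b' := by
  ext g m
  simp only [val_mul, val_add, Pi.add_apply, mul]
  split_ifs
  · rw [← Finset.sum_add_distrib]
    refine Finset.sum_congr rfl fun p _ => ?_
    rw [← _root_.mul_add, ← finsum_add_distrib (a.levelFinite.mul_support_finite b.levelFinite _ _ _)
      (a.levelFinite.mul_support_finite b'.levelFinite _ _ _)]
    simp only [_root_.mul_add]
  · simp

theorem add_mul_aux (a a' b : Completed 𝕜 c d) : (a + a') * b = a * b + a' * b := by
  ext g m
  simp only [val_mul, val_add, Pi.add_apply, mul]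
  split_ifs
  · rw [← Finset.sum_add_distrib]
    refine Finset.sum_congr rfl fun p _ => ?_
    rw [← _root_.mul_add, ← finsum_add_distrib (a.levelFinite.mul_support_finite b.levelFinite _ _ _)
      (a'.levelFinite.mul_support_finite b.levelFinite _ _ _)]
    simp only [_root_.add_mul]
  · simp

theorem mul_mem_fil {k l : ℤ} {a b : Completed 𝕜 c d} (ha : a ∈ fil k) (hb : b ∈ fil l) :
    a * b ∈ fil (k + l) := by
  intro g m h
  obtain ⟨-, g₁, g₂, m₁, m₂, rfl, rfl, h1, h2⟩ := mul_ne_zero_exists h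
  rw [level_add]
  exact add_le_add (ha _ _ h1) (hb _ _ h2)

/-- Left multiplication, as an additive map. -/
def mulL (a : Completed 𝕜 c d) : Completed 𝕜 c d →+ Completed 𝕜 c d :=
  AddMonoidHom.mk' (fun b => a * b) (mul_add_aux a)

/-- Right multiplication, as an additive map. -/
def mulR (b : Completed 𝕜 c d) : Completed 𝕜 c d →+ Completed 𝕜 c d :=
  AddMonoidHom.mk' (fun a => a * b) fun a a' => add_mul_aux a a' b

theorem isBounded_mulL (a : Completed 𝕜 c d) : IsBounded (mulL a) := by
  obtain ⟨l, hl⟩ := a.exists_mem_fil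
  exact fun k => ⟨k - l, fun b hb => by
    have := mul_mem_fil hl hb
    rwa [add_sub_cancel] at this⟩

theorem isBounded_mulR (a : Completed 𝕜 c d) : IsBounded (mulR a) := by
  obtain ⟨l, hl⟩ := a.exists_mem_fil
  exact fun k => ⟨k - l, fun b hb => by
    have := mul_mem_fil hb hl
    rwa [sub_add_cancel] at this⟩

theorem IsBounded.comp {c₁ c₂ c₃ : ℤ} {L : Completed 𝕜 c₂ d → Completed 𝕜 c₃ d}
    {L' : Completed 𝕜 c₁ d → Completed 𝕜 c₂ d} (hL : IsBounded L) (hL' : IsBounded L') :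
    IsBounded (L ∘ L') := fun k => by
  obtain ⟨l, hl⟩ := hL k
  obtain ⟨l', hl'⟩ := hL' l
  exact ⟨l', fun a ha => hl _ (hl' _ ha)⟩

/-- As `mon` vanishes on inadmissible exponents, the formula holds without case distinction. The
ring laws follow from it because the Koszul exponent is biadditive. -/
theorem mon_mul_mon (g h : ℤ) (a b : ι →₀ ℕ) (x y : 𝕜) :
    mon c d g a x * mon c d h b y = mon c d (g + h) (a + b) (koszul d a b * (x * y)) := by
  classical
  by_cases ha : Admissible d a
  swap
  · rw [mon_of_not_admissible ha, mon_of_not_admissible fun h => ha h.of_add_left]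
    exact map_zero (mulR (mon c d h b y))
  by_cases hb : Admissible d b
  swap
  · rw [mon_of_not_admissible hb, mon_of_not_admissible fun h => hb h.of_add_right]
    exact map_zero (mulL (mon c d g a x))
  ext g' m'
  simp only [val_mul, mul, mon_val, ha, hb, true_and]
  by_cases hm : Admissible d m'
  swap
  · rw [if_neg hm, if_neg]
    rintro ⟨h1, -, rfl⟩
    exact hm h1
  rw [if_pos hm]
  have key : ∀ p : (ι →₀ ℕ) × (ι →₀ ℕ), (∑ᶠ h' : ℤ, (if h' = g ∧ p.1 = a then x else 0) *
      (if g' - h' = h ∧ p.2 = b then y else 0)) = if p = (a, b) ∧ g' = g + h then x * y else 0 := by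
    intro p
    rw [finsum_eq_single _ g]
    · by_cases hp : p = (a, b)
      · subst hp
        by_cases hg : g' = g + h
        · simp [hg]
        · have : ¬ g' - g = h := fun h0 => hg (by omega)
          simp [hg, this]
      · rw [if_neg fun hh : p = (a, b) ∧ g' = g + h => hp hh.1]
        by_cases h1 : p.1 = a
        · have : ¬ p.2 = b := fun h2 => hp (Prod.ext h1 h2)
          rw [if_neg fun hh : g' - g = h ∧ p.2 = b => this hh.2, mul_zero]
        · rw [if_neg fun hh : g = g ∧ p.1 = a => h1 hh.2, zero_mul]
    · intro h' hh'
      simp [hh']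
  simp only [key]
  by_cases hg : g' = g + h ∧ m' = a + b
  · obtain ⟨rfl, rfl⟩ := hg
    rw [Finset.sum_eq_single (a, b)]
    · simp [hm]
    · intro p _ hp
      simp [hp]
    · intro hn
      rw [Finset.HasAntidiagonal.mem_antidiagonal] at hn
      exact absurd rfl hn
  · rw [if_neg fun hh => hg hh.2]
    refine Finset.sum_eq_zero fun p hp => ?_
    rw [if_neg, mul_zero]
    rintro ⟨rfl, h2⟩
    exact hg ⟨h2, (Finset.HasAntidiagonal.mem_antidiagonal.1 hp).symm⟩

instance : One (Completed 𝕜 c d) :=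
  ⟨⟨QuantumBV.one, fun g m h => by
    have : g = 0 ∧ m = 0 := by
      by_contra hc
      exact h (if_neg hc)
    rw [this.2]
    intro i _
    simp, fun k => (Set.finite_singleton (0, 0)).subset fun p hp => by
      have : p.1 = 0 ∧ p.2 = 0 := by
        by_contra hc
        exact hp.2 (if_neg hc)
      exact Prod.ext this.1 this.2⟩⟩

@[simp] theorem val_one : (1 : Completed 𝕜 c d).1 = QuantumBV.one := rfl

theorem admissible_zero : Admissible d (0 : ι →₀ ℕ) := fun i _ => by simp

theorem one_eq_mon : (1 : Completed 𝕜 c d) = mon c d 0 0 1 := by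
  ext g m
  simp [mon_val, QuantumBV.one, admissible_zero]

/-- An identity between bounded additive maps may be checked on monomials. -/
theorem induction_mon {c' : ℤ} (L L' : Completed 𝕜 c d → Completed 𝕜 c' d)
    (hL : IsBounded L) (hL' : IsBounded L')
    (ha : ∀ a b, L (a + b) = L a + L b) (ha' : ∀ a b, L' (a + b) = L' a + L' b)
    (h : ∀ g m x, Admissible d m → L (mon c d g m x) = L' (mon c d g m x))
    (a : Completed 𝕜 c d) : L a = L' a :=
  DFunLike.congr_fun (addMonoidHom_ext (L := AddMonoidHom.mk' L ha) (L' := AddMonoidHom.mk' L' ha')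
    hL hL' h) a

/-- On monomials both sides carry the product of the three pairwise Koszul signs; boundedness
extends the identity one variable at a time. -/
theorem mul_assoc_aux (a b e : Completed 𝕜 c d) : a * b * e = a * (b * e) := by
  have h3 : ∀ g m x g' m' x' g'' m'' x'', mon c d g m x * mon c d g' m' x' * mon c d g'' m'' x'' =
      (mon c d g m x * (mon c d g' m' x' * mon c d g'' m'' x'') : Completed 𝕜 c d) := by
    intro g m x g' m' x' g'' m'' x''
    simp only [mon_mul_mon, add_assoc, koszul_add_left, koszul_add_right]
    congr 1
    ring
  have h2 : ∀ g m x g' m' x' e, mon c d g m x * mon c d g' m' x' * e =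
      (mon c d g m x * (mon c d g' m' x' * e) : Completed 𝕜 c d) := by
    intro g m x g' m' x' e
    exact induction_mon (fun e => mulL (mon c d g m x * mon c d g' m' x') e)
      (fun e => mulL (mon c d g m x) (mulL (mon c d g' m' x') e)) (isBounded_mulL _)
      ((isBounded_mulL _).comp (isBounded_mulL _))
      (fun _ _ => map_add _ _ _) (fun _ _ => by rw [map_add, map_add])
      (fun g'' m'' x'' _ => h3 g m x g' m' x' g'' m'' x'') e
  have h1 : ∀ g m x b e, mon c d g m x * b * e = (mon c d g m x * (b * e) : Completed 𝕜 c d) := by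
    intro g m x b e
    exact induction_mon (fun b => mulR e (mulL (mon c d g m x) b))
      (fun b => mulL (mon c d g m x) (mulR e b)) ((isBounded_mulR e).comp (isBounded_mulL _))
      ((isBounded_mulL _).comp (isBounded_mulR e)) (fun _ _ => by rw [map_add, map_add])
      (fun _ _ => by rw [map_add, map_add]) (fun g' m' x' _ => h2 g m x g' m' x' e) b
  exact induction_mon (fun a => mulR e (mulR b a)) (fun a => mulR (b * e) a)
    ((isBounded_mulR e).comp (isBounded_mulR b)) (isBounded_mulR (b * e))
    (fun _ _ => by rw [map_add, map_add]) (fun _ _ => map_add _ _ _)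
    (fun g m x _ => h1 g m x b e) a

instance : Ring (Completed 𝕜 c d) where
  __ := (inferInstance : AddCommGroup (Completed 𝕜 c d))
  mul_assoc := mul_assoc_aux
  left_distrib := mul_add_aux
  right_distrib := add_mul_aux
  zero_mul a := map_zero (mulR a)
  mul_zero a := map_zero (mulL a)
  one_mul a := induction_mon (fun a => mulL 1 a) (fun a => a) (isBounded_mulL 1)
      (fun k => ⟨k, fun _ h => h⟩) (fun _ _ => map_add _ _ _) (fun _ _ => rfl) (fun g m x _ => by
        change 1 * mon c d g m x = _
        rw [one_eq_mon, mon_mul_mon]; simp) a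
  mul_one a := induction_mon (fun a => mulR 1 a) (fun a => a) (isBounded_mulR 1)
      (fun k => ⟨k, fun _ h => h⟩) (fun _ _ => map_add _ _ _) (fun _ _ => rfl) (fun g m x _ => by
        change mon c d g m x * 1 = _
        rw [one_eq_mon, mon_mul_mon]; simp) a

instance : Algebra 𝕜 (Completed 𝕜 c d) := Algebra.ofModule
  (fun x a b => by
    ext g m
    simp only [val_mul, val_smul, Pi.smul_apply, mul]
    split_ifs
    · rw [Finset.smul_sum]
      refine Finset.sum_congr rfl fun p _ => ?_
      rw [← mul_smul_comm, smul_finsum]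
      simp only [smul_mul_assoc]
    · simp)
  (fun x a b => by
    ext g m
    simp only [val_mul, val_smul, Pi.smul_apply, mul]
    split_ifs
    · rw [Finset.smul_sum]
      refine Finset.sum_congr rfl fun p _ => ?_
      rw [← mul_smul_comm, smul_finsum]
      simp only [mul_smul_comm]
    · simp)

theorem val_pow (a : Completed 𝕜 c d) (k : ℕ) : (a ^ k).1 = QuantumBV.pow d a.1 k := by
  induction k with
  | zero => rw [pow_zero]; rfl
  | succ k ih => rw [pow_succ', val_mul, ih]; rfl

theorem one_mem_fil : (1 : Completed 𝕜 c d) ∈ fil 0 := by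
  rw [one_eq_mon]
  simpa [level] using mon_mem_fil (c := c) (d := d) 0 0 (1 : 𝕜)

theorem pow_mem_fil {a : Completed 𝕜 c d} {k : ℤ} (ha : a ∈ fil k) (n : ℕ) : a ^ n ∈ fil (n * k) := by
  induction n with
  | zero => simpa using one_mem_fil
  | succ n ih =>
    rw [pow_succ]
    have := mul_mem_fil ih ha
    push_cast
    rwa [add_mul, one_mul]

/-! ### Topology -/

theorem ringSubgroupsBasis :
    RingSubgroupsBasis fun k : ℤ => (fil k : Submodule 𝕜 (Completed 𝕜 c d)).toAddSubgroup where
  inter i j := ⟨max i j, fun _ ha => ⟨fil_anti (le_max_left i j) ha, fil_anti (le_max_right i j) ha⟩⟩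
  -- For negative `i` a product of two elements of `fil i` only lies in `fil (i + i)`, which may be
  -- larger than `fil i`; a nonnegative level repairs this.
  mul i := ⟨max i 0, by
    rintro _ ⟨a, ha, b, hb, rfl⟩
    refine fil_anti (?_ : i ≤ max i 0 + max i 0) (mul_mem_fil ha hb)
    omega⟩
  leftMul a k := by
    obtain ⟨l, hl⟩ := isBounded_mulL a k
    exact ⟨l, fun b hb => hl b hb⟩
  rightMul a k := by
    obtain ⟨l, hl⟩ := isBounded_mulR a k
    exact ⟨l, fun b hb => hl b hb⟩

instance : TopologicalSpace (Completed 𝕜 c d) := ringSubgroupsBasis.topology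

instance : IsTopologicalRing (Completed 𝕜 c d) :=
  ringSubgroupsBasis.toRingFilterBasis.isTopologicalRing

theorem hasBasis_nhds_zero :
    (nhds (0 : Completed 𝕜 c d)).HasBasis (fun _ => True) fun k : ℤ => {a | a ∈ fil k} :=
  ringSubgroupsBasis.hasBasis_nhds_zero

instance : T2Space (Completed 𝕜 c d) := by
  refine IsTopologicalAddGroup.t2Space_of_zero_sep fun a ha => ?_
  by_contra hc
  push Not at hc
  exact ha (eq_zero_of_forall_mem_fil fun k => hc _ (hasBasis_nhds_zero.mem_of_mem trivial))

theorem IsBounded.continuous {c' : ℤ} {L : Completed 𝕜 c d →+ Completed 𝕜 c' d} (hL : IsBounded L) :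
    Continuous L := by
  refine continuous_of_continuousAt_zero L ?_
  rw [ContinuousAt, map_zero]
  refine (hasBasis_nhds_zero.tendsto_iff hasBasis_nhds_zero).2 fun k _ => ?_
  obtain ⟨l, hl⟩ := hL k
  exact ⟨l, trivial, hl⟩

end Completed

end Completed

/-! ### Infinite sums, parity operators, graded commutativity and graded derivatives -/

section Calculus

variable {ι 𝕜 : Type*} [LinearOrder ι] [Field 𝕜]

theorem monDeg_add (d : ι → ℤ) (a b : ι →₀ ℕ) : monDeg d (a + b) = monDeg d a + monDeg d b :=
  Finsupp.sum_add_index' (by simp) (by intros; push_cast; ring)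

@[simp] theorem monDeg_zero (d : ι → ℤ) : monDeg d (0 : ι →₀ ℕ) = 0 := Finsupp.sum_zero_index

@[simp] theorem monDeg_single (d : ι → ℤ) (i : ι) (n : ℕ) :
    monDeg d (Finsupp.single i n) = n * d i := Finsupp.sum_single_index (by simp)

namespace Completed

variable {c : ℤ} {d : ι → ℤ}

/-! ### Infinite sums -/

theorem finite_of_summable {α : Type*} {f : α → Completed 𝕜 c d} (h : Summable f) (k : ℤ) :
    {x | f x ∉ fil k}.Finite := by
  have := h.tendsto_cofinite_zero (hasBasis_nhds_zero.mem_of_mem (i := k) trivial)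
  exact this

theorem hasSum_of_finite {α : Type*} {f : α → Completed 𝕜 c d} {s : Completed 𝕜 c d}
    (h : ∀ k, {x | f x ∉ fil k}.Finite) (hs : ∀ g m, s.1 g m = ∑ᶠ x, (f x).1 g m) :
    HasSum f s := by
  rw [HasSum, ← tendsto_sub_nhds_zero_iff]
  refine (Filter.HasBasis.tendsto_right_iff hasBasis_nhds_zero).2 fun k _ => ?_
  rw [SummationFilter.unconditional_filter]
  filter_upwards [Filter.eventually_ge_atTop (h k).toFinset] with t ht
  refine mem_fil'.2 fun g m hgm => ?_
  simp only [val_sub, Pi.sub_apply, val_sum]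
  rw [hs, finsum_eq_sum_of_support_subset (s := t), sub_self]
  intro x hx
  refine ht ((Set.Finite.mem_toFinset _).2 fun hc => hx ?_)
  exact mem_fil'.1 hc g m hgm

/-- This is completeness in nonarchimedean form: below each level only finitely many terms
contribute, so the coefficientwise sum is again level finite. -/
theorem summable_of_finite {α : Type*} {f : α → Completed 𝕜 c d}
    (h : ∀ k, {x | f x ∉ fil k}.Finite) : Summable f := by
  have key : ∀ g m, (∑ᶠ x, (f x).1 g m) ≠ 0 → ∃ x, (f x).1 g m ≠ 0 := by
    intro g m hh
    by_contra hc
    push Not at hc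
    exact hh (by simp only [hc, finsum_zero])
  refine ⟨⟨fun g m => ∑ᶠ x, (f x).1 g m, fun g m hh => ?_, fun k => ?_⟩,
    hasSum_of_finite h fun _ _ => rfl⟩
  · obtain ⟨x, hx⟩ := key g m hh
    exact (f x).gradedSymm g m hx
  · refine ((h (k + 1)).biUnion fun x _ => (f x).levelFinite k).subset ?_
    rintro ⟨g, m⟩ ⟨h1, h2⟩
    obtain ⟨x, hx⟩ := key g m h2
    refine Set.mem_biUnion (x := x) (fun hc => ?_) ⟨h1, hx⟩
    have := hc g m hx
    simp only at h1
    omega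

theorem summable_iff {α : Type*} {f : α → Completed 𝕜 c d} :
    Summable f ↔ ∀ k, {x | f x ∉ fil k}.Finite :=
  ⟨finite_of_summable, summable_of_finite⟩

/-- The bridge between sums in the level topology and the coefficientwise `finsum`s in the
definitions of exponential, pullback, bracket and Laplacian. -/
theorem val_tsum {α : Type*} {f : α → Completed 𝕜 c d} (h : Summable f) (g : ℤ) (m : ι →₀ ℕ) :
    (∑' x, f x).1 g m = ∑ᶠ x, (f x).1 g m := by
  have h1 := finite_of_summable h
  have key : ∃ s : Completed 𝕜 c d, HasSum f s ∧ ∀ g m, s.1 g m = ∑ᶠ x, (f x).1 g m := by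
    obtain ⟨s, hs⟩ := h
    refine ⟨s, hs, fun g m => ?_⟩
    have h2 := (Filter.HasBasis.tendsto_right_iff hasBasis_nhds_zero).1
      (tendsto_sub_nhds_zero_iff.2 hs) (level c g m + 1) trivial
    rw [SummationFilter.unconditional_filter] at h2
    obtain ⟨t, ht, ht'⟩ := (h2.and (Filter.eventually_ge_atTop
      (h1 (level c g m + 1)).toFinset)).exists
    have h3 := mem_fil'.1 ht g m (by omega)
    simp only [val_sub, Pi.sub_apply, val_sum] at h3
    rw [← sub_eq_zero.1 h3, finsum_eq_sum_of_support_subset (s := t)]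
    intro x hx
    refine ht' ((Set.Finite.mem_toFinset _).2 fun hc => hx ?_)
    exact mem_fil'.1 hc g m (by omega)
  obtain ⟨s, hs, hs'⟩ := key
  rw [hs.tsum_eq, hs']

theorem tsum_ne_zero_exists {α : Type*} {f : α → Completed 𝕜 c d} {g : ℤ} {m : ι →₀ ℕ}
    (h : (∑' x, f x).1 g m ≠ 0) : ∃ x, (f x).1 g m ≠ 0 := by
  by_cases hf : Summable f
  · rw [val_tsum hf] at h
    by_contra hc
    push Not at hc
    exact h (by simp only [hc, finsum_zero])
  · rw [tsum_eq_zero_of_not_summable hf] at h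
    exact absurd rfl h

theorem tsum_mem_fil {α : Type*} {f : α → Completed 𝕜 c d} {k : ℤ} (h : ∀ x, f x ∈ fil k) :
    ∑' x, f x ∈ fil k := fun g m hm => by
  obtain ⟨x, hx⟩ := tsum_ne_zero_exists hm
  exact h x g m hx

theorem IsBounded.hasSum {c' : ℤ} {α : Type*} {L : Completed 𝕜 c d →+ Completed 𝕜 c' d}
    (hL : IsBounded L) {f : α → Completed 𝕜 c d} {s : Completed 𝕜 c d} (h : HasSum f s) :
    HasSum (fun x => L (f x)) (L s) := h.map L hL.continuous

theorem IsBounded.map_tsum {c' : ℤ} {α : Type*} {L : Completed 𝕜 c d →+ Completed 𝕜 c' d}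
    (hL : IsBounded L) {f : α → Completed 𝕜 c d} (h : Summable f) :
    L (∑' x, f x) = ∑' x, L (f x) := (hL.hasSum h.hasSum).tsum_eq.symm

theorem IsBounded.summable {c' : ℤ} {α : Type*} {L : Completed 𝕜 c d →+ Completed 𝕜 c' d}
    (hL : IsBounded L) {f : α → Completed 𝕜 c d} (h : Summable f) :
    Summable fun x => L (f x) := (hL.hasSum h.hasSum).summable

/-- A biadditive identity between separately bounded maps may be checked on monomials. -/
theorem induction_mon₂ (B B' : Completed 𝕜 c d → Completed 𝕜 c d → Completed 𝕜 c d)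
    (hl : ∀ b, IsBounded fun a => B a b) (hr : ∀ a, IsBounded fun b => B a b)
    (hl' : ∀ b, IsBounded fun a => B' a b) (hr' : ∀ a, IsBounded fun b => B' a b)
    (al : ∀ a a' b, B (a + a') b = B a b + B a' b) (ar : ∀ a b b', B a (b + b') = B a b + B a b')
    (al' : ∀ a a' b, B' (a + a') b = B' a b + B' a' b)
    (ar' : ∀ a b b', B' a (b + b') = B' a b + B' a b')
    (h : ∀ g m x g' m' y, Admissible d m → Admissible d m' →
      B (mon c d g m x) (mon c d g' m' y) = B' (mon c d g m x) (mon c d g' m' y))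
    (a b : Completed 𝕜 c d) : B a b = B' a b :=
  induction_mon (fun a => B a b) (fun a => B' a b) (hl b) (hl' b) (fun _ _ => al _ _ _)
    (fun _ _ => al' _ _ _)
    (fun g m x hm => induction_mon (fun b => B (mon c d g m x) b) (fun b => B' (mon c d g m x) b)
      (hr _) (hr' _) (fun _ _ => ar _ _ _) (fun _ _ => ar' _ _ _)
      (fun g' m' y hm' => h g m x g' m' y hm hm') b) a

theorem IsBounded.add {c' : ℤ} {L L' : Completed 𝕜 c d → Completed 𝕜 c' d} (h : IsBounded L)
    (h' : IsBounded L') : IsBounded fun a => L a + L' a := fun k => by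
  obtain ⟨l, hl⟩ := h k
  obtain ⟨l', hl'⟩ := h' k
  exact ⟨max l l', fun a ha => add_mem (hl _ (fil_anti (le_max_left _ _) ha))
    (hl' _ (fil_anti (le_max_right _ _) ha))⟩

theorem IsBounded.sub {c' : ℤ} {L L' : Completed 𝕜 c d → Completed 𝕜 c' d} (h : IsBounded L)
    (h' : IsBounded L') : IsBounded fun a => L a - L' a := fun k => by
  obtain ⟨l, hl⟩ := h k
  obtain ⟨l', hl'⟩ := h' k
  exact ⟨max l l', fun a ha => sub_mem (hl _ (fil_anti (le_max_left _ _) ha))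
    (hl' _ (fil_anti (le_max_right _ _) ha))⟩

theorem IsBounded.mul_left {c' : ℤ} {L : Completed 𝕜 c d → Completed 𝕜 c' d} (h : IsBounded L)
    (b : Completed 𝕜 c' d) : IsBounded fun a => b * L a := (isBounded_mulL b).comp h

theorem IsBounded.mul_right {c' : ℤ} {L : Completed 𝕜 c d → Completed 𝕜 c' d} (h : IsBounded L)
    (b : Completed 𝕜 c' d) : IsBounded fun a => L a * b := (isBounded_mulR b).comp h

theorem IsBounded.of_shift {c' : ℤ} {L : Completed 𝕜 c d → Completed 𝕜 c' d} (r : ℤ)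
    (h : ∀ k a, a ∈ fil k → L a ∈ fil (k - r)) : IsBounded L :=
  fun k => ⟨k + r, fun a ha => by simpa using h _ a ha⟩

/-! ### Diagonal operators -/

/-- The operator multiplying each monomial by a scalar. -/
def diag (w : ℤ → (ι →₀ ℕ) → 𝕜) : Completed 𝕜 c d →ₗ[𝕜] Completed 𝕜 c d where
  toFun a := ⟨fun g m => w g m * a.1 g m,
    fun g m h => a.gradedSymm g m (right_ne_zero_of_mul h),
    fun k => (a.levelFinite k).subset fun _ hp => ⟨hp.1, right_ne_zero_of_mul hp.2⟩⟩
  map_add' a b := by ext g m; exact mul_add _ _ _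
  map_smul' x a := by ext g m; exact mul_left_comm _ _ _

theorem diag_val (w : ℤ → (ι →₀ ℕ) → 𝕜) (a : Completed 𝕜 c d) (g : ℤ) (m : ι →₀ ℕ) :
    (diag w a).1 g m = w g m * a.1 g m := rfl

theorem diag_mem_fil {w : ℤ → (ι →₀ ℕ) → 𝕜} {a : Completed 𝕜 c d} {k : ℤ} (ha : a ∈ fil k) :
    diag w a ∈ fil k := fun g m h => ha g m (right_ne_zero_of_mul h)

theorem isBounded_diag (w : ℤ → (ι →₀ ℕ) → 𝕜) :
    IsBounded (diag w : Completed 𝕜 c d →ₗ[𝕜] Completed 𝕜 c d) :=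
  fun k => ⟨k, fun _ h => diag_mem_fil h⟩

theorem diag_mon (w : ℤ → (ι →₀ ℕ) → 𝕜) (g : ℤ) (m : ι →₀ ℕ) (x : 𝕜) :
    diag w (mon c d g m x) = mon c d g m (w g m * x) := by
  ext g' m'
  simp only [diag_val, mon_val]
  split_ifs with h
  · rw [h.2.1, h.2.2]
  · simp

/-- The algebra automorphism `F ↦ (-1)^{n |F|} F`. -/
def rho (n : ℤ) : Completed 𝕜 c d →ₐ[𝕜] Completed 𝕜 c d :=
  AlgHom.ofLinearMap (diag fun _ m => (-1) ^ (n * monDeg d m))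
    (by rw [one_eq_mon, diag_mon]; simp)
    (induction_mon₂ (fun a b => diag _ (a * b)) (fun a b => diag _ a * diag _ b)
      (fun b => (isBounded_diag _).comp (isBounded_mulR b))
      (fun a => (isBounded_diag _).comp (isBounded_mulL a))
      (fun b => (isBounded_diag _).mul_right _) (fun a => (isBounded_diag _).mul_left _)
      (fun _ _ _ => by simp only [add_mul, map_add]) (fun _ _ _ => by simp only [mul_add, map_add])
      (fun _ _ _ => by simp only [add_mul, map_add]) (fun _ _ _ => by simp only [mul_add, map_add])
      (fun g m x g' m' y _ _ => by
        simp only [mon_mul_mon, diag_mon, monDeg_add, mul_add]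
        rw [zpow_add₀ (by simp)]
        congr 1; ring))

theorem rho_val (n : ℤ) (a : Completed 𝕜 c d) (g : ℤ) (m : ι →₀ ℕ) :
    (rho n a).1 g m = (-1) ^ (n * monDeg d m) * a.1 g m := rfl

theorem rho_eq_diag (n : ℤ) (a : Completed 𝕜 c d) :
    rho n a = diag (fun _ m => (-1) ^ (n * monDeg d m)) a := rfl

theorem rho_mem_fil {n : ℤ} {a : Completed 𝕜 c d} {k : ℤ} (ha : a ∈ fil k) : rho n a ∈ fil k :=
  diag_mem_fil ha

theorem isBounded_rho (n : ℤ) : IsBounded (rho n : Completed 𝕜 c d →ₐ[𝕜] Completed 𝕜 c d) :=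
  isBounded_diag _

theorem rho_add (m n : ℤ) (a : Completed 𝕜 c d) : rho (m + n) a = rho m (rho n a) := by
  ext g k
  simp only [rho_val]
  rw [add_mul, zpow_add₀ (by simp), mul_assoc]

theorem rho_of_even {n : ℤ} (h : Even n) (a : Completed 𝕜 c d) : rho n a = a := by
  ext g m
  rw [rho_val, (h.mul_right _).neg_one_zpow, one_mul]

theorem rho_of_odd {n : ℤ} (h : Odd n) (a : Completed 𝕜 c d) : rho n a = rho 1 a := by
  obtain ⟨k, rfl⟩ := h
  rw [add_comm, rho_add, rho_of_even (even_two_mul k)]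

theorem rho_rho (n : ℤ) (a : Completed 𝕜 c d) : rho n (rho n a) = a := by
  rw [← rho_add, rho_of_even ⟨n, rfl⟩]

/-- `a` is homogeneous of degree `n`. -/
abbrev Homog (n : ℤ) (a : Completed 𝕜 c d) : Prop := IsHomogeneous d n a.1

theorem Homog.rho_eq {n : ℤ} {a : Completed 𝕜 c d} (h : Homog n a) (k : ℤ) :
    rho k a = ((-1) ^ (k * n) : 𝕜) • a := by
  ext g m
  rw [rho_val, val_smul]
  by_cases h0 : a.1 g m = 0
  · simp [h0]
  · rw [h g m h0]; rfl

theorem Homog.zero (n : ℤ) : Homog n (0 : Completed 𝕜 c d) := fun _ _ h => absurd rfl h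

theorem Homog.add {n : ℤ} {a b : Completed 𝕜 c d} (ha : Homog n a) (hb : Homog n b) :
    Homog n (a + b) := fun g m h => by
  by_cases h1 : a.1 g m = 0
  · exact hb g m fun h2 => h (by simp [h1, h2])
  · exact ha g m h1

theorem Homog.smul {n : ℤ} {a : Completed 𝕜 c d} (ha : Homog n a) (x : 𝕜) : Homog n (x • a) :=
  fun g m h => ha g m fun h2 => h (by simp [h2])

theorem Homog.neg {n : ℤ} {a : Completed 𝕜 c d} (ha : Homog n a) : Homog n (-a) :=
  fun g m h => ha g m fun h2 => h (by simp [h2])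

theorem Homog.sub {n : ℤ} {a b : Completed 𝕜 c d} (ha : Homog n a) (hb : Homog n b) :
    Homog n (a - b) := sub_eq_add_neg a b ▸ ha.add hb.neg

theorem Homog.mul {n k : ℤ} {a b : Completed 𝕜 c d} (ha : Homog n a) (hb : Homog k b) :
    Homog (n + k) (a * b) := fun g m h => by
  obtain ⟨-, g₁, g₂, m₁, m₂, rfl, rfl, h1, h2⟩ := mul_ne_zero_exists h
  rw [monDeg_add, ha _ _ h1, hb _ _ h2]

theorem Homog.tsum {α : Type*} {n : ℤ} {f : α → Completed 𝕜 c d} (h : ∀ x, Homog n (f x)) :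
    Homog n (∑' x, f x) := fun g m hm => by
  obtain ⟨x, hx⟩ := tsum_ne_zero_exists hm
  exact h x g m hx

theorem Homog.sum {α : Type*} {s : Finset α} {n : ℤ} {f : α → Completed 𝕜 c d}
    (h : ∀ x ∈ s, Homog n (f x)) : Homog n (∑ x ∈ s, f x) := fun g m hm => by
  rw [val_sum] at hm
  obtain ⟨x, hx, hx'⟩ := Finset.exists_ne_zero_of_sum_ne_zero hm
  exact h x hx g m hx'

theorem Homog.map_diag {n : ℤ} {a : Completed 𝕜 c d} (ha : Homog n a) (w : ℤ → (ι →₀ ℕ) → 𝕜) :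
    Homog n (diag w a) := fun g m h => ha g m (right_ne_zero_of_mul h)

theorem Homog.map_rho {n k : ℤ} {a : Completed 𝕜 c d} (ha : Homog n a) : Homog n (rho k a) := ha.map_diag _

theorem homog_mon (g : ℤ) (m : ι →₀ ℕ) (x : 𝕜) : Homog (monDeg d m) (mon c d g m x) := fun g' m' h => by
  rw [mon_val] at h
  split_ifs at h with hc
  · rw [hc.2.2]
  · simp at h

theorem Homog.one : Homog 0 (1 : Completed 𝕜 c d) := by
  rw [one_eq_mon]
  simpa using homog_mon (c := c) (d := d) 0 0 (1 : 𝕜)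

theorem Homog.pow {a : Completed 𝕜 c d} (ha : Homog 0 a) (n : ℕ) : Homog 0 (a ^ n) := by
  induction n with
  | zero => simpa using Homog.one
  | succ n ih => rw [pow_succ]; simpa using ih.mul ha

/-! ### Graded commutativity -/

/-- The double sum over pairs of indices splits into the parts above, below and on the diagonal; the
first two are the Koszul exponents in the two orders. -/
theorem monDeg_mul_monDeg (d : ι → ℤ) (a b : ι →₀ ℕ) :
    monDeg d a * monDeg d b = koszulExp d a b + koszulExp d b a
      + a.sum fun i p => (p : ℤ) * d i * ((b i : ℤ) * d i) := by
  have h1 : koszulExp d b a = a.sum fun i p => b.sum fun j q =>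
      if i < j then (p : ℤ) * d i * ((q : ℤ) * d j) else 0 := by
    unfold koszulExp
    rw [Finsupp.sum_comm]
    refine Finsupp.sum_congr fun i _ => Finsupp.sum_congr fun j _ => ?_
    split_ifs <;> ring
  have h2 : ∀ i (p : ℕ), (p : ℤ) * d i * ((b i : ℤ) * d i) = b.sum fun j q =>
      if i = j then (p : ℤ) * d i * ((q : ℤ) * d j) else 0 := by
    intro i p
    rw [Finsupp.sum, Finset.sum_ite_eq]
    split_ifs with h
    · rfl
    · simp [Finsupp.notMem_support_iff.1 h]
  rw [h1, monDeg, monDeg, koszulExp, Finsupp.sum_mul, ← Finsupp.sum_add, ← Finsupp.sum_add]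
  refine Finsupp.sum_congr fun i _ => ?_
  rw [Finsupp.mul_sum, h2, ← Finsupp.sum_add, ← Finsupp.sum_add]
  refine Finsupp.sum_congr fun j _ => ?_
  rcases lt_trichotomy i j with h | h | h
  · simp [h, h.not_gt, h.ne]
  · simp [h]
  · simp [h, h.not_gt, h.ne']

/-- The diagonal terms are even: by admissibility an odd index occurs in at most one of `a` and `b`.
-/
theorem koszul_swap {d : ι → ℤ} {a b : ι →₀ ℕ} (h : Admissible d (a + b)) :
    koszul (𝕜 := 𝕜) d a b = (-1) ^ (monDeg d a * monDeg d b) * koszul d b a := by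
  have heven : Even (a.sum fun i p => (p : ℤ) * d i * ((b i : ℤ) * d i)) := by
    refine Finset.even_sum _ fun i _ => ?_
    rcases Int.even_or_odd (d i) with hd | hd
    · exact (hd.mul_left _).mul_right _
    · have := h i hd
      simp only [Finsupp.coe_add, Pi.add_apply] at this
      have : a i = 0 ∨ b i = 0 := by omega
      rcases this with h0 | h0 <;> simp [h0]
  rw [monDeg_mul_monDeg, zpow_add₀ (by simp), heven.neg_one_zpow, mul_one, zpow_add₀ (by simp),
    koszul_eq, koszul_eq, mul_assoc, neg_one_zpow_mul_self, mul_one]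

theorem mul_mon_comm (a : Completed 𝕜 c d) (g : ℤ) (m : ι →₀ ℕ) (x : 𝕜) :
    a * mon c d g m x = mon c d g m x * rho (monDeg d m) a := by
  refine induction_mon (fun a => a * mon c d g m x) (fun a => mon c d g m x * rho (monDeg d m) a)
    (isBounded_mulR _) ((isBounded_rho _).mul_left _) (fun _ _ => add_mul _ _ _)
    (fun _ _ => by rw [map_add, mul_add]) (fun g' m' y _ => ?_) a
  simp only [rho_eq_diag, diag_mon, mon_mul_mon]
  rw [add_comm g', add_comm m']
  by_cases h : Admissible d (m + m')
  · rw [koszul_swap (a := m') (b := m) (by rwa [add_comm]), mul_comm (monDeg d m')]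
    congr 1; ring
  · rw [mon_of_not_admissible h, mon_of_not_admissible h]

/-- Graded commutativity. -/
theorem Homog.mul_comm {n : ℤ} {u : Completed 𝕜 c d} (hu : Homog n u) (a : Completed 𝕜 c d) :
    u * a = rho n a * u := by
  refine induction_mon (fun a => u * a) (fun a => rho n a * u) (isBounded_mulL _)
    ((isBounded_rho _).mul_right _) (fun _ _ => mul_add _ _ _)
    (fun _ _ => by rw [map_add, add_mul]) (fun g m y _ => ?_) a
  rw [mul_mon_comm, hu.rho_eq, (homog_mon g m y).rho_eq, mul_smul_comm, smul_mul_assoc, _root_.mul_comm n]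

theorem Homog.commute {u : Completed 𝕜 c d} (hu : Homog 0 u) (a : Completed 𝕜 c d) :
    Commute u a := by
  rw [Commute, SemiconjBy, hu.mul_comm, rho_of_even (by simp)]

/-! ### Derivatives -/

theorem dL_eq (i : ι) (F : Fun ι 𝕜) (g : ℤ) (m : ι →₀ ℕ) :
    dL d i F g m = koszul d (Finsupp.single i 1) m * ((m i : 𝕜) + 1) * F g (m + Finsupp.single i 1) := by
  rw [dL, koszul_eq, koszulExp, Finsupp.sum_single_index (by simp [Finsupp.sum])]
  congr 3
  rw [Finsupp.mul_sum]
  refine Finsupp.sum_congr fun j _ => ?_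
  split_ifs <;> simp

theorem degree_add_single (m : ι →₀ ℕ) (i : ι) :
    (m + Finsupp.single i 1).degree = m.degree + 1 := by
  rw [map_add, Finsupp.degree_single]

theorem level_add_single (c g : ℤ) (m : ι →₀ ℕ) (i : ι) :
    level c g (m + Finsupp.single i 1) = level c g m + 1 := by
  rw [level, degree_add_single, level]; push_cast; ring

/-- The left partial derivative. -/
def pd (i : ι) : Completed 𝕜 c d →ₗ[𝕜] Completed 𝕜 c d where
  toFun a := ⟨dL d i a.1, fun g m h =>
      (a.gradedSymm _ _ (right_ne_zero_of_mul h)).of_add_left, fun k => by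
      refine Set.Finite.of_finite_image (f := fun p => (p.1, p.2 + Finsupp.single i 1))
        ((a.levelFinite (k + 1)).subset ?_) ?_
      · rintro _ ⟨p, hp, rfl⟩
        refine ⟨?_, right_ne_zero_of_mul hp.2⟩
        simp only [level_add_single]
        have := hp.1
        omega
      · rintro p - q - h
        simpa [Prod.ext_iff] using h⟩
  map_add' a b := by ext g m; exact mul_add _ _ _
  map_smul' x a := by ext g m; exact mul_left_comm _ _ _

theorem pd_val (i : ι) (a : Completed 𝕜 c d) : (pd i a).1 = dL d i a.1 := rfl

theorem pd_apply (i : ι) (a : Completed 𝕜 c d) (g : ℤ) (m : ι →₀ ℕ) : (pd i a).1 g m =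
    koszul d (Finsupp.single i 1) m * ((m i : 𝕜) + 1) * a.1 g (m + Finsupp.single i 1) :=
  dL_eq i a.1 g m

theorem pd_ne_zero {i : ι} {a : Completed 𝕜 c d} {g : ℤ} {m : ι →₀ ℕ} (h : (pd i a).1 g m ≠ 0) :
    a.1 g (m + Finsupp.single i 1) ≠ 0 := by
  rw [pd_apply] at h
  exact right_ne_zero_of_mul h

theorem pd_mem_fil {i : ι} {a : Completed 𝕜 c d} {k : ℤ} (ha : a ∈ fil k) : pd i a ∈ fil (k - 1) := by
  intro g m h
  have := ha _ _ (pd_ne_zero h)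
  rw [level_add_single] at this
  omega

theorem isBounded_pd (i : ι) : IsBounded (pd i : Completed 𝕜 c d →ₗ[𝕜] Completed 𝕜 c d) :=
  IsBounded.of_shift 1 fun _ _ h => pd_mem_fil h

theorem Homog.map_pd {n : ℤ} {a : Completed 𝕜 c d} (h : Homog n a) (i : ι) : Homog (n - d i) (pd i a) := by
  intro g m hm
  have := h _ _ (pd_ne_zero hm)
  rw [monDeg_add, monDeg_single] at this
  push_cast at this
  linarith

/-- Only finitely many derivatives of `a` are nonzero below a given level. -/
theorem finite_pd_notMem (a : Completed 𝕜 c d) (k : ℤ) : {i | pd i a ∉ fil k}.Finite := by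
  refine ((a.levelFinite k).biUnion fun p _ => p.2.support.finite_toSet).subset fun i hi => ?_
  simp only [Set.mem_ofPred_eq, mem_fil, not_forall] at hi
  obtain ⟨g, m, h, h'⟩ := hi
  refine Set.mem_biUnion (x := (g, m + Finsupp.single i 1)) ⟨?_, pd_ne_zero h⟩ ?_
  · simp only [level_add_single]; omega
  · simp

theorem pd_pd (i j : ι) (a : Completed 𝕜 c d) :
    pd i (pd j a) = ((-1) ^ (d i * d j) : 𝕜) • pd j (pd i a) := by
  ext g m
  simp only [pd_apply, val_smul, Pi.smul_apply, smul_eq_mul]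
  rw [add_right_comm m (Finsupp.single i 1)]
  by_cases h0 : a.1 g (m + Finsupp.single j 1 + Finsupp.single i 1) = 0
  · simp [h0]
  by_cases hij : i = j
  · subst hij
    rcases Int.even_or_odd (d i) with hd | hd
    · rw [(hd.mul_left _).neg_one_zpow, one_mul]
    -- An odd index would occur twice here, so the coefficient cannot be nonzero.
    · have := a.gradedSymm _ _ h0 i hd
      simp at this
  · have hadm : Admissible d (Finsupp.single i 1 + Finsupp.single j 1) := by
      intro k _
      by_cases hk : k = i
      · subst hk
        simp [Ne.symm hij]
      · simp only [Finsupp.coe_add, Pi.add_apply, Finsupp.single_apply, if_neg fun h : i = k => hk h.symm]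
        split_ifs <;> simp
    have h1 := koszul_swap (𝕜 := 𝕜) hadm
    simp only [monDeg_single, Nat.cast_one, one_mul] at h1
    rw [koszul_add_right, koszul_add_right]
    have h2 : koszul (𝕜 := 𝕜) d (Finsupp.single j 1) (Finsupp.single i 1) =
        (-1) ^ (d i * d j) * koszul d (Finsupp.single i 1) (Finsupp.single j 1) := by
      rw [h1, ← mul_assoc, neg_one_zpow_mul_self, one_mul]
    rw [h2]
    simp only [Finsupp.coe_add, Pi.add_apply, Finsupp.single_apply, if_neg hij,
      if_neg fun h : j = i => hij h.symm, add_zero]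
    ring

theorem pd_diag (w w' : ℤ → (ι →₀ ℕ) → 𝕜) (i : ι)
    (h : ∀ g m, w g m = w' g (m + Finsupp.single i 1)) (a : Completed 𝕜 c d) :
    pd i (diag w' a) = diag w (pd i a) := by
  ext g m
  simp only [pd_apply, diag_val, h]
  ring

theorem pd_rho (i : ι) (n : ℤ) (a : Completed 𝕜 c d) :
    pd i (rho n a) = ((-1) ^ (n * d i) : 𝕜) • rho n (pd i a) := by
  ext g m
  simp only [pd_apply, rho_val, val_smul, Pi.smul_apply, smul_eq_mul, monDeg_add, monDeg_single,
    mul_add, Nat.cast_one, one_mul]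
  rw [zpow_add₀ (by simp)]
  ring

open Classical in
theorem pd_mon (i : ι) (g : ℤ) (m : ι →₀ ℕ) (x : 𝕜) :
    pd i (mon c d g (m + Finsupp.single i 1) x) =
      if Admissible d (m + Finsupp.single i 1) then
        mon c d g m (koszul d (Finsupp.single i 1) m * ((m i : 𝕜) + 1) * x) else 0 := by
  split_ifs with h
  · ext g' m'
    rw [pd_apply, mon_val, mon_val]
    by_cases hc : g' = g ∧ m' = m
    · rw [if_pos ⟨h, hc.1, by rw [hc.2]⟩, if_pos ⟨h.of_add_left, hc⟩, hc.2]
    · rw [if_neg, if_neg, mul_zero]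
      · exact fun hh => hc hh.2
      · exact fun hh => hc ⟨hh.2.1, add_right_cancel hh.2.2⟩
  · rw [mon_of_not_admissible h, map_zero]

theorem pd_mon_of_eq_zero {i : ι} {m : ι →₀ ℕ} (h : m i = 0) (g : ℤ) (x : 𝕜) :
    pd i (mon c d g m x) = 0 := by
  ext g' m'
  rw [pd_apply, mon_val, if_neg, mul_zero]; rfl
  rintro ⟨-, -, rfl⟩
  simp at h

theorem koszul_single_mul (d : ι → ℤ) (i : ι) (a : ι →₀ ℕ) (h : Odd (d i) → a i = 0) :
    koszul (𝕜 := 𝕜) d a (Finsupp.single i 1) = (-1) ^ (d i * monDeg d a) *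
      koszul d (Finsupp.single i 1) a := by
  have heven : Even (a.sum fun j p => (p : ℤ) * d j * ((Finsupp.single i 1 j : ℕ) * d j)) := by
    refine Finset.even_sum _ fun j _ => ?_
    by_cases hij : i = j
    · subst hij
      rcases Int.even_or_odd (d i) with hd | hd
      · exact (hd.mul_left _).mul_right _
      · simp [h hd]
    · simp [hij]
  have := monDeg_mul_monDeg d a (Finsupp.single i 1)
  rw [monDeg_single, Nat.cast_one, one_mul] at this
  rw [mul_comm (d i), this, zpow_add₀ (by simp), heven.neg_one_zpow, mul_one, zpow_add₀ (by simp),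
    koszul_eq, koszul_eq, mul_assoc, neg_one_zpow_mul_self, mul_one]

/-- The graded Leibniz rule. -/
theorem pd_mul (i : ι) (a b : Completed 𝕜 c d) :
    pd i (a * b) = pd i a * b + rho (d i) a * pd i b := by
  refine induction_mon₂ (fun a b => pd i (a * b)) (fun a b => pd i a * b + rho (d i) a * pd i b)
    (fun b => (isBounded_pd i).comp (isBounded_mulR b))
    (fun a => (isBounded_pd i).comp (isBounded_mulL a))
    (fun b => ((isBounded_pd i).mul_right b).add ((isBounded_rho _).mul_right _))
    (fun a => (isBounded_mulL _).add ((isBounded_pd i).mul_left _))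
    (fun _ _ _ => by simp only [add_mul, map_add]) (fun _ _ _ => by simp only [mul_add, map_add])
    (fun _ _ _ => by simp only [add_mul, map_add]; abel)
    (fun _ _ _ => by simp only [mul_add, map_add]; abel)
    (fun g m x g' m' y hm hm' => ?_) a b
  simp only [rho_eq_diag, diag_mon]
  have dec : ∀ m : ι →₀ ℕ, m i ≠ 0 → ∃ m₀, m = m₀ + Finsupp.single i 1 := fun m h =>
    ⟨m - Finsupp.single i 1, (tsub_add_cancel_of_le (by
      simpa using Nat.one_le_iff_ne_zero.2 h)).symm⟩
  -- Four cases, according to whether `φ^i` occurs in neither, one or both factors. If it occurs in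
  -- both and is odd, the product is zero and the two terms on the right cancel.
  by_cases h : m i = 0 <;> by_cases h' : m' i = 0
  · rw [mon_mul_mon, pd_mon_of_eq_zero (by simp [h, h']), pd_mon_of_eq_zero h, pd_mon_of_eq_zero h']
    simp
  · obtain ⟨m', rfl⟩ := dec m' h'
    rw [mon_mul_mon, pd_mon_of_eq_zero h, ← add_assoc, pd_mon, pd_mon, if_pos hm', zero_mul, zero_add,
      mon_mul_mon]
    have hz : Odd (d i) → m i = 0 := fun _ => h
    split_ifs with hadm
    · rw [koszul_add_right, koszul_add_right, koszul_single_mul d i m hz]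
      simp only [Finsupp.coe_add, Pi.add_apply, h, zero_add]
      congr 1
      linear_combination ((-1) ^ (d i * monDeg d m) * koszul d (Finsupp.single i 1) m' *
        ((m' i : 𝕜) + 1) * koszul d m m' * x * y) * koszul_mul_self (𝕜 := 𝕜) d (Finsupp.single i 1) m
    · rw [mon_of_not_admissible]
      intro hc
      refine hadm fun j hj => ?_
      have h1 := hc j hj
      have h2 := hm' j hj
      by_cases hij : i = j
      · subst hij
        simp only [Finsupp.coe_add, Pi.add_apply, Finsupp.single_eq_same, h] at h1 h2 ⊢
        omega
      · simpa [Finsupp.single_apply, hij] using h1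
  · obtain ⟨m, rfl⟩ := dec m h
    rw [mon_mul_mon, pd_mon_of_eq_zero h', add_right_comm, pd_mon, pd_mon, if_pos hm, mul_zero, add_zero,
      mon_mul_mon]
    split_ifs with hadm
    · rw [koszul_add_left, koszul_add_right]
      simp only [Finsupp.coe_add, Pi.add_apply, h', add_zero]
      congr 1
      linear_combination (koszul d (Finsupp.single i 1) m *
        ((m i : 𝕜) + 1) * koszul d m m' * x * y) * koszul_mul_self (𝕜 := 𝕜) d (Finsupp.single i 1) m'
    · rw [mon_of_not_admissible]
      intro hc
      refine hadm fun j hj => ?_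
      have h1 := hc j hj
      have h2 := hm j hj
      by_cases hij : i = j
      · subst hij
        simp only [Finsupp.coe_add, Pi.add_apply, Finsupp.single_eq_same, h'] at h1 h2 ⊢
        omega
      · simpa [Finsupp.single_apply, hij] using h1
  · obtain ⟨m, rfl⟩ := dec m h
    obtain ⟨m', rfl⟩ := dec m' h'
    rw [mon_mul_mon, ← add_assoc, pd_mon, pd_mon, if_pos hm, pd_mon, if_pos hm', mon_mul_mon, mon_mul_mon,
      ← add_assoc, add_right_comm m _ m', ← mon_add]
    rcases Int.even_or_odd (d i) with hd | hd
    · have hs : koszul (𝕜 := 𝕜) d (m + Finsupp.single i 1) (Finsupp.single i 1) =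
          koszul d (Finsupp.single i 1) (m + Finsupp.single i 1) := by
        rw [koszul_single_mul d i _ fun ho => absurd hd (Int.not_even_iff_odd.2 ho),
          (hd.mul_right _).neg_one_zpow, one_mul]
      have hs0 : koszul (𝕜 := 𝕜) d m (Finsupp.single i 1) = koszul d (Finsupp.single i 1) m := by
        rw [koszul_single_mul d i _ fun ho => absurd hd (Int.not_even_iff_odd.2 ho),
          (hd.mul_right _).neg_one_zpow, one_mul]
      rw [(hd.mul_right _).neg_one_zpow]
      split_ifs with hadm
      · simp only [koszul_add_left, koszul_add_right, Finsupp.coe_add, Pi.add_apply,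
          Finsupp.single_eq_same, hs0]
        congr 1
        push_cast
        have e1 := koszul_mul_self (𝕜 := 𝕜) d (Finsupp.single i 1) m
        have e2 := koszul_mul_self (𝕜 := 𝕜) d (Finsupp.single i 1) m'
        have e3 := koszul_mul_self (𝕜 := 𝕜) d (Finsupp.single i 1) (Finsupp.single i 1)
        generalize koszul (𝕜 := 𝕜) d (Finsupp.single i 1) m = A at *
        generalize koszul (𝕜 := 𝕜) d (Finsupp.single i 1) m' = B at *
        generalize koszul (𝕜 := 𝕜) d (Finsupp.single i 1) (Finsupp.single i 1) = C at *
        generalize koszul (𝕜 := 𝕜) d m m' = K at *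
        linear_combination (x * y * K * ((m i : 𝕜) + m' i + 2) * (B * B * C * C) -
          x * y * K * ((m i : 𝕜) + 1)) * e1 + (x * y * K * ((m i : 𝕜) + m' i + 2) * (C * C) -
          x * y * K * ((m' i : 𝕜) + 1)) * e2 + (x * y * K * ((m i : 𝕜) + m' i + 2)) * e3
      · rw [mon_of_not_admissible]
        intro hc
        refine hadm fun j hj => ?_
        have hij : i ≠ j := fun hij => absurd hd (Int.not_even_iff_odd.2 (hij ▸ hj))
        simpa [Finsupp.single_apply, hij] using hc j hj
    · have hmi : m i = 0 := by
        have := hm i hd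
        simpa using this
      have hmi' : m' i = 0 := by
        have := hm' i hd
        simpa using this
      rw [if_neg, monDeg_add, monDeg_single, Nat.cast_one, one_mul (d i), mul_add (d i),
        zpow_add₀ (by simp), (hd.mul hd).neg_one_zpow, koszul_add_left, koszul_add_right,
        koszul_single_mul d i m fun _ => hmi, hmi, hmi']
      · rw [eq_comm, ← mon_zero (c := c) (d := d) (g + g') (m + m' + Finsupp.single i 1)]
        congr 1
        have e1 := koszul_mul_self (𝕜 := 𝕜) d (Finsupp.single i 1) m
        have e2 := koszul_mul_self (𝕜 := 𝕜) d (Finsupp.single i 1) m'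
        push_cast
        linear_combination (((-1) ^ (d i * monDeg d m) * koszul d m m' * x * y)) * (e1 - e2)
      · intro hc
        have := hc i hd
        simp at this

end Completed

end Calculus

/-! ### The Euler operator, and exponential and logarithm as solutions of Euler equations -/

section Exponential

variable {ι 𝕜 : Type*} [LinearOrder ι] [Field 𝕜]

namespace Completed

variable {c : ℤ} {d : ι → ℤ}

/-! ### The Euler operator -/

/-- The Euler operator, multiplying each monomial by its level. -/
def eul : Completed 𝕜 c d →ₗ[𝕜] Completed 𝕜 c d := diag fun g m => (level c g m : 𝕜)

theorem eul_val (a : Completed 𝕜 c d) (g : ℤ) (m : ι →₀ ℕ) :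
    (eul a).1 g m = (level c g m : 𝕜) * a.1 g m := rfl

theorem eul_mem_fil {a : Completed 𝕜 c d} {k : ℤ} (ha : a ∈ fil k) : eul a ∈ fil k :=
  diag_mem_fil ha

/-- Bounded even derivations. -/
structure IsDer (δ : Completed 𝕜 c d →ₗ[𝕜] Completed 𝕜 c d) : Prop where
  bounded : IsBounded δ
  leibniz : ∀ a b, δ (a * b) = δ a * b + a * δ b

theorem IsDer.map_one {δ : Completed 𝕜 c d →ₗ[𝕜] Completed 𝕜 c d} (h : IsDer δ) : δ 1 = 0 := by
  have := h.leibniz 1 1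
  simpa using this

theorem IsDer.sub {δ δ' : Completed 𝕜 c d →ₗ[𝕜] Completed 𝕜 c d} (h : IsDer δ) (h' : IsDer δ') :
    IsDer (δ - δ') :=
  ⟨h.bounded.sub h'.bounded, fun a b => by
    simp only [LinearMap.sub_apply, h.leibniz, h'.leibniz, sub_mul, mul_sub]; abel⟩

theorem isDer_eul : IsDer (eul : Completed 𝕜 c d →ₗ[𝕜] Completed 𝕜 c d) := by
  refine ⟨isBounded_diag _, induction_mon₂ (fun a b => eul (a * b)) (fun a b => eul a * b + a * eul b)
    (fun b => (isBounded_diag _).comp (isBounded_mulR b))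
    (fun a => (isBounded_diag _).comp (isBounded_mulL a))
    (fun b => ((isBounded_diag _).mul_right b).add (isBounded_mulR _))
    (fun a => (isBounded_mulL _).add ((isBounded_diag _).mul_left _))
    (fun _ _ _ => by simp only [add_mul, map_add]) (fun _ _ _ => by simp only [mul_add, map_add])
    (fun _ _ _ => by simp only [add_mul, map_add]; abel)
    (fun _ _ _ => by simp only [mul_add, map_add]; abel)
    (fun g m x g' m' y _ _ => ?_)⟩
  simp only [eul, mon_mul_mon, diag_mon, level_add, ← mon_add]
  congr 1
  push_cast
  ring

theorem eul_one : eul (1 : Completed 𝕜 c d) = 0 := isDer_eul.map_one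

theorem pd_eul (i : ι) (a : Completed 𝕜 c d) : pd i (eul a) = eul (pd i a) + pd i a := by
  rw [eul, pd_diag (fun g m => (level c g m : 𝕜) + 1) _ _ fun g m => by
    rw [level_add_single]; push_cast; rfl]
  ext g m
  simp only [diag_val, val_add, Pi.add_apply]
  ring

/-- The inverse of `eul - w` on terms of level larger than `w`. -/
def eulInv (w : ℤ) : Completed 𝕜 c d →ₗ[𝕜] Completed 𝕜 c d :=
  diag fun g m => if w < level c g m then ((level c g m - w : ℤ) : 𝕜)⁻¹ else 0

theorem eulInv_mem_fil_succ (w : ℤ) (a : Completed 𝕜 c d) : eulInv w a ∈ fil (w + 1) := by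
  intro g m h
  rw [eulInv, diag_val] at h
  by_contra hc
  rw [if_neg (by omega), zero_mul] at h
  exact h rfl

theorem eulInv_mem_fil {w k : ℤ} {a : Completed 𝕜 c d} (h : a ∈ fil k) : eulInv w a ∈ fil k :=
  diag_mem_fil h

theorem eul_eulInv [CharZero 𝕜] {w : ℤ} {a : Completed 𝕜 c d} (h : a ∈ fil (w + 1)) :
    eul (eulInv w a) - (w : 𝕜) • eulInv w a = a := by
  ext g m
  simp only [val_sub, Pi.sub_apply, eul_val, val_smul, Pi.smul_apply, smul_eq_mul, eulInv, diag_val]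
  by_cases h0 : a.1 g m = 0
  · simp [h0]
  · have := h g m h0
    rw [if_pos (by omega), ← sub_mul, ← Int.cast_sub, ← mul_assoc, mul_inv_cancel₀, one_mul]
    exact_mod_cast (by omega : level c g m - w ≠ 0)

theorem eulInv_eul [CharZero 𝕜] {w : ℤ} {a : Completed 𝕜 c d} (h : a ∈ fil (w + 1)) :
    eulInv w (eul a - (w : 𝕜) • a) = a := by
  ext g m
  simp only [val_sub, Pi.sub_apply, eul_val, val_smul, Pi.smul_apply, smul_eq_mul, eulInv, diag_val]
  by_cases h0 : a.1 g m = 0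
  · simp [h0]
  · have := h g m h0
    rw [if_pos (by omega), ← sub_mul, ← Int.cast_sub, ← mul_assoc, inv_mul_cancel₀, one_mul]
    exact_mod_cast (by omega : level c g m - w ≠ 0)

/-- Uniqueness for equations `eul z - w z = L z` where `L` raises the level. -/
theorem eq_zero_of_eul [CharZero 𝕜] {w : ℤ} {z z' : Completed 𝕜 c d} (hz : z ∈ fil (w + 1))
    (hL : ∀ n, z ∈ fil n → z' ∈ fil (n + 1)) (h : eul z - (w : 𝕜) • z = z') : z = 0 := by
  have key : ∀ n : ℕ, z ∈ fil (w + 1 + n) := by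
    intro n
    induction n with
    | zero => simpa using hz
    | succ n ih =>
      have h1 := hL _ ih
      intro g m hm
      have h2 := ih g m hm
      by_contra hc
      -- A term of `z` at the lowest possible level is multiplied by the nonzero factor `level - w`,
      -- while `z'` has no term at that level.
      have h3 : level c g m = w + 1 + n := by push_cast at hc; omega
      have h4 := mem_fil'.1 h1 g m (by omega)
      rw [← h] at h4
      simp only [val_sub, Pi.sub_apply, eul_val, val_smul, Pi.smul_apply, smul_eq_mul] at h4
      rw [← sub_mul, ← Int.cast_sub] at h4
      refine (mul_ne_zero ?_ hm) h4
      exact_mod_cast (by omega : level c g m - w ≠ 0)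
  refine eq_zero_of_forall_mem_fil fun k => ?_
  exact fil_anti (by omega : k ≤ w + 1 + (k - w - 1).toNat) (key _)

/-- Plays the role of the uniqueness theorem for flows: the difference of two solutions solves the
same linear equation, and `L` raises the level. -/
theorem eq_of_eul [CharZero 𝕜] {w : ℤ} {z z' : Completed 𝕜 c d} (L : Completed 𝕜 c d →+ Completed 𝕜 c d)
    (hz : z - z' ∈ fil (w + 1)) (hL : ∀ n a, a ∈ fil n → L a ∈ fil (n + 1))
    (h : eul z - (w : 𝕜) • z = L z) (h' : eul z' - (w : 𝕜) • z' = L z') : z = z' :=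
  sub_eq_zero.1 (eq_zero_of_eul hz (fun n hn => hL n _ hn) (by
    rw [map_sub L, ← h, ← h', map_sub, smul_sub]; abel))

/-! ### Exponential, inverse and logarithm -/

/-- The exponential series. -/
def expC (a : Completed 𝕜 c d) : Completed 𝕜 c d := ∑' k : ℕ, (k.factorial : 𝕜)⁻¹ • a ^ k

theorem summable_pow {a : Completed 𝕜 c d} (ha : a ∈ fil 1) (x : ℕ → 𝕜) :
    Summable fun k => x k • a ^ k := by
  refine summable_of_finite fun k => (Set.finite_lt_nat k.toNat).subset fun n hn => ?_
  by_contra hc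
  simp only [Set.mem_ofPred_eq, not_lt] at hn hc
  exact hn (Submodule.smul_mem _ _ (fil_anti (by omega) (pow_mem_fil ha n)))

theorem expC_val {a : Completed 𝕜 c d} (ha : a ∈ fil 1) : (expC a).1 = QuantumBV.exp d a.1 := by
  funext g m
  rw [expC, val_tsum (summable_pow ha _)]
  simp only [val_smul, val_pow]
  rfl

theorem tsum_pow_sub_mem_fil {a : Completed 𝕜 c d} (ha : a ∈ fil 1) (x : ℕ → 𝕜) :
    ∑' k, x k • a ^ k - x 0 • 1 ∈ fil 1 := by
  rw [(summable_pow ha x).tsum_eq_zero_add, pow_zero, add_sub_cancel_left]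
  refine tsum_mem_fil fun n => Submodule.smul_mem _ _ ?_
  exact fil_anti (by push_cast; omega) (pow_mem_fil ha (n + 1))

theorem expC_sub_one_mem {a : Completed 𝕜 c d} (ha : a ∈ fil 1) : expC a - 1 ∈ fil 1 := by
  simpa [expC] using tsum_pow_sub_mem_fil ha fun k => (k.factorial : 𝕜)⁻¹

theorem mem_fil_zero_of_sub_one {a : Completed 𝕜 c d} (ha : a - 1 ∈ fil 1) : a ∈ fil 0 := by
  have := add_mem (fil_anti (by omega : (0 : ℤ) ≤ 1) ha) one_mem_fil
  rwa [sub_add_cancel] at this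

theorem homog_tsum_pow {a : Completed 𝕜 c d} (ha : Homog 0 a) (x : ℕ → 𝕜) :
    Homog 0 (∑' k, x k • a ^ k) := Homog.tsum fun k => (ha.pow k).smul _

theorem homog_expC {a : Completed 𝕜 c d} (ha : Homog 0 a) : Homog 0 (expC a) := homog_tsum_pow ha _

/-- The Leibniz rule is only required for products with left factor `a`. So the lemma also applies
to graded derivations of odd degree, which satisfy the rule without sign when `a` has degree `0`. -/
theorem map_pow_of_leibniz {δ : Completed 𝕜 c d →ₗ[𝕜] Completed 𝕜 c d} {a : Completed 𝕜 c d}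
    (hl : ∀ y, δ (a * y) = δ a * y + a * δ y) (h : ∀ b, Commute a b) (n : ℕ) :
    δ (a ^ (n + 1)) = ((n : 𝕜) + 1) • (δ a * a ^ n) := by
  induction n with
  | zero => simp
  | succ n ih =>
    rw [pow_succ', hl, ih, mul_smul_comm, (h _).eq, mul_assoc, ← pow_succ]
    push_cast
    rw [add_smul (n : 𝕜), add_smul ((n : 𝕜) + 1), add_smul (n : 𝕜), one_smul]
    abel

theorem map_tsum_pow_of_leibniz {δ : Completed 𝕜 c d →ₗ[𝕜] Completed 𝕜 c d} (hδ : IsBounded δ)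
    {a : Completed 𝕜 c d} (h1 : δ 1 = 0) (hl : ∀ y, δ (a * y) = δ a * y + a * δ y)
    (ha : a ∈ fil 1) (h : ∀ b, Commute a b) (x : ℕ → 𝕜) :
    δ (∑' k, x k • a ^ k) = δ a * ∑' k : ℕ, (((k : 𝕜) + 1) * x (k + 1)) • a ^ k := by
  have hs := summable_pow ha x
  have h3 := IsBounded.map_tsum (L := δ.toAddMonoidHom) hδ hs
  have h2 := IsBounded.summable (L := δ.toAddMonoidHom) hδ hs
  change δ _ = ∑' k, δ _ at h3
  change Summable fun k => δ _ at h2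
  rw [h3, h2.tsum_eq_zero_add, ← (summable_pow ha _).tsum_mul_left]
  simp only [map_smul, pow_zero, h1, smul_zero, zero_add, map_pow_of_leibniz hl h, mul_smul_comm,
    smul_smul]
  refine tsum_congr fun k => ?_
  rw [mul_comm]

theorem map_expC_of_leibniz [CharZero 𝕜] {δ : Completed 𝕜 c d →ₗ[𝕜] Completed 𝕜 c d} (hδ : IsBounded δ)
    {a : Completed 𝕜 c d} (h1 : δ 1 = 0) (hl : ∀ y, δ (a * y) = δ a * y + a * δ y)
    (ha : a ∈ fil 1) (h : Homog 0 a) : δ (expC a) = δ a * expC a := by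
  rw [expC, map_tsum_pow_of_leibniz hδ h1 hl ha h.commute]
  congr 2
  funext k
  congr 1
  rw [Nat.factorial_succ]
  push_cast
  field_simp

theorem IsDer.map_tsum_pow {δ : Completed 𝕜 c d →ₗ[𝕜] Completed 𝕜 c d} (hδ : IsDer δ)
    {a : Completed 𝕜 c d} (ha : a ∈ fil 1) (h : ∀ b, Commute a b) (x : ℕ → 𝕜) :
    δ (∑' k, x k • a ^ k) = δ a * ∑' k : ℕ, (((k : 𝕜) + 1) * x (k + 1)) • a ^ k :=
  map_tsum_pow_of_leibniz hδ.bounded hδ.map_one (hδ.leibniz a) ha h x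

theorem IsDer.map_expC [CharZero 𝕜] {δ : Completed 𝕜 c d →ₗ[𝕜] Completed 𝕜 c d} (hδ : IsDer δ)
    {a : Completed 𝕜 c d} (ha : a ∈ fil 1) (h : Homog 0 a) : δ (expC a) = δ a * expC a :=
  map_expC_of_leibniz hδ.bounded hδ.map_one (hδ.leibniz a) ha h

theorem pd_one (i : ι) : pd i (1 : Completed 𝕜 c d) = 0 := by
  rw [one_eq_mon]
  exact pd_mon_of_eq_zero (by simp) _ _

theorem pd_expC [CharZero 𝕜] (i : ι) {a : Completed 𝕜 c d} (ha : a ∈ fil 1) (h : Homog 0 a) :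
    pd i (expC a) = pd i a * expC a :=
  map_expC_of_leibniz (isBounded_pd i) (pd_one i) (fun y => by
    rw [pd_mul, h.rho_eq]; simp) ha h

/-- Both sides solve `E z = E (a + b) z` and have leading term `1`; uniqueness replaces the
rearrangement of a double series. -/
theorem expC_add [CharZero 𝕜] {a b : Completed 𝕜 c d} (ha : a ∈ fil 1) (hb : b ∈ fil 1)
    (ha' : Homog 0 a) (hb' : Homog 0 b) : expC (a + b) = expC a * expC b := by
  refine eq_of_eul (w := 0) (mulL (eul (a + b))) ?_ (fun n y hy => ?_) ?_ ?_
  · have h1 := expC_sub_one_mem (add_mem ha hb)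
    have h2 : expC a * expC b - 1 ∈ fil 1 := by
      have h3 := mul_mem_fil (expC_sub_one_mem ha) (mem_fil_zero_of_sub_one (expC_sub_one_mem hb))
      have h4 := add_mem h3 (expC_sub_one_mem hb)
      rw [sub_mul, one_mul] at h4
      simpa using h4
    simpa using sub_mem h1 h2
  · rw [add_comm]
    exact mul_mem_fil (eul_mem_fil (add_mem ha hb)) hy
  · rw [isDer_eul.map_expC (add_mem ha hb) (ha'.add hb')]
    simp [mulL]
  · rw [isDer_eul.leibniz, isDer_eul.map_expC ha ha', isDer_eul.map_expC hb hb', ← mul_assoc (expC a),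
      ((homog_expC ha').commute _).eq, mul_assoc, mul_assoc, map_add]
    simp [mulL, add_mul]

theorem expC_zero : expC (0 : Completed 𝕜 c d) = 1 := by
  rw [expC, tsum_eq_single 0]
  · simp
  · intro k hk
    simp [hk]

theorem expC_mul_expC_neg [CharZero 𝕜] {a : Completed 𝕜 c d} (ha : a ∈ fil 1) (ha' : Homog 0 a) :
    expC a * expC (-a) = 1 := by
  rw [← expC_add ha (neg_mem ha) ha' ha'.neg, add_neg_cancel, expC_zero]

/-- The inverse of a function `x` with constant leading term `1`. -/
def invC (x : Completed 𝕜 c d) : Completed 𝕜 c d := ∑' k : ℕ, ((-1 : 𝕜) ^ k) • (x - 1) ^ k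

theorem invC_sub_one_mem {x : Completed 𝕜 c d} (hx : x - 1 ∈ fil 1) : invC x - 1 ∈ fil 1 := by
  simpa [invC] using tsum_pow_sub_mem_fil hx fun k => (-1 : 𝕜) ^ k

theorem mul_invC {x : Completed 𝕜 c d} (hx : x - 1 ∈ fil 1) : x * invC x = 1 := by
  have hs := summable_pow hx fun k => (-1 : 𝕜) ^ k
  have h1 : invC x = 1 - (x - 1) * invC x := by
    conv_lhs => rw [invC, hs.tsum_eq_zero_add]
    rw [invC, ← hs.tsum_mul_left, sub_eq_add_neg (1 : Completed 𝕜 c d), ← tsum_neg]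
    simp only [pow_zero, one_smul, pow_succ' (x - 1), pow_succ' (-1 : 𝕜), mul_smul_comm, neg_mul,
      one_mul, neg_smul]
  rw [sub_mul, one_mul] at h1
  have h2 : x * invC x = 1 - invC x + invC x := by
    nth_rewrite 2 [h1]
    abel
  rw [h2, sub_add_cancel]

/-- The logarithm of a function with constant leading term `1`. -/
def logC (x : Completed 𝕜 c d) : Completed 𝕜 c d :=
  ∑' k : ℕ, (if k = 0 then 0 else (-1 : 𝕜) ^ (k + 1) * (k : 𝕜)⁻¹) • (x - 1) ^ k

theorem logC_mem_fil {x : Completed 𝕜 c d} (hx : x - 1 ∈ fil 1) : logC x ∈ fil 1 := by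
  have := tsum_pow_sub_mem_fil hx fun k => if k = 0 then 0 else (-1 : 𝕜) ^ (k + 1) * (k : 𝕜)⁻¹
  rwa [if_pos rfl, zero_smul, sub_zero] at this

theorem homog_logC {x : Completed 𝕜 c d} (hx : Homog 0 x) : Homog 0 (logC x) :=
  homog_tsum_pow (hx.sub Homog.one) _

theorem homog_invC {x : Completed 𝕜 c d} (hx : Homog 0 x) : Homog 0 (invC x) :=
  homog_tsum_pow (hx.sub Homog.one) _

/-- Termwise differentiation turns the logarithm series into the geometric series of `invC`. -/
theorem eul_logC [CharZero 𝕜] {x : Completed 𝕜 c d} (hx : x - 1 ∈ fil 1) (hx' : Homog 0 x) :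
    eul (logC x) = eul x * invC x := by
  rw [logC, isDer_eul.map_tsum_pow hx (hx'.sub Homog.one).commute, map_sub, eul_one, sub_zero, invC]
  congr 2
  funext k
  congr 1
  have : (k : 𝕜) + 1 ≠ 0 := by exact_mod_cast Nat.succ_ne_zero k
  rw [if_neg (by omega)]
  push_cast
  rw [pow_succ, pow_succ]
  field_simp

/-- Both sides solve `E z = (E x · x⁻¹) z` and have leading term `1`. -/
theorem expC_logC [CharZero 𝕜] {x : Completed 𝕜 c d} (hx : x - 1 ∈ fil 1) (hx' : Homog 0 x) :
    expC (logC x) = x := by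
  have he : eul x ∈ fil 1 := by
    have := eul_mem_fil hx
    rwa [map_sub, eul_one, sub_zero] at this
  refine eq_of_eul (w := 0) (mulL (eul x * invC x)) ?_ (fun n y hy => ?_) ?_ ?_
  · simpa using sub_mem (expC_sub_one_mem (logC_mem_fil hx)) hx
  · rw [add_comm]
    have := mul_mem_fil he (mem_fil_zero_of_sub_one (invC_sub_one_mem hx))
    rw [add_zero] at this
    exact mul_mem_fil this hy
  · rw [isDer_eul.map_expC (logC_mem_fil hx) (homog_logC hx'), eul_logC hx hx']
    simp [mulL]
  · have : eul x * invC x * x = eul x := by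
      rw [mul_assoc, ((homog_invC hx').commute x).eq, mul_invC hx, mul_one]
    simp [mulL, this]

/-- The Euler operator annihilates the difference and is injective on positive levels. -/
theorem logC_expC [CharZero 𝕜] {a : Completed 𝕜 c d} (ha : a ∈ fil 1) (ha' : Homog 0 a) :
    logC (expC a) = a := by
  have h1 := expC_sub_one_mem ha
  refine sub_eq_zero.1 (eq_zero_of_eul (w := 0) (z' := 0) (sub_mem (logC_mem_fil h1) ha)
    (fun _ _ => zero_mem _) ?_)
  rw [map_sub, eul_logC h1 (homog_expC ha'), isDer_eul.map_expC ha ha', mul_assoc, mul_invC h1]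
  simp

end Completed

end Exponential

/-! ### Pullback along formal maps, and comparison of the completions by `2 g + n` and `g + n` -/

section Pullback

variable {ι 𝕜 : Type*} [LinearOrder ι] [Field 𝕜]

namespace Completed

variable {c : ℤ} {d : ι → ℤ}

/-! ### Multiplication by powers of `ħ` and by coordinates -/

/-- The function `ħ^k`. -/
def hb (k : ℤ) : Completed 𝕜 c d := mon c d k 0 1

theorem homog_hb (k : ℤ) : Homog 0 (hb k : Completed 𝕜 c d) := by
  simpa [hb] using homog_mon (c := c) (d := d) k 0 (1 : 𝕜)

theorem hb_mem_fil (k : ℤ) : (hb k : Completed 𝕜 c d) ∈ fil (c * k) := by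
  simpa [level, hb] using mon_mem_fil (c := c) (d := d) k 0 (1 : 𝕜)

theorem hb_mul_mon (k g : ℤ) (m : ι →₀ ℕ) (x : 𝕜) :
    hb k * mon c d g m x = mon c d (k + g) m x := by
  rw [hb, mon_mul_mon]; simp

theorem hb_mul_hb (k l : ℤ) : (hb k * hb l : Completed 𝕜 c d) = hb (k + l) := hb_mul_mon _ _ _ _

@[simp] theorem hb_zero : (hb 0 : Completed 𝕜 c d) = 1 := one_eq_mon.symm

theorem hb_mul_mem_fil {k l : ℤ} {a : Completed 𝕜 c d} (ha : a ∈ fil l) : hb k * a ∈ fil (c * k + l) :=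
  mul_mem_fil (hb_mem_fil k) ha

open Classical in
theorem hb_mul_val_apply (k : ℤ) (a : Completed 𝕜 c d) (g : ℤ) (m : ι →₀ ℕ) :
    (hb k * a).1 g m = a.1 (g - k) m := by
  have h1 : ∀ n : ℤ, ∀ b : Completed 𝕜 c d, b ∈ fil n → (level c (g - k) m < n) → (hb k * b).1 g m = 0 := by
    intro n b hb hn
    refine mem_fil'.1 (hb_mul_mem_fil hb) g m ?_
    have : level c g m = c * k + level c (g - k) m := by simp only [level]; ring
    omega
  obtain ⟨s, hs, hs'⟩ := a.exists_finset_approx (level c (g - k) m + 1)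
  have h2 := h1 _ _ hs' (by omega)
  have h3 := mem_fil'.1 hs' (g - k) m (by omega)
  rw [mul_sub, Finset.mul_sum] at h2
  simp only [val_sub, Pi.sub_apply, val_sum, hb_mul_mon, mon_val] at h2 h3
  rw [sub_eq_zero] at h2 h3
  rw [h2, h3]
  refine Finset.sum_congr rfl fun p _ => ?_
  have : g = k + p.1 ↔ g - k = p.1 := by omega
  exact if_congr (by rw [this]) rfl rfl

theorem hb_mul_val (k : ℤ) (a : Completed 𝕜 c d) : (hb k * a).1 = hbarPow k a.1 :=
  funext fun _ => funext fun _ => hb_mul_val_apply _ _ _ _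

theorem Homog.hb_mul {n : ℤ} {a : Completed 𝕜 c d} (ha : Homog n a) (k : ℤ) : Homog n (hb k * a) := by
  simpa using (homog_hb k).mul ha

theorem hb_comm (k : ℤ) (a : Completed 𝕜 c d) : hb k * a = a * hb k := (homog_hb k).commute a

theorem rho_hb (n k : ℤ) : rho n (hb k : Completed 𝕜 c d) = hb k := by
  rw [(homog_hb k).rho_eq]; simp

theorem pd_hb (i : ι) (k : ℤ) : pd i (hb k : Completed 𝕜 c d) = 0 := pd_mon_of_eq_zero (by simp) _ _

theorem pd_hb_mul (i : ι) (k : ℤ) (a : Completed 𝕜 c d) : pd i (hb k * a) = hb k * pd i a := by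
  rw [pd_mul, pd_hb, zero_mul, zero_add, rho_hb]

theorem eul_hb (k : ℤ) : eul (hb k : Completed 𝕜 c d) = ((c * k : ℤ) : 𝕜) • hb k := by
  rw [hb, eul, diag_mon, smul_mon]
  simp [level]

theorem hb_mul_cancel (k : ℤ) (a : Completed 𝕜 c d) : hb (-k) * (hb k * a) = a := by
  rw [← mul_assoc, hb_mul_hb, neg_add_cancel, hb_zero, one_mul]

theorem hb_mul_cancel' (k : ℤ) (a : Completed 𝕜 c d) : hb k * (hb (-k) * a) = a := by
  rw [← mul_assoc, hb_mul_hb, add_neg_cancel, hb_zero, one_mul]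

theorem admissible_single (d : ι → ℤ) (i : ι) : Admissible d (Finsupp.single i 1) := by
  intro j _
  rw [Finsupp.single_apply]
  split_ifs <;> simp

/-- The coordinate `φ^i`. -/
def crd (i : ι) : Completed 𝕜 c d := mon c d 0 (Finsupp.single i 1) 1

theorem crd_val (i : ι) : (crd i : Completed 𝕜 c d).1 = coord i := by
  funext g m
  rw [crd, mon_val, coord]
  simp [admissible_single]

theorem homog_crd (i : ι) : Homog (d i) (crd i : Completed 𝕜 c d) := by
  simpa [crd] using homog_mon (c := c) (d := d) 0 (Finsupp.single i 1) (1 : 𝕜)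

theorem crd_mem_fil (i : ι) : (crd i : Completed 𝕜 c d) ∈ fil 1 := by
  simpa [level, crd] using mon_mem_fil (c := c) (d := d) 0 (Finsupp.single i 1) (1 : 𝕜)

theorem crd_mul_mon (i : ι) (g : ℤ) (m : ι →₀ ℕ) (x : 𝕜) : crd i * mon c d g m x =
    mon c d g (m + Finsupp.single i 1) (koszul d (Finsupp.single i 1) m * x) := by
  rw [crd, mon_mul_mon, zero_add, one_mul, add_comm]

theorem eul_crd (i : ι) : eul (crd i : Completed 𝕜 c d) = crd i := by
  rw [crd, eul, diag_mon]
  simp [level]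

theorem pd_crd (i j : ι) : pd i (crd j : Completed 𝕜 c d) = if i = j then 1 else 0 := by
  split_ifs with h
  · subst h
    rw [crd, ← zero_add (Finsupp.single i 1), pd_mon, if_pos (by simpa using admissible_single d i)]
    simp [one_eq_mon]
  · exact pd_mon_of_eq_zero (by simp [Ne.symm h]) _ _

/-! ### Pullbacks -/

/-- The pullback `Φ^* φ^a`. -/
def pm (f : ι → Completed 𝕜 c d) (a : ι →₀ ℕ) : Completed 𝕜 c d :=
  (a.support.sort (· ≤ ·)).foldr (fun i F => f i ^ a i * F) 1

theorem foldr_val (f : ι → Completed 𝕜 c d) (a : ι →₀ ℕ) (l : List ι) :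
    (l.foldr (fun i F => f i ^ a i * F) 1 : Completed 𝕜 c d).1 =
      l.foldr (fun i F => mul d (QuantumBV.pow d (f i).1 (a i)) F) QuantumBV.one := by
  induction l with
  | nil => rfl
  | cons i l ih => rw [List.foldr_cons, val_mul, ih, val_pow]; rfl

theorem pm_val (f : ι → Completed 𝕜 c d) (a : ι →₀ ℕ) :
    (pm f a).1 = pullMon d (fun i => (f i).1) a := foldr_val f a _

theorem foldr_mem_fil {f : ι → Completed 𝕜 c d} (hf : ∀ i, f i ∈ fil 1) (a : ι →₀ ℕ) (l : List ι) :
    l.foldr (fun i F => f i ^ a i * F) 1 ∈ fil (c := c) (d := d) (𝕜 := 𝕜) (l.map fun i => (a i : ℤ)).sum := by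
  induction l with
  | nil => exact one_mem_fil
  | cons i l ih =>
    rw [List.foldr_cons, List.map_cons, List.sum_cons]
    refine mul_mem_fil ?_ ih
    simpa using pow_mem_fil (hf i) (a i)

theorem sum_sort {M : Type*} [AddCommMonoid M] (s : Finset ι) (u : ι → M) :
    ((s.sort (· ≤ ·)).map u).sum = ∑ i ∈ s, u i := by
  rw [← List.sum_toFinset u (s.sort_nodup _), Finset.sort_toFinset]

theorem pm_mem_fil {f : ι → Completed 𝕜 c d} (hf : ∀ i, f i ∈ fil 1) (a : ι →₀ ℕ) :
    pm f a ∈ fil (a.degree : ℤ) := by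
  have := foldr_mem_fil hf a (a.support.sort (· ≤ ·))
  rw [sum_sort] at this
  rw [Finsupp.degree_apply]
  push_cast
  exact this

/-- Indices with exponent zero contribute factors `1`. Enlarging the index set allows the ordered
products for `a` and for `a` plus one further coordinate to be compared along the same list. -/
theorem foldr_congr_support (f : ι → Completed 𝕜 c d) (a : ι →₀ ℕ) {s : Finset ι} (hs : a.support ⊆ s) :
    pm f a = (s.sort (· ≤ ·)).foldr (fun i F => f i ^ a i * F) 1 := by
  have h1 : a.support.sort (· ≤ ·) = (s.sort (· ≤ ·)).filter fun i => decide (a i ≠ 0) := by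
    refine (List.Pairwise.eq_of_mem_iff (r := (· < ·)) ?_ ?_ ?_)
    · exact Finset.sortedLT_sort _ |>.pairwise
    · exact (Finset.sortedLT_sort _ |>.pairwise).filter _
    · intro i
      simp only [Finset.mem_sort, Finsupp.mem_support_iff, List.mem_filter, decide_eq_true_eq]
      exact ⟨fun h => ⟨hs (Finsupp.mem_support_iff.2 h), h⟩, fun h => h.2⟩
  rw [pm, h1]
  induction s.sort (· ≤ ·) with
  | nil => rfl
  | cons i l ih =>
    by_cases h : a i = 0
    · rw [List.filter_cons_of_neg (by simp [h]), List.foldr_cons, h, pow_zero, one_mul, ih]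
    · rw [List.filter_cons_of_pos (by simp [h]), List.foldr_cons, List.foldr_cons, ih]

theorem Homog.mul_pow_comm {n k : ℤ} {u v : Completed 𝕜 c d} (hu : Homog n u) (hv : Homog k v) (r : ℕ) :
    u * v ^ r = ((-1) ^ (n * (r * k)) : 𝕜) • (v ^ r * u) := by
  rw [hu.mul_comm, map_pow, hv.rho_eq, smul_pow, smul_mul_assoc, ← zpow_natCast, ← zpow_mul]
  congr 2; ring

theorem foldr_congr (f : ι → Completed 𝕜 c d) (a b : ι →₀ ℕ) (l : List ι) (h : ∀ i ∈ l, a i = b i) :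
    l.foldr (fun i F => f i ^ a i * F) 1 = l.foldr (fun i F => f i ^ b i * F) (1 : Completed 𝕜 c d) := by
  induction l with
  | nil => rfl
  | cons i l ih =>
    rw [List.foldr_cons, List.foldr_cons, ih fun j hj => h j (List.mem_cons_of_mem _ hj),
      h i List.mem_cons_self]

/-- On the way to its place in the ordered product, `f i` passes exactly the powers with smaller
index, and these produce the sign. -/
theorem mul_foldr {f : ι → Completed 𝕜 c d} (hf : ∀ i, Homog (d i) (f i)) (a : ι →₀ ℕ) (i : ι) (l : List ι)
    (hl : l.Pairwise (· < ·)) (hi : i ∈ l) :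
    f i * l.foldr (fun i F => f i ^ a i * F) 1 =
      ((-1) ^ (d i * (l.map fun k => if k < i then (a k : ℤ) * d k else 0).sum) : 𝕜) •
        l.foldr (fun j F => f j ^ ((a + Finsupp.single i 1 : ι →₀ ℕ) j) * F) 1 := by
  induction l with
  | nil => simp at hi
  | cons j l ih =>
    rw [List.pairwise_cons] at hl
    simp only [List.foldr_cons, List.map_cons, List.sum_cons]
    rcases List.mem_cons.1 hi with rfl | hi
    · have h1 : (l.map fun k => if k < i then (a k : ℤ) * d k else 0).sum = 0 := by
        refine List.sum_eq_zero fun x hx => ?_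
        obtain ⟨k, hk, rfl⟩ := List.mem_map.1 hx
        rw [if_neg (hl.1 k hk).not_gt]
      rw [h1, if_neg (lt_irrefl _), foldr_congr f (a + Finsupp.single i 1) a l]
      · simp only [Finsupp.coe_add, Pi.add_apply, Finsupp.single_eq_same, pow_succ']
        simp [mul_assoc]
      · intro k hk
        simp [(hl.1 k hk).ne]
    · have hji := hl.1 i hi
      rw [← mul_assoc, (hf i).mul_pow_comm (hf j), smul_mul_assoc, mul_assoc, ih hl.2 hi, mul_smul_comm,
        smul_smul, if_pos hji, mul_add, zpow_add₀ (by simp)]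
      simp [hji.ne']

theorem sq_eq_zero_of_odd [CharZero 𝕜] {n : ℤ} (hn : Odd n) {u : Completed 𝕜 c d} (hu : Homog n u) :
    u * u = 0 := by
  have h1 := hu.mul_comm u
  rw [hu.rho_eq, (hn.mul hn).neg_one_zpow, smul_mul_assoc, neg_smul, one_smul] at h1
  have h2 : (2 : 𝕜) • (u * u) = 0 := by
    rw [two_smul]
    nth_rewrite 1 [h1]
    simp
  exact (smul_eq_zero.1 h2).resolve_left two_ne_zero

/-- The product contains the square of an odd function. This is the relation already built into
`mon`, so the pullback formula is valid on all exponents. -/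
theorem pm_of_not_admissible [CharZero 𝕜] {f : ι → Completed 𝕜 c d} (hf : ∀ i, Homog (d i) (f i))
    {a : ι →₀ ℕ} (ha : ¬ Admissible d a) : pm f a = 0 := by
  simp only [Admissible, not_forall, not_le] at ha
  obtain ⟨i, hi, h2⟩ := ha
  have h0 : f i ^ a i = 0 := by
    obtain ⟨k, hk⟩ := Nat.exists_eq_add_of_lt h2
    rw [hk, show 1 + k + 1 = k + 2 by ring, pow_add, pow_two, sq_eq_zero_of_odd hi (hf i), mul_zero]
  have key : ∀ l : List ι, i ∈ l → l.foldr (fun i F => f i ^ a i * F) 1 = 0 := by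
    intro l hl
    induction l with
    | nil => simp at hl
    | cons j l ih =>
      rcases List.mem_cons.1 hl with rfl | hl
      · rw [List.foldr_cons, h0, zero_mul]
      · rw [List.foldr_cons, ih hl, mul_zero]
  exact key _ ((Finset.mem_sort _).2 (Finsupp.mem_support_iff.2 (by omega)))

theorem mul_pm {f : ι → Completed 𝕜 c d} (hf : ∀ i, Homog (d i) (f i)) (i : ι) (a : ι →₀ ℕ) :
    f i * pm f a = koszul (𝕜 := 𝕜) d (Finsupp.single i 1) a • pm f (a + Finsupp.single i 1) := by
  classical
  have hs : a.support ⊆ (a + Finsupp.single i 1).support := fun j hj => by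
    rw [Finsupp.mem_support_iff] at hj ⊢
    simp only [Finsupp.coe_add, Pi.add_apply]
    omega
  rw [foldr_congr_support f a hs, mul_foldr hf a i _ (Finset.sortedLT_sort _ |>.pairwise)
    ((Finset.mem_sort _).2 (by simp)), pm, sum_sort]
  congr 1
  rw [koszul_eq, koszulExp, Finsupp.sum_single_index (by simp [Finsupp.sum]), Finset.mul_sum,
    Finsupp.sum_of_support_subset _ hs _ (by simp)]
  congr 1
  refine Finset.sum_congr rfl fun j _ => ?_
  split_ifs <;> simp

/-- The data of a formal map of level-preserving form. -/
structure IsMap (f : ι → Completed 𝕜 c d) : Prop where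
  homog : ∀ i, Homog (d i) (f i)
  mem : ∀ i, f i ∈ fil 1

section

variable {f : ι → Completed 𝕜 c d}

theorem hb_mul_pm_mem (hf : IsMap f) (g : ℤ) (m : ι →₀ ℕ) : hb g * pm f m ∈ fil (level c g m) :=
  hb_mul_mem_fil (pm_mem_fil hf.mem m)

theorem summable_pull (hf : IsMap f) (y : Completed 𝕜 c d) :
    Summable fun p : ℤ × (ι →₀ ℕ) => y.1 p.1 p.2 • (hb p.1 * pm f p.2) := by
  refine summable_of_finite fun k => (y.levelFinite k).subset fun p hp => ?_
  refine ⟨?_, fun h0 => hp (by rw [h0, zero_smul]; exact zero_mem _)⟩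
  by_contra hc
  exact hp (Submodule.smul_mem _ _ (fil_anti (by omega) (hb_mul_pm_mem hf _ _)))

/-- The pullback of functions, as a linear map. -/
def pullL (hf : IsMap f) : Completed 𝕜 c d →ₗ[𝕜] Completed 𝕜 c d where
  toFun y := ∑' p : ℤ × (ι →₀ ℕ), y.1 p.1 p.2 • (hb p.1 * pm f p.2)
  map_add' y z := by
    rw [← (summable_pull hf y).tsum_add (summable_pull hf z)]
    exact tsum_congr fun p => add_smul _ _ _
  map_smul' x y := by
    ext g m
    change (∑' p : ℤ × (ι →₀ ℕ), (x • y).1 p.1 p.2 • (hb p.1 * pm f p.2)).1 g m =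
      x • (∑' p : ℤ × (ι →₀ ℕ), y.1 p.1 p.2 • (hb p.1 * pm f p.2)).1 g m
    rw [val_tsum (summable_pull hf y), val_tsum (summable_pull hf _), smul_finsum]
    simp only [val_smul, Pi.smul_apply, smul_assoc]

theorem pullL_val (hf : IsMap f) (y : Completed 𝕜 c d) :
    (pullL hf y).1 = pullback d (fun i => (f i).1) y.1 := by
  funext g m
  change (∑' p : ℤ × (ι →₀ ℕ), y.1 p.1 p.2 • (hb p.1 * pm f p.2)).1 g m = _
  rw [val_tsum (summable_pull hf y), pullback]
  simp only [val_smul, Pi.smul_apply, hb_mul_val_apply, pm_val, smul_eq_mul]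

theorem pullL_mem_fil (hf : IsMap f) {y : Completed 𝕜 c d} {k : ℤ} (hy : y ∈ fil k) :
    pullL hf y ∈ fil k := by
  refine tsum_mem_fil fun p => ?_
  by_cases h0 : y.1 p.1 p.2 = 0
  · rw [h0, zero_smul]; exact zero_mem _
  · exact Submodule.smul_mem _ _ (fil_anti (hy _ _ h0) (hb_mul_pm_mem hf _ _))

theorem isBounded_pullL (hf : IsMap f) : IsBounded (pullL hf) := fun k => ⟨k, fun _ h => pullL_mem_fil hf h⟩

theorem pullL_mon (hf : IsMap f) (g : ℤ) {m : ι →₀ ℕ} (hm : Admissible d m) (x : 𝕜) :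
    pullL hf (mon c d g m x) = x • (hb g * pm f m) := by
  change (∑' p : ℤ × (ι →₀ ℕ), (mon c d g m x).1 p.1 p.2 • (hb p.1 * pm f p.2)) = _
  rw [tsum_eq_single (g, m)]
  · simp [mon_val, hm]
  · intro p hp
    rw [mon_val, if_neg, zero_smul]
    rintro ⟨-, h1, h2⟩
    exact hp (Prod.ext h1 h2)

variable [CharZero 𝕜]

theorem pullL_mon' (hf : IsMap f) (g : ℤ) (m : ι →₀ ℕ) (x : 𝕜) :
    pullL hf (mon c d g m x) = x • (hb g * pm f m) := by
  by_cases hm : Admissible d m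
  · exact pullL_mon hf g hm x
  · rw [mon_of_not_admissible hm, map_zero, pm_of_not_admissible hf.homog hm, mul_zero, smul_zero]

theorem pm_zero (f : ι → Completed 𝕜 c d) : pm f 0 = 1 := by simp [pm]

theorem pullL_one (hf : IsMap f) : pullL hf 1 = 1 := by
  rw [one_eq_mon, pullL_mon hf 0 admissible_zero, pm_zero, hb_zero, one_smul, mul_one, one_eq_mon]

theorem pullL_hb_mul (hf : IsMap f) (k : ℤ) (y : Completed 𝕜 c d) :
    pullL hf (hb k * y) = hb k * pullL hf y :=
  induction_mon (fun y => pullL hf (hb k * y)) (fun y => hb k * pullL hf y)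
    ((isBounded_pullL hf).comp (isBounded_mulL _)) ((isBounded_pullL hf).mul_left _)
    (fun _ _ => by rw [mul_add, map_add]) (fun _ _ => by rw [map_add, mul_add])
    (fun g m x hm => by
      rw [hb_mul_mon, pullL_mon hf _ hm, pullL_mon hf _ hm, mul_smul_comm, ← mul_assoc, hb_mul_hb]) y

theorem pullL_crd_mul (hf : IsMap f) (i : ι) (y : Completed 𝕜 c d) :
    pullL hf (crd i * y) = f i * pullL hf y :=
  induction_mon (fun y => pullL hf (crd i * y)) (fun y => f i * pullL hf y)
    ((isBounded_pullL hf).comp (isBounded_mulL _)) ((isBounded_pullL hf).mul_left _)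
    (fun _ _ => by rw [mul_add, map_add]) (fun _ _ => by rw [map_add, mul_add])
    (fun g m x hm => by
      rw [crd_mul_mon, pullL_mon' hf, pullL_mon hf _ hm, mul_smul_comm, ← mul_assoc, ← hb_comm, mul_assoc,
        mul_pm hf.homog, mul_smul_comm, smul_smul, mul_comm x]) y

theorem pullL_crd (hf : IsMap f) (i : ι) : pullL hf (crd i) = f i := by
  have := pullL_crd_mul hf i 1
  rwa [pullL_one, mul_one, mul_one] at this

/-- Properties of monomials may be proved by multiplying coordinates. -/
theorem mon_induction {p : Completed 𝕜 c d → Prop} (h1 : p 1) (hX : ∀ i, p (crd i))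
    (hmul : ∀ a b, p a → p b → p (a * b)) (hsmul : ∀ (x : 𝕜) a, p a → p (x • a)) (m : ι →₀ ℕ) :
    p (mon c d 0 m 1) := by
  have hadd : ∀ a b, p (mon c d 0 a 1) → p (mon c d 0 b 1) → p (mon c d 0 (a + b) 1) := by
    intro a b ha hb
    have := hsmul (koszul d a b) _ (hmul _ _ ha hb)
    rwa [mon_mul_mon, smul_mon, zero_add, one_mul, mul_one, koszul_mul_self] at this
  induction m using Finsupp.induction_linear with
  | zero => rwa [← one_eq_mon]
  | add a b ha hb => exact hadd a b ha hb
  | single i n =>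
    induction n with
    | zero => rwa [Finsupp.single_zero, ← one_eq_mon]
    | succ n ih =>
      rw [Finsupp.single_add]
      exact hadd _ _ ih (hX i)

theorem mon_eq_smul (g : ℤ) (m : ι →₀ ℕ) (x : 𝕜) : mon c d g m x = x • (hb g * mon c d 0 m 1) := by
  rw [hb_mul_mon, smul_mon, add_zero, mul_one]

/-- The pullback of functions, as an algebra homomorphism. -/
def pull (hf : IsMap f) : Completed 𝕜 c d →ₐ[𝕜] Completed 𝕜 c d :=
  AlgHom.ofLinearMap (pullL hf) (pullL_one hf) fun y z => by
    refine induction_mon (fun y => pullL hf (y * z)) (fun y => pullL hf y * pullL hf z)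
      ((isBounded_pullL hf).comp (isBounded_mulR _)) ((isBounded_pullL hf).mul_right _)
      (fun _ _ => by rw [add_mul, map_add]) (fun _ _ => by rw [map_add, add_mul]) (fun g m x _ => ?_) y
    -- The left factors for which multiplicativity holds contain the coordinates and are closed
    -- under products and scalars, hence contain all monomials.
    have key : ∀ z, pullL hf (mon c d 0 m 1 * z) = pullL hf (mon c d 0 m 1) * pullL hf z := by
      refine mon_induction (p := fun y => ∀ z, pullL hf (y * z) = pullL hf y * pullL hf z) (fun z => ?_)
        (fun i z => ?_) (fun a b ha hb z => ?_) (fun x a ha z => ?_) m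
      · rw [one_mul, pullL_one, one_mul]
      · rw [pullL_crd_mul, pullL_crd]
      · rw [mul_assoc, ha, hb, ha b, mul_assoc]
      · rw [smul_mul_assoc, map_smul, ha, map_smul, smul_mul_assoc]
    rw [mon_eq_smul, smul_mul_assoc, map_smul, mul_assoc, pullL_hb_mul, key, map_smul, pullL_hb_mul,
      smul_mul_assoc, mul_assoc]

theorem pull_val (hf : IsMap f) (y : Completed 𝕜 c d) :
    (pull hf y).1 = pullback d (fun i => (f i).1) y.1 := pullL_val hf y

theorem pull_mem_fil (hf : IsMap f) {y : Completed 𝕜 c d} {k : ℤ} (hy : y ∈ fil k) :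
    pull hf y ∈ fil k := pullL_mem_fil hf hy

theorem isBounded_pull (hf : IsMap f) : IsBounded (pull hf) := isBounded_pullL hf

theorem pull_crd (hf : IsMap f) (i : ι) : pull hf (crd i) = f i := pullL_crd hf i

theorem pull_hb (hf : IsMap f) (k : ℤ) : pull hf (hb k) = hb k := by
  have := pullL_hb_mul hf k 1
  rw [pullL_one, mul_one] at this
  exact this

theorem pull_expC (hf : IsMap f) {a : Completed 𝕜 c d} (ha : a ∈ fil 1) :
    pull hf (expC a) = expC (pull hf a) := by
  have := IsBounded.map_tsum (L := (pull hf).toLinearMap.toAddMonoidHom) (isBounded_pull hf)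
    (summable_pow ha fun k => (k.factorial : 𝕜)⁻¹)
  change pull hf (expC a) = ∑' k, pull hf _ at this
  rw [this, expC]
  simp only [map_smul, map_pow]

/-- A derivation with `δ f_i = f_i` corresponds to the Euler operator under the pullback. -/
theorem der_pull (hf : IsMap f) {δ : Completed 𝕜 c d →ₗ[𝕜] Completed 𝕜 c d} (hδ : IsDer δ)
    (h1 : ∀ i, δ (f i) = f i) (h2 : ∀ k, δ (hb k) = ((c * k : ℤ) : 𝕜) • hb k) (y : Completed 𝕜 c d) :
    δ (pull hf y) = pull hf (eul y) := by
  refine induction_mon (fun y => δ (pull hf y)) (fun y => pull hf (eul y))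
      (hδ.bounded.comp (isBounded_pull hf)) ((isBounded_pull hf).comp (isBounded_diag _))
      (fun _ _ => by rw [map_add, map_add]) (fun _ _ => by rw [map_add, map_add]) (fun g m x _ => ?_) y
  -- Both sides are derivations along the homomorphism `pull hf`, so agreement on the coordinates
  -- and on powers of `ħ` suffices.
  have key : δ (pull hf (mon c d 0 m 1)) = pull hf (eul (mon c d 0 m 1)) := by
    refine mon_induction (p := fun y => δ (pull hf y) = pull hf (eul y)) ?_ (fun i => ?_)
      (fun a b ha hb => ?_) (fun x a ha => ?_) m
    · rw [map_one, hδ.map_one, eul_one, map_zero]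
    · rw [pull_crd, h1, eul_crd, pull_crd]
    · rw [map_mul, hδ.leibniz, ha, hb, isDer_eul.leibniz, map_add, map_mul, map_mul]
    · rw [map_smul, map_smul, ha, map_smul, map_smul]
  rw [mon_eq_smul, map_smul, map_smul, map_mul, hδ.leibniz, pull_hb, h2, key, map_smul, map_smul,
    isDer_eul.leibniz, eul_hb, map_add, map_mul, map_mul, map_smul, pull_hb]

/-- A homogeneous map has homogeneous pullback. -/
theorem pm_homog (hf : IsMap f) (m : ι →₀ ℕ) : Homog (monDeg d m) (pm f m) := by
  have key : ∀ l : List ι, Homog (l.map fun i => (m i : ℤ) * d i).sum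
      (l.foldr (fun i F => f i ^ m i * F) 1) := by
    intro l
    induction l with
    | nil => exact Homog.one
    | cons i l ih =>
      rw [List.foldr_cons, List.map_cons, List.sum_cons]
      refine Homog.mul ?_ ih
      induction m i with
      | zero => simpa using Homog.one
      | succ n ih => rw [pow_succ, Nat.cast_succ, add_mul, one_mul]; exact ih.mul (hf.homog i)
  have := key (m.support.sort (· ≤ ·))
  rwa [sum_sort] at this

theorem homog_pull (hf : IsMap f) {n : ℤ} {y : Completed 𝕜 c d} (hy : Homog n y) :
    Homog n (pull hf y) := by
  refine Homog.tsum fun p => ?_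
  by_cases h0 : y.1 p.1 p.2 = 0
  · rw [h0, zero_smul]; exact Homog.zero _
  · refine Homog.smul (Homog.hb_mul ?_ _) _
    rw [← hy _ _ h0]
    exact pm_homog hf _

/-- The pullback is the identity up to higher terms. -/
theorem pull_sub_self_mem (hf : IsMap f) (hf' : ∀ i, f i - crd i ∈ fil 2) {k : ℤ} {y : Completed 𝕜 c d}
    (hy : y ∈ fil k) : pull hf y - y ∈ fil (k + 1) := by
  have key : ∀ m, pull hf (mon c d 0 m (1 : 𝕜)) - mon c d 0 m 1 ∈ fil ((m.degree : ℤ) + 1) := by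
    have hadd : ∀ a b : ι →₀ ℕ, pull hf (mon c d 0 a (1 : 𝕜)) - mon c d 0 a 1 ∈ fil ((a.degree : ℤ) + 1) →
        pull hf (mon c d 0 b (1 : 𝕜)) - mon c d 0 b 1 ∈ fil ((b.degree : ℤ) + 1) →
        pull hf (mon c d 0 (a + b) (1 : 𝕜)) - mon c d 0 (a + b) 1 ∈ fil (((a + b).degree : ℤ) + 1) := by
      intro a b ha hb
      have h1 : mon c d 0 (a + b) (1 : 𝕜) = koszul (𝕜 := 𝕜) d a b • (mon c d 0 a 1 * mon c d 0 b 1) := by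
        rw [mon_mul_mon, smul_mon, zero_add, one_mul, mul_one, koszul_mul_self]
      rw [h1, map_smul, map_mul, ← smul_sub]
      refine Submodule.smul_mem _ _ ?_
      have h2 : ∀ u v u' v' : Completed 𝕜 c d, u * v - u' * v' = (u - u') * v + u' * (v - v') :=
        fun u v u' v' => by noncomm_ring
      rw [h2, map_add]
      push_cast
      have ha0 : mon c d 0 a (1 : 𝕜) ∈ fil (c := c) (d := d) (a.degree : ℤ) := by
        simpa [level, crd] using mon_mem_fil (c := c) (d := d) 0 a (1 : 𝕜)
      have hb0 : pull hf (mon c d 0 b (1 : 𝕜)) ∈ fil (c := c) (d := d) (b.degree : ℤ) :=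
        pull_mem_fil hf (by simpa [level, crd] using mon_mem_fil (c := c) (d := d) 0 b (1 : 𝕜))
      refine add_mem ?_ ?_
      · rw [add_right_comm]
        exact mul_mem_fil ha hb0
      · rw [add_assoc]
        exact mul_mem_fil ha0 hb
    intro m
    induction m using Finsupp.induction_linear with
    | zero => rw [← one_eq_mon, map_one, sub_self]; exact zero_mem _
    | add a b ha hb => exact hadd a b ha hb
    | single i n =>
      induction n with
      | zero => rw [Finsupp.single_zero, ← one_eq_mon, map_one, sub_self]; exact zero_mem _
      | succ n ih =>
        rw [Finsupp.single_add]
        refine hadd _ _ ih ?_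
        change pull hf (crd i) - crd i ∈ _
        rw [pull_crd, Finsupp.degree_single]
        exact hf' i
  obtain ⟨s, hs, hs'⟩ := y.exists_finset_approx (k + 1)
  set r := ∑ p ∈ s, mon c d p.1 p.2 (y.1 p.1 p.2) with hr
  have h1 : pull hf y - y = pull hf (y - r) - (y - r) + (pull hf r - r) := by rw [map_sub]; abel
  rw [h1]
  refine add_mem (sub_mem (pull_mem_fil hf hs') hs') ?_
  rw [hr, map_sum, ← Finset.sum_sub_distrib]
  refine Submodule.sum_mem _ fun p hp => ?_
  rw [mon_eq_smul, map_smul, map_mul, pull_hb, ← smul_sub, ← mul_sub]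
  refine Submodule.smul_mem _ _ (fil_anti ?_ (hb_mul_mem_fil (key _)))
  have := hy _ _ (hs p hp).2
  simp only [level] at this
  omega

end

/-! ### Comparison of the completions -/

/-- The inclusion of the completion by weight in the completion by `g + n`. -/
def incl : Completed 𝕜 2 d →ₐ[𝕜] Completed 𝕜 1 d :=
  AlgHom.ofLinearMap
    -- Since `n ≥ 0`, the bound `g + n ≤ k` implies `2 g + n ≤ 2 k`.
    { toFun := fun a => ⟨a.1, a.gradedSymm, fun k => (a.levelFinite (2 * k)).subset fun p hp => by
        refine ⟨?_, hp.2⟩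
        have := hp.1
        simp only [level] at this ⊢
        omega⟩
      map_add' := fun _ _ => rfl
      map_smul' := fun _ _ => rfl } rfl fun _ _ => rfl

@[simp] theorem incl_val (a : Completed 𝕜 2 d) : (incl a).1 = a.1 := rfl

theorem incl_injective : Function.Injective (incl : Completed 𝕜 2 d → Completed 𝕜 1 d) :=
  fun _ _ h => val_injective (congrArg (fun x : Completed 𝕜 1 d => x.val) h)

/-- From `2 g + n ≥ 1` and `n ≥ 0` follows `2 (g + n) ≥ 1`, hence `g + n ≥ 1` for integers. -/
theorem incl_mem_fil {a : Completed 𝕜 2 d} (ha : a ∈ fil 1) : incl a ∈ fil 1 := by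
  intro g m h
  have := ha g m h
  simp only [level] at this ⊢
  omega

theorem incl_expC {a : Completed 𝕜 2 d} (ha : a ∈ fil 1) : incl (expC a) = expC (incl a) :=
  val_injective (by rw [incl_val, expC_val ha, expC_val (incl_mem_fil ha), incl_val])

theorem IsMap.incl {f : ι → Completed 𝕜 2 d} (hf : IsMap f) :
    IsMap fun i => Completed.incl (f i) := ⟨hf.homog, fun i => incl_mem_fil (hf.mem i)⟩

theorem incl_pull [CharZero 𝕜] {f : ι → Completed 𝕜 2 d} (hf : IsMap f) (y : Completed 𝕜 2 d) :
    incl (pull hf y) = pull hf.incl (incl y) :=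
  val_injective (by rw [incl_val, pull_val, pull_val]; rfl)

end Completed

end Pullback

/-! ### The BV Laplacian and bracket, organised by odd indices -/

section BV

variable {ι 𝕜 : Type*} [LinearOrder ι] [Field 𝕜]

/-- The algebraic properties of the inverse matrix of an odd symplectic form of degree `-1`. -/
structure IsOddPoisson (d : ι → ℤ) (P : ι → ι → 𝕜) : Prop where
  antisymm : ∀ i j, P i j = -P j i
  degree : ∀ i j, P i j ≠ 0 → d i + d j = -1
  finite : ∀ i, {j | P i j ≠ 0}.Finite

/-- The indices of the odd coordinates. -/
abbrev OddIdx (d : ι → ℤ) : Type _ := {i : ι // Odd (d i)}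

/-- Degrees of paired coordinates add up to `-1`, so `P` pairs odd with even coordinates. Every sum
over pairs can therefore be organised by its odd index `i`, and for such `i` the operator `pu hP i`
is an ordinary even derivation. -/
theorem IsOddPoisson.even {d : ι → ℤ} {P : ι → ι → 𝕜} (hP : IsOddPoisson d P) {i j : ι} (hi : Odd (d i))
    (h : P i j ≠ 0) : Even (d j) := by
  have := hP.degree i j h
  rw [show d j = -1 - d i by omega]
  exact (show Odd (-1 : ℤ) by decide).sub_odd hi

namespace Completed

variable {c : ℤ} {d : ι → ℤ} {P : ι → ι → 𝕜}

/-! ### The Hamiltonian derivatives -/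

/-- The derivative `∑_j P i j ∂ / ∂φ^j`. -/
def pu (hP : IsOddPoisson d P) (i : ι) : Completed 𝕜 c d →ₗ[𝕜] Completed 𝕜 c d :=
  ∑ j ∈ (hP.finite i).toFinset, P i j • pd j

variable (hP : IsOddPoisson d P)

theorem pu_apply (i : ι) (a : Completed 𝕜 c d) :
    pu hP i a = ∑ j ∈ (hP.finite i).toFinset, P i j • pd j a := by
  simp [pu, LinearMap.sum_apply]

theorem mem_row {i j : ι} : j ∈ (hP.finite i).toFinset ↔ P i j ≠ 0 := by simp

theorem pu_mem_fil {i : ι} {a : Completed 𝕜 c d} {k : ℤ} (ha : a ∈ fil k) : pu hP i a ∈ fil (k - 1) := by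
  rw [pu_apply]
  exact Submodule.sum_mem _ fun j _ => Submodule.smul_mem _ _ (pd_mem_fil ha)

theorem isBounded_pu (i : ι) : IsBounded (pu hP i : Completed 𝕜 c d →ₗ[𝕜] Completed 𝕜 c d) :=
  IsBounded.of_shift 1 fun _ _ h => pu_mem_fil hP h

theorem Homog.map_pu {n : ℤ} {a : Completed 𝕜 c d} (h : Homog n a) (i : ι) :
    Homog (n + 1 + d i) (pu hP i a) := by
  rw [pu_apply]
  refine Homog.sum fun j hj => Homog.smul ?_ _
  have := hP.degree i j ((mem_row hP).1 hj)
  rw [show n + 1 + d i = n - d j by omega]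
  exact h.map_pd j

theorem finite_pu_notMem (a : Completed 𝕜 c d) (k : ℤ) : {i | pu hP i a ∉ fil k}.Finite := by
  refine ((finite_pd_notMem a k).biUnion fun j _ => hP.finite j).subset fun i hi => ?_
  by_contra hc
  simp only [Set.mem_iUnion, not_exists] at hc
  refine hi ?_
  rw [pu_apply]
  refine Submodule.sum_mem _ fun j hj => Submodule.smul_mem _ _ ?_
  by_contra hj'
  refine hc j hj' ?_
  have := (mem_row hP).1 hj
  rw [hP.antisymm] at this
  exact neg_ne_zero.1 this

theorem pu_mul {i : ι} (hi : Odd (d i)) (a b : Completed 𝕜 c d) :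
    pu hP i (a * b) = pu hP i a * b + a * pu hP i b := by
  simp only [pu_apply, Finset.sum_mul, Finset.mul_sum, ← Finset.sum_add_distrib]
  refine Finset.sum_congr rfl fun j hj => ?_
  rw [pd_mul, rho_of_even (hP.even hi ((mem_row hP).1 hj)), smul_add, smul_mul_assoc, mul_smul_comm]

theorem isDer_pu {i : ι} (hi : Odd (d i)) : IsDer (pu hP i : Completed 𝕜 c d →ₗ[𝕜] Completed 𝕜 c d) :=
  ⟨isBounded_pu hP i, pu_mul hP hi⟩

theorem pd_mul_odd {i : ι} (hi : Odd (d i)) (a b : Completed 𝕜 c d) :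
    pd i (a * b) = pd i a * b + rho 1 a * pd i b := by
  rw [pd_mul, rho_of_odd hi]

theorem pu_rho {i : ι} (hi : Odd (d i)) (n : ℤ) (a : Completed 𝕜 c d) :
    pu hP i (rho n a) = rho n (pu hP i a) := by
  simp only [pu_apply, map_sum]
  refine Finset.sum_congr rfl fun j hj => ?_
  rw [pd_rho, ((hP.even hi ((mem_row hP).1 hj)).mul_left n).neg_one_zpow, one_smul, map_smul]

theorem pd_rho_odd {i : ι} (hi : Odd (d i)) (a : Completed 𝕜 c d) :
    pd i (rho 1 a) = -rho 1 (pd i a) := by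
  rw [pd_rho, one_mul, hi.neg_one_zpow, neg_smul, one_smul]

theorem pd_pd_odd {i j : ι} (hi : Odd (d i)) (hj : Odd (d j)) (a : Completed 𝕜 c d) :
    pd i (pd j a) = -pd j (pd i a) := by
  rw [pd_pd, (hi.mul hj).neg_one_zpow, neg_smul, one_smul]

theorem pd_pu {i j : ι} (hj : Odd (d j)) (a : Completed 𝕜 c d) :
    pd i (pu hP j a) = pu hP j (pd i a) := by
  simp only [pu_apply, map_sum, map_smul]
  refine Finset.sum_congr rfl fun k hk => ?_
  rw [pd_pd, ((hP.even hj ((mem_row hP).1 hk)).mul_left _).neg_one_zpow, one_smul]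

theorem pu_pu {i j : ι} (hj : Odd (d j)) (a : Completed 𝕜 c d) :
    pu hP i (pu hP j a) = pu hP j (pu hP i a) := by
  rw [pu_apply, pu_apply hP i, map_sum]
  refine Finset.sum_congr rfl fun k _ => ?_
  rw [pd_pu hP hj, map_smul]

theorem pu_hb_mul (i : ι) (k : ℤ) (a : Completed 𝕜 c d) :
    pu hP i (hb k * a) = hb k * pu hP i a := by
  simp only [pu_apply, pd_hb_mul, Finset.mul_sum, mul_smul_comm]

theorem pu_eul (i : ι) (a : Completed 𝕜 c d) : pu hP i (eul a) = eul (pu hP i a) + pu hP i a := by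
  simp only [pu_apply, pd_eul, map_sum, map_smul, ← Finset.sum_add_distrib, smul_add]

/-! ### The Laplacian and the bracket -/

theorem summable_lap (a : Completed 𝕜 c d) : Summable fun i : OddIdx d => pd i.1 (pu hP i.1 a) := by
  refine summable_of_finite fun k => ?_
  refine ((finite_pu_notMem hP a (k + 1)).preimage Subtype.val_injective.injOn).subset fun i hi hc => hi ?_
  simpa using pd_mem_fil (i := i.1) hc

theorem summable_br₁ (a b : Completed 𝕜 c d) :
    Summable fun i : OddIdx d => rho 1 (pd i.1 a) * pu hP i.1 b := by
  obtain ⟨l, hl⟩ := b.exists_mem_fil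
  refine summable_of_finite fun k => ?_
  refine ((finite_pd_notMem a (k - (l - 1))).preimage Subtype.val_injective.injOn).subset fun i hi hc => hi ?_
  simpa using mul_mem_fil (rho_mem_fil hc) (pu_mem_fil hP (i := i.1) hl)

theorem summable_br₂ (a b : Completed 𝕜 c d) :
    Summable fun i : OddIdx d => pu hP i.1 a * pd i.1 b := by
  obtain ⟨l, hl⟩ := b.exists_mem_fil
  refine summable_of_finite fun k => ?_
  refine ((finite_pu_notMem hP a (k - (l - 1))).preimage Subtype.val_injective.injOn).subset fun i hi hc => hi ?_
  simpa using mul_mem_fil hc (pd_mem_fil (i := i.1) hl)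

theorem summable_br (a b : Completed 𝕜 c d) :
    Summable fun i : OddIdx d => rho 1 (pd i.1 a) * pu hP i.1 b - pu hP i.1 a * pd i.1 b :=
  (summable_br₁ hP a b).sub (summable_br₂ hP a b)

theorem tsum_smul' {α : Type*} (x : 𝕜) {f : α → Completed 𝕜 c d} (hf : Summable f) :
    ∑' i, x • f i = x • ∑' i, f i := by
  have h : IsBounded fun a : Completed 𝕜 c d => x • a := fun k => ⟨k, fun _ h => Submodule.smul_mem _ x h⟩
  exact (IsBounded.map_tsum (L := (LinearMap.lsmul 𝕜 _ x : Completed 𝕜 c d →ₗ[𝕜] _).toAddMonoidHom) h hf).symm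

/-- The BV Laplacian. -/
def lap : Completed 𝕜 c d →ₗ[𝕜] Completed 𝕜 c d where
  -- Each unordered pair of indices is recorded once, by its odd member, which absorbs the factor
  -- `1/2`; `laplacian_val` compares this with the original formula.
  toFun a := -∑' i : OddIdx d, pd i.1 (pu hP i.1 a)
  map_add' a b := by
    simp only [map_add]
    rw [(summable_lap hP a).tsum_add (summable_lap hP b)]
    abel
  map_smul' x a := by
    simp only [map_smul]
    rw [tsum_smul' x (summable_lap hP a), smul_neg]
    rfl

theorem lap_apply (a : Completed 𝕜 c d) : lap hP a = -∑' i : OddIdx d, pd i.1 (pu hP i.1 a) := rfl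

/-- The BV bracket. -/
def br (a : Completed 𝕜 c d) : Completed 𝕜 c d →ₗ[𝕜] Completed 𝕜 c d where
  -- The two terms are the orders (odd, even) and (even, odd) of a pair; the minus sign is the
  -- antisymmetry of `P`, and `rho 1` turns the left derivative by an odd coordinate into the right
  -- one.
  toFun b := ∑' i : OddIdx d, (rho 1 (pd i.1 a) * pu hP i.1 b - pu hP i.1 a * pd i.1 b)
  map_add' b b' := by
    rw [← (summable_br hP a b).tsum_add (summable_br hP a b')]
    refine tsum_congr fun i => ?_
    rw [map_add, map_add, mul_add, mul_add]
    abel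
  map_smul' x b := by
    rw [RingHom.id_apply, ← tsum_smul' x (summable_br hP a b)]
    refine tsum_congr fun i => ?_
    rw [map_smul, map_smul, mul_smul_comm, mul_smul_comm, smul_sub]

theorem br_apply (a b : Completed 𝕜 c d) :
    br hP a b = ∑' i : OddIdx d, (rho 1 (pd i.1 a) * pu hP i.1 b - pu hP i.1 a * pd i.1 b) := rfl

theorem br_add_left (a a' b : Completed 𝕜 c d) : br hP (a + a') b = br hP a b + br hP a' b := by
  rw [br_apply, br_apply, br_apply, ← (summable_br hP a b).tsum_add (summable_br hP a' b)]
  refine tsum_congr fun i => ?_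
  rw [map_add, map_add, map_add, add_mul, add_mul]
  abel

theorem br_smul_left (x : 𝕜) (a b : Completed 𝕜 c d) : br hP (x • a) b = x • br hP a b := by
  rw [br_apply, br_apply, ← tsum_smul' x (summable_br hP a b)]
  refine tsum_congr fun i => ?_
  rw [map_smul, map_smul, map_smul, smul_mul_assoc, smul_mul_assoc, smul_sub]

theorem br_neg_left (a b : Completed 𝕜 c d) : br hP (-a) b = -br hP a b := by
  rw [← neg_one_smul 𝕜 a, br_smul_left, neg_one_smul]

theorem br_sub_left (a a' b : Completed 𝕜 c d) : br hP (a - a') b = br hP a b - br hP a' b := by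
  rw [sub_eq_add_neg, br_add_left, br_neg_left, sub_eq_add_neg]

theorem lap_mem_fil {a : Completed 𝕜 c d} {k : ℤ} (ha : a ∈ fil k) : lap hP a ∈ fil (k - 2) := by
  refine neg_mem (tsum_mem_fil fun i => ?_)
  rw [show k - 2 = k - 1 - 1 by ring]
  exact pd_mem_fil (pu_mem_fil hP ha)

theorem isBounded_lap : IsBounded (lap hP : Completed 𝕜 c d →ₗ[𝕜] Completed 𝕜 c d) :=
  IsBounded.of_shift 2 fun _ _ h => lap_mem_fil hP h

theorem br_mem_fil {a b : Completed 𝕜 c d} {k l : ℤ} (ha : a ∈ fil k) (hb : b ∈ fil l) :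
    br hP a b ∈ fil (k + l - 2) := by
  refine tsum_mem_fil fun i => ?_
  rw [show k + l - 2 = (k - 1) + (l - 1) by ring]
  exact sub_mem (mul_mem_fil (rho_mem_fil (pd_mem_fil ha)) (pu_mem_fil hP hb))
    (mul_mem_fil (pu_mem_fil hP ha) (pd_mem_fil hb))

theorem isBounded_br (a : Completed 𝕜 c d) : IsBounded (br hP a) := by
  obtain ⟨k, hk⟩ := a.exists_mem_fil
  exact IsBounded.of_shift (2 - k) fun l b hb => by
    rw [show l - (2 - k) = k + l - 2 by ring]
    exact br_mem_fil hP hk hb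

theorem Homog.map_lap {n : ℤ} {a : Completed 𝕜 c d} (h : Homog n a) : Homog (n + 1) (lap hP a) := by
  refine Homog.neg (Homog.tsum fun i => ?_)
  have := (h.map_pu hP i.1).map_pd i.1
  rwa [add_sub_cancel_right] at this

theorem Homog.map_br {n k : ℤ} {a b : Completed 𝕜 c d} (ha : Homog n a) (hb : Homog k b) :
    Homog (n + k + 1) (br hP a b) := by
  refine Homog.tsum fun i => Homog.sub ?_ ?_
  · have := (ha.map_pd i.1).map_rho (k := 1) |>.mul (hb.map_pu hP i.1)
    rwa [show n - d i.1 + (k + 1 + d i.1) = n + k + 1 by ring] at this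
  · have := (ha.map_pu hP i.1).mul (hb.map_pd i.1)
    rwa [show n + 1 + d i.1 + (k - d i.1) = n + k + 1 by ring] at this

theorem eul_tsum {α : Type*} {f : α → Completed 𝕜 c d} (hf : Summable f) :
    eul (∑' i, f i) = ∑' i, eul (f i) :=
  IsBounded.map_tsum (L := (eul : Completed 𝕜 c d →ₗ[𝕜] _).toAddMonoidHom) (isBounded_diag _) hf

theorem lap_eul (a : Completed 𝕜 c d) : lap hP (eul a) = eul (lap hP a) + (2 : 𝕜) • lap hP a := by
  rw [lap_apply, lap_apply, map_neg, eul_tsum (summable_lap hP a), smul_neg, ← neg_add,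
    ← tsum_smul' _ (summable_lap hP a), ← Summable.tsum_add]
  · congr 2
    funext i
    rw [pu_eul, map_add, pd_eul, two_smul]
    abel
  · exact IsBounded.summable (L := (eul : Completed 𝕜 c d →ₗ[𝕜] _).toAddMonoidHom) (isBounded_diag _)
      (summable_lap hP a)
  · simpa only [map_smul] using summable_lap hP ((2 : 𝕜) • a)

theorem rho_eul (n : ℤ) (a : Completed 𝕜 c d) : rho n (eul a) = eul (rho n a) := by
  ext g m
  simp only [rho_val, eul_val]
  ring

theorem eul_br (a b : Completed 𝕜 c d) :
    br hP (eul a) b + br hP a (eul b) = eul (br hP a b) + (2 : 𝕜) • br hP a b := by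
  rw [br_apply, br_apply, br_apply, eul_tsum (summable_br hP a b), ← tsum_smul' _ (summable_br hP a b),
    ← (summable_br hP _ _).tsum_add (summable_br hP _ _), ← Summable.tsum_add]
  · refine tsum_congr fun i => ?_
    simp only [pd_eul, pu_eul, map_add, map_sub, rho_eul, isDer_eul.leibniz, add_mul, mul_add, two_smul]
    abel
  · exact IsBounded.summable (L := (eul : Completed 𝕜 c d →ₗ[𝕜] _).toAddMonoidHom) (isBounded_diag _)
      (summable_br hP a b)
  · have := summable_br hP a ((2 : 𝕜) • b)
    simpa only [map_smul, mul_smul_comm, ← smul_sub] using this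

theorem tsum_mul_left' {α : Type*} (a : Completed 𝕜 c d) {f : α → Completed 𝕜 c d} (hf : Summable f) :
    a * ∑' i, f i = ∑' i, a * f i := hf.tsum_mul_left a |>.symm

theorem tsum_mul_right' {α : Type*} (a : Completed 𝕜 c d) {f : α → Completed 𝕜 c d} (hf : Summable f) :
    (∑' i, f i) * a = ∑' i, f i * a := hf.tsum_mul_right a |>.symm

theorem br_hb_left (k : ℤ) (a b : Completed 𝕜 c d) : br hP (hb k * a) b = hb k * br hP a b := by
  rw [br_apply, br_apply, tsum_mul_left' _ (summable_br hP a b)]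
  refine tsum_congr fun i => ?_
  rw [pd_hb_mul, pu_hb_mul hP, map_mul, rho_hb, mul_assoc, mul_assoc, mul_sub]

theorem br_hb_right (k : ℤ) (a b : Completed 𝕜 c d) : br hP a (hb k * b) = hb k * br hP a b := by
  rw [br_apply, br_apply, tsum_mul_left' _ (summable_br hP a b)]
  refine tsum_congr fun i => ?_
  rw [pd_hb_mul, pu_hb_mul hP, ← mul_assoc, ← mul_assoc, ← hb_comm, ← hb_comm, mul_assoc, mul_assoc,
    mul_sub]

theorem lap_hb (k : ℤ) (a : Completed 𝕜 c d) : lap hP (hb k * a) = hb k * lap hP a := by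
  rw [lap_apply, lap_apply, mul_neg, tsum_mul_left' _ (summable_lap hP a)]
  simp only [pd_hb_mul, pu_hb_mul hP]

/-- The Laplacian is a second order operator, whose symbol is the bracket. -/
theorem lap_mul (a b : Completed 𝕜 c d) :
    lap hP (a * b) = lap hP a * b + rho 1 a * lap hP b + br hP (rho 1 a) b := by
  have h1 := (summable_lap hP a).mul_right b
  have h2 := (summable_lap hP b).mul_left (rho 1 a)
  rw [lap_apply, lap_apply, lap_apply, br_apply, neg_mul, mul_neg, tsum_mul_right' _ (summable_lap hP a),
    tsum_mul_left' _ (summable_lap hP b), ← tsum_neg, ← tsum_neg, ← tsum_neg, ← h1.neg.tsum_add h2.neg,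
    ← (h1.neg.add h2.neg).tsum_add (summable_br hP _ _)]
  refine tsum_congr fun i => ?_
  rw [pu_mul hP i.2, map_add, pd_mul_odd i.2, pd_mul_odd i.2, pd_rho_odd i.2, pu_rho hP i.2, map_neg,
    rho_rho, neg_mul]
  abel

/-- The bracket with a homogeneous function is a graded derivation. -/
theorem br_mul {n : ℤ} {a : Completed 𝕜 c d} (ha : Homog n a) (x y : Completed 𝕜 c d) :
    br hP a (x * y) = br hP a x * y + rho (n + 1) x * br hP a y := by
  have h1 := (summable_br hP a x).mul_right y
  have h2 := (summable_br hP a y).mul_left (rho (n + 1) x)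
  rw [br_apply, br_apply, br_apply, tsum_mul_right' _ (summable_br hP a x),
    tsum_mul_left' _ (summable_br hP a y), ← h1.tsum_add h2]
  refine tsum_congr fun i => ?_
  have e1 : rho 1 (pd i.1 a) * x = rho (n + 1) x * rho 1 (pd i.1 a) := by
    rw [((ha.map_pd i.1).map_rho (k := 1)).mul_comm]
    congr 1
    rw [show n + 1 = (n - d i.1) + (1 + d i.1) by ring, rho_add,
      rho_of_even ((show Odd (1 : ℤ) by decide).add_odd i.2)]
  have e2 : pu hP i.1 a * rho 1 x = rho (n + 1) x * pu hP i.1 a := by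
    rw [(ha.map_pu hP i.1).mul_comm, ← rho_add]
    congr 1
    rw [show n + 1 + d i.1 + 1 = (n + 1) + (1 + d i.1) by ring, rho_add _ (1 + d i.1),
      rho_of_even ((show Odd (1 : ℤ) by decide).add_odd i.2)]
  rw [pu_mul hP i.2, pd_mul_odd i.2, mul_add, mul_add, ← mul_assoc, ← mul_assoc, ← mul_assoc, ← mul_assoc,
    e1, e2, sub_mul, mul_sub]
  simp only [mul_assoc]
  abel

/-- The bracket has degree `1`, so bracketing with a function of degree `-1` has degree `0` and
involves no signs: it is the Hamiltonian vector field. -/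
theorem isDer_br {a : Completed 𝕜 c d} (ha : Homog (-1) a) : IsDer (br hP a) :=
  ⟨isBounded_br hP a, fun x y => by
    rw [br_mul hP ha, neg_add_cancel, rho_of_even (by decide)]⟩

theorem rho_tsum {α : Type*} (n : ℤ) {f : α → Completed 𝕜 c d} (hf : Summable f) :
    rho n (∑' i, f i) = ∑' i, rho n (f i) :=
  IsBounded.map_tsum (L := (rho n : Completed 𝕜 c d →ₐ[𝕜] _).toLinearMap.toAddMonoidHom)
    (isBounded_diag _) hf

theorem rho_br {a : Completed 𝕜 c d} (ha : Homog (-1) a) (x : Completed 𝕜 c d) :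
    rho 1 (br hP a x) = br hP a (rho 1 x) := by
  rw [br_apply, br_apply, rho_tsum _ (summable_br hP a x)]
  refine tsum_congr fun i => ?_
  have e1 : rho 1 (pu hP i.1 a) = -pu hP i.1 a := by
    rw [(ha.map_pu hP i.1).rho_eq, one_mul, neg_add_cancel, zero_add, i.2.neg_one_zpow, neg_smul, one_smul]
  have e2 : rho 1 (pd i.1 a) = pd i.1 a := by
    rw [(ha.map_pd i.1).rho_eq, one_mul, ((show Odd (-1 : ℤ) by decide).sub_odd i.2).neg_one_zpow, one_smul]
  rw [map_sub, map_mul, map_mul, pu_rho hP i.2, pd_rho_odd i.2, e1, e2, e2, neg_mul, mul_neg]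

theorem br_comm {a b : Completed 𝕜 c d} (ha : Homog 0 a) (hb : Homog (-1) b) :
    br hP a b = -br hP b a := by
  rw [br_apply, br_apply, ← tsum_neg]
  refine tsum_congr fun i => ?_
  have e1 : rho 1 (pd i.1 a) = -pd i.1 a := by
    rw [(ha.map_pd i.1).rho_eq, one_mul, zero_sub, i.2.neg.neg_one_zpow, neg_smul, one_smul]
  have hq : Even (-1 - d i.1) := (show Odd (-1 : ℤ) by decide).sub_odd i.2
  have e2 : rho 1 (pd i.1 b) = pd i.1 b := by
    rw [(hb.map_pd i.1).rho_eq, one_mul, hq.neg_one_zpow, one_smul]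
  have e3 : pd i.1 b * pu hP i.1 a = pu hP i.1 a * pd i.1 b := by
    rw [(hb.map_pd i.1).mul_comm, rho_of_even hq]
  have e4 : pu hP i.1 b * pd i.1 a = -(pd i.1 a * pu hP i.1 b) := by
    rw [(hb.map_pu hP i.1).mul_comm, neg_add_cancel, zero_add, rho_of_odd i.2, e1, neg_mul]
  rw [e1, e2, e3, e4, neg_mul]
  abel

end Completed

end BV

/-! ### Comparison with the coefficient formulas; the twisted operator, the master equation and the
Jacobi identity -/

section BV

variable {ι 𝕜 : Type*} [LinearOrder ι] [Field 𝕜]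

/-- The signs of the left and the right derivative together account for all of `φ^m` except the
power of `φ^i`. Its contribution is even, since either `d i` is even or `m i = 0`. -/
theorem dR_eq (d : ι → ℤ) (i : ι) (F : Fun ι 𝕜) (hF : IsGradedSymm d F) (g : ℤ) (m : ι →₀ ℕ) :
    dR d i F g m = (-1) ^ (d i * monDeg d m) * dL d i F g m := by
  by_cases h0 : F g (m + Finsupp.single i 1) = 0
  · simp [dR, dL, h0]
  have key : d i * monDeg d m = d i * (m.sum fun j k => if j < i then (k : ℤ) * d j else 0) +
      d i * (m.sum fun j k => if i < j then (k : ℤ) * d j else 0) + d i * (m i * d i) := by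
    rw [← mul_add, ← mul_add]
    congr 1
    have : (m i : ℤ) * d i = m.sum fun j k => if j = i then (k : ℤ) * d j else 0 := by
      rw [Finsupp.sum, Finset.sum_ite_eq' m.support i fun j => (m j : ℤ) * d j]
      split_ifs with h
      · rfl
      · simp [Finsupp.notMem_support_iff.1 h]
    rw [this, monDeg, Finsupp.sum, Finsupp.sum, Finsupp.sum, Finsupp.sum, ← Finset.sum_add_distrib,
      ← Finset.sum_add_distrib]
    refine Finset.sum_congr rfl fun j _ => ?_
    rcases lt_trichotomy j i with h | h | h
    · simp [h, h.ne, h.not_gt]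
    · simp [h]
    · simp [h, h.ne', h.not_gt]
  have hev : Even (d i * (m i * d i)) := by
    rcases Int.even_or_odd (d i) with h | h
    · exact h.mul_right _
    · have := hF _ _ h0 i h
      have hm : m i = 0 := by simpa using this
      simp [hm]
  have hne : (-1 : 𝕜) ≠ 0 := neg_ne_zero.2 one_ne_zero
  rw [dR, dL, key, zpow_add₀ hne, zpow_add₀ hne, hev.neg_one_zpow]
  have := neg_one_zpow_mul_self (𝕜 := 𝕜) (d i * m.sum fun j k => if j < i then (k : ℤ) * d j else 0)
  linear_combination (-((-1) ^ (d i * m.sum fun j k => if i < j then (k : ℤ) * d j else 0) *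
    ((m i : 𝕜) + 1) * F g (m + Finsupp.single i 1))) * this

namespace Completed

variable {c : ℤ} {d : ι → ℤ} {P : ι → ι → 𝕜}

theorem dR_val (i : ι) (a : Completed 𝕜 c d) : dR d i a.1 = (rho (d i) (pd i a)).1 := by
  funext g m
  rw [dR_eq d i a.1 a.2, rho_val, pd_val]

variable (hP : IsOddPoisson d P)

include hP in
-- A pair with `P i j ≠ 0` has exactly one odd member. Exchanging the two indices carries the terms
-- whose first index is even to those whose first index is odd.
theorem tsum_pairs {t : ι × ι → Completed 𝕜 c d} (ht : Summable t) (h0 : ∀ i j, P i j = 0 → t (i, j) = 0) :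
    ∑' p, t p = ∑' i : OddIdx d, ∑ j ∈ (hP.finite i.1).toFinset, (t (i.1, j) + t (j, i.1)) := by
  classical
  have aux : ∀ u : ι × ι → Completed 𝕜 c d, Summable u → (∀ i j, P i j = 0 → u (i, j) = 0) →
      (∀ i j, ¬ Odd (d i) → u (i, j) = 0) →
      HasSum (fun i : OddIdx d => ∑ j ∈ (hP.finite i.1).toFinset, u (i.1, j)) (∑' p, u p) := by
    intro u hu h0 h1
    have h2 := hu.hasSum.prod_fiberwise (g := fun i => ∑ j ∈ (hP.finite i).toFinset, u (i, j)) fun i =>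
      hasSum_sum_of_ne_finset_zero fun j hj => h0 i j (by simpa using hj)
    refine (hasSum_subtype_iff_of_support_subset (s := {i | Odd (d i)}) ?_).2 h2
    intro i hi
    by_contra hc
    exact hi (Finset.sum_eq_zero fun j _ => h1 i j hc)
  set t₁ : ι × ι → Completed 𝕜 c d := fun p => if Odd (d p.1) then t p else 0 with ht₁
  set t₂ : ι × ι → Completed 𝕜 c d := fun p => if Odd (d p.1) then 0 else t p with ht₂
  have hs₁ : Summable t₁ := summable_iff.2 fun k => (summable_iff.1 ht k).subset fun p hp => by
    simp only [ht₁, Set.mem_ofPred_eq] at hp ⊢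
    split_ifs at hp with h
    · exact hp
    · exact absurd (Submodule.zero_mem _) hp
  have hs₂ : Summable t₂ := summable_iff.2 fun k => (summable_iff.1 ht k).subset fun p hp => by
    simp only [ht₂, Set.mem_ofPred_eq] at hp ⊢
    split_ifs at hp with h
    · exact absurd (Submodule.zero_mem _) hp
    · exact hp
  have hs₂' : Summable (t₂ ∘ Prod.swap) := (Equiv.prodComm ι ι).summable_iff.2 hs₂
  have e₂ : ∑' p, (t₂ ∘ Prod.swap) p = ∑' p, t₂ p := (Equiv.prodComm ι ι).tsum_eq t₂
  have a₁ := aux t₁ hs₁ (fun i j h => by simp [ht₁, h0 i j h]) fun i j h => by simp [ht₁, h]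
  have a₂ := aux (t₂ ∘ Prod.swap) hs₂'
    (fun i j h => by simp [ht₂, h0 j i (by rw [hP.antisymm, h, neg_zero])]) fun i j h => by
      simp only [ht₂, Function.comp, Prod.swap]
      split_ifs with h'
      · rfl
      · refine h0 j i ?_
        by_contra hc
        have := hP.degree j i hc
        rcases Int.even_or_odd (d j) with h3 | h3
        · refine h ?_
          rw [show d i = -1 - d j by omega]
          exact (show Odd (-1 : ℤ) by decide).sub_even h3
        · exact h' h3
  have e : t = fun p => t₁ p + t₂ p := by
    funext p
    simp only [ht₁, ht₂]
    split_ifs <;> simp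
  rw [show ∑' p, t p = ∑' p, (t₁ p + t₂ p) by rw [← e], hs₁.tsum_add hs₂, ← e₂,
    ← (a₁.add a₂).tsum_eq]
  refine tsum_congr fun i => ?_
  rw [← Finset.sum_add_distrib]
  refine Finset.sum_congr rfl fun j hj => ?_
  have : ¬ Odd (d j) := Int.not_odd_iff_even.2 (hP.even i.2 ((mem_row hP).1 hj))
  simp only [ht₁, ht₂, i.2, this, Function.comp, Prod.swap, if_true, if_false]

include hP in
-- Each index has only finitely many partners under `P`, so smallness for almost all second indices,
-- uniformly in the first, is enough.
theorem summable_pairs {t : ι × ι → Completed 𝕜 c d} (h0 : ∀ i j, P i j = 0 → t (i, j) = 0)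
    (h : ∀ k, {j | ∃ i, t (i, j) ∉ fil k}.Finite) : Summable t := by
  refine summable_of_finite fun k => ?_
  refine ((h k).biUnion fun j _ => ((hP.finite j).prod (Set.finite_singleton j))).subset ?_
  rintro ⟨i, j⟩ hij
  simp only [Set.mem_iUnion]
  refine ⟨j, ⟨i, hij⟩, ?_, rfl⟩
  intro hc
  refine hij ?_
  rw [h0 i j (by rw [hP.antisymm, hc, neg_zero])]
  exact Submodule.zero_mem _

/-- The two orders of a pair contribute equally, which cancels the factor `1/2`. -/
theorem laplacian_val [CharZero 𝕜] (a : Completed 𝕜 c d) : laplacian d P a.1 = (lap hP a).1 := by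
  set t : ι × ι → Completed 𝕜 c d := fun p => ((-1) ^ d p.1 * P p.1 p.2) • pd p.1 (pd p.2 a) with ht
  have h0 : ∀ i j, P i j = 0 → t (i, j) = 0 := fun i j h => by simp [ht, h]
  have hs : Summable t := summable_pairs hP h0 fun k => (finite_pd_notMem a (k + 1)).subset
    fun j ⟨i, hi⟩ hc => hi (Submodule.smul_mem _ _ (by simpa using pd_mem_fil (i := i) hc))
  have e : lap hP a = (2⁻¹ : 𝕜) • ∑' p, t p := by
    have hs' := summable_lap hP a
    rw [tsum_pairs hP hs h0, lap_apply, ← tsum_neg, show (fun i : OddIdx d => ∑ j ∈ (hP.finite i.1).toFinset,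
      (t (i.1, j) + t (j, i.1))) = fun i : OddIdx d => (2 : 𝕜) • -pd i.1 (pu hP i.1 a) from ?_,
      tsum_smul' _ hs'.neg, smul_smul, inv_mul_cancel₀ two_ne_zero, one_smul]
    funext i
    rw [pu_apply, map_sum, ← Finset.sum_neg_distrib, Finset.smul_sum]
    refine Finset.sum_congr rfl fun j hj => ?_
    have hj' := hP.even i.2 ((mem_row hP).1 hj)
    simp only [ht]
    rw [pd_pd j i, (hj'.mul_right _).neg_one_zpow, i.2.neg_one_zpow, hj'.neg_one_zpow, hP.antisymm j i,
      map_smul, one_smul, two_smul]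
    simp only [neg_mul, one_mul, neg_smul]
  funext g m
  rw [e]
  show _ = 2⁻¹ * (∑' p, t p).1 g m
  rw [val_tsum hs]
  rfl

theorem bracket_val (a b : Completed 𝕜 c d) : bracket d P a.1 b.1 = (br hP a b).1 := by
  set t : ι × ι → Completed 𝕜 c d := fun p => P p.1 p.2 • (rho (d p.1) (pd p.1 a) * pd p.2 b) with ht
  have h0 : ∀ i j, P i j = 0 → t (i, j) = 0 := fun i j h => by simp [ht, h]
  obtain ⟨l, hl⟩ := a.exists_mem_fil
  have hs : Summable t := summable_pairs hP h0 fun k => (finite_pd_notMem b (k - (l - 1))).subset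
    fun j ⟨i, hi⟩ hc => hi (Submodule.smul_mem _ _ (by
      simpa using mul_mem_fil (rho_mem_fil (n := d i) (pd_mem_fil (i := i) hl)) hc))
  have e : br hP a b = ∑' p, t p := by
    rw [tsum_pairs hP hs h0, br_apply]
    refine tsum_congr fun i => ?_
    rw [pu_apply, pu_apply, Finset.mul_sum, Finset.sum_mul, ← Finset.sum_sub_distrib]
    refine Finset.sum_congr rfl fun j hj => ?_
    simp only [ht]
    rw [rho_of_odd i.2, rho_of_even (hP.even i.2 ((mem_row hP).1 hj)), hP.antisymm j i, mul_smul_comm,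
      smul_mul_assoc, neg_smul, sub_eq_add_neg]
  funext g m
  rw [e, val_tsum hs]
  refine finsum_congr fun p => ?_
  rw [dR_val]
  rfl

/-! ### The operator `{S, -} + ħ Δ` -/

/-- The operator `{S, -} + ħ Δ`. -/
def tw (S : Completed 𝕜 c d) : Completed 𝕜 c d →ₗ[𝕜] Completed 𝕜 c d where
  toFun z := br hP S z + hb 1 * lap hP z
  map_add' a b := by rw [map_add, map_add, mul_add]; abel
  map_smul' x a := by rw [map_smul, map_smul, mul_smul_comm, smul_add]; rfl

theorem tw_apply (S z : Completed 𝕜 c d) : tw hP S z = br hP S z + hb 1 * lap hP z := rfl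

theorem twisted_val [CharZero 𝕜] (S z : Completed 𝕜 c d) : twisted d P S.1 z.1 = (tw hP S z).1 := by
  rw [twisted, bracket_val hP, laplacian_val hP, ← hb_mul_val]
  rfl

theorem isBounded_tw (S : Completed 𝕜 c d) : IsBounded (tw hP S) :=
  (isBounded_br hP S).add ((isBounded_lap hP).mul_left (hb 1))

theorem tw_hb (S : Completed 𝕜 c d) (k : ℤ) (z : Completed 𝕜 c d) : tw hP S (hb k * z) = hb k * tw hP S z := by
  rw [tw_apply, tw_apply, br_hb_right, lap_hb, mul_add, ← mul_assoc, ← mul_assoc, hb_comm 1 (hb k)]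

theorem Homog.map_tw {S z : Completed 𝕜 c d} {n : ℤ} (hS : Homog 0 S) (hz : Homog n z) :
    Homog (n + 1) (tw hP S z) := by
  have := hS.map_br hP hz
  rw [zero_add] at this
  exact this.add ((hz.map_lap hP).hb_mul 1)

theorem br_comm_zero {a b : Completed 𝕜 c d} (ha : Homog 0 a) (hb : Homog 0 b) :
    br hP a b = br hP b a := by
  rw [br_apply, br_apply]
  refine tsum_congr fun i => ?_
  have e1 : ∀ {a : Completed 𝕜 c d}, Homog 0 a → rho 1 (pd i.1 a) = -pd i.1 a := fun ha => by
    rw [(ha.map_pd i.1).rho_eq, one_mul, zero_sub, i.2.neg.neg_one_zpow, neg_smul, one_smul]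
  have e2 : ∀ {a : Completed 𝕜 c d}, Homog 0 a → ∀ b, pu hP i.1 a * b = b * pu hP i.1 a := fun ha b => by
    rw [(ha.map_pu hP i.1).mul_comm, rho_of_even]
    rw [zero_add]
    exact (show Odd (1 : ℤ) by decide).add_odd i.2
  rw [e1 ha, e1 hb, e2 ha, e2 hb, neg_mul, neg_mul]
  abel

section Conj

variable (s : Completed 𝕜 c d)

/-- The derivative `pd i` conjugated by `exp s`. -/
def pdc (i : ι) : Completed 𝕜 c d →ₗ[𝕜] Completed 𝕜 c d := pd i + LinearMap.mulLeft 𝕜 (pd i s)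

/-- The derivative `pu i` conjugated by `exp s`. -/
def puc (i : ι) : Completed 𝕜 c d →ₗ[𝕜] Completed 𝕜 c d := pu hP i + LinearMap.mulLeft 𝕜 (pu hP i s)

theorem pdc_apply (i : ι) (z : Completed 𝕜 c d) : pdc s i z = pd i z + pd i s * z := rfl

theorem puc_apply (i : ι) (z : Completed 𝕜 c d) : puc hP s i z = pu hP i z + pu hP i s * z := rfl

/-- The loss of level is uniform in the index, as the summability of the double sum in `conj_conj`
requires. -/
theorem exists_shift : ∃ r : ℤ, ∀ (i : ι) (k : ℤ) (z : Completed 𝕜 c d), z ∈ fil k →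
    pdc s i (puc hP s i z) ∈ fil (k - r) := by
  obtain ⟨l, hl⟩ := s.exists_mem_fil
  have h : ∀ (i : ι) (k : ℤ) (z : Completed 𝕜 c d), z ∈ fil k →
      pdc s i z ∈ fil (k - (max 0 (-l) + 1)) ∧ puc hP s i z ∈ fil (k - (max 0 (-l) + 1)) := by
    intro i k z hz
    have h1 : k - (max 0 (-l) + 1) ≤ k - 1 := by have := le_max_left 0 (-l); omega
    have h2 : k - (max 0 (-l) + 1) ≤ l - 1 + k := by have := le_max_right 0 (-l); omega
    exact ⟨add_mem (fil_anti h1 (pd_mem_fil hz)) (fil_anti h2 (mul_mem_fil (pd_mem_fil hl) hz)),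
      add_mem (fil_anti h1 (pu_mem_fil hP hz)) (fil_anti h2 (mul_mem_fil (pu_mem_fil hP hl) hz))⟩
  refine ⟨(max 0 (-l) + 1) + (max 0 (-l) + 1), fun i k z hz => ?_⟩
  rw [← sub_sub]
  exact (h i _ _ (h i _ _ hz).2).1

theorem finite_conj_notMem (z : Completed 𝕜 c d) (k : ℤ) :
    {i | pdc s i (puc hP s i z) ∉ fil k}.Finite := by
  obtain ⟨l, hl⟩ := s.exists_mem_fil
  obtain ⟨l', hl'⟩ := z.exists_mem_fil
  set K := max (k + 1) (k - (l - 1)) with hK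
  refine ((finite_pu_notMem hP z K).union (finite_pu_notMem hP s (K - l'))).subset fun i hi => ?_
  by_contra hc
  simp only [Set.mem_union, Set.mem_ofPred_eq, not_or, not_not] at hc
  refine hi ?_
  have h1 : puc hP s i z ∈ fil K := add_mem hc.1 (by simpa using mul_mem_fil hc.2 hl')
  refine add_mem ?_ ?_
  · exact fil_anti (by have := le_max_left (k + 1) (k - (l - 1)); omega) (pd_mem_fil h1)
  · exact fil_anti (by have := le_max_right (k + 1) (k - (l - 1)); omega)
      (mul_mem_fil (pd_mem_fil hl) h1)

theorem summable_conj (z : Completed 𝕜 c d) :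
    Summable fun i : OddIdx d => pdc s i.1 (puc hP s i.1 z) :=
  summable_of_finite fun k => (finite_conj_notMem hP s z k).preimage Subtype.val_injective.injOn

variable {s}

/-- The commutation relations survive conjugation by an even exponential. They are verified without
using `exp s`, which need not exist: `S_free / ħ` has weight zero. -/
theorem pdc_pdc (hs : Homog 0 s) {i j : ι} (hi : Odd (d i)) (hj : Odd (d j)) (z : Completed 𝕜 c d) :
    pdc s i (pdc s j z) = -pdc s j (pdc s i z) := by
  have e1 : ∀ {i}, Odd (d i) → rho 1 (pd i s) = -pd i s := fun {i} hi => by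
    rw [(hs.map_pd i).rho_eq, one_mul, zero_sub, hi.neg.neg_one_zpow, neg_smul, one_smul]
  have e2 : pd i s * pd j s = -(pd j s * pd i s) := by
    rw [(hs.map_pd i).mul_comm, zero_sub, rho_of_odd hi.neg, e1 hj, neg_mul]
  simp only [pdc_apply, map_add, pd_mul_odd hi, pd_mul_odd hj, e1 hi, e1 hj, pd_pd_odd hi hj z,
    pd_pd_odd hi hj s, ← mul_assoc, e2]
  noncomm_ring

theorem puc_puc (hs : Homog 0 s) {i j : ι} (hi : Odd (d i)) (hj : Odd (d j)) (z : Completed 𝕜 c d) :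
    puc hP s i (puc hP s j z) = puc hP s j (puc hP s i z) := by
  have e2 : pu hP i s * pu hP j s = pu hP j s * pu hP i s := by
    rw [(hs.map_pu hP i).mul_comm, rho_of_even]
    rw [zero_add]
    exact (show Odd (1 : ℤ) by decide).add_odd hi
  simp only [puc_apply, map_add, pu_mul hP hi, pu_mul hP hj, pu_pu hP (i := i) hj, ← mul_assoc, e2]
  abel

theorem pdc_puc (hs : Homog 0 s) {i j : ι} (hi : Odd (d i)) (hj : Odd (d j)) (z : Completed 𝕜 c d) :
    pdc s i (puc hP s j z) = puc hP s j (pdc s i z) := by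
  have hev : Even (0 + 1 + d j) := by
    rw [zero_add]
    exact (show Odd (1 : ℤ) by decide).add_odd hj
  have e1 : rho 1 (pu hP j s) = pu hP j s := by
    rw [(hs.map_pu hP j).rho_eq, one_mul, hev.neg_one_zpow, one_smul]
  have e2 : pu hP j s * pd i s = pd i s * pu hP j s := by
    rw [(hs.map_pu hP j).mul_comm, rho_of_even hev]
  simp only [puc_apply, pdc_apply, map_add, pu_mul hP hj, pd_mul_odd hi, pd_pu hP hj, e1,
    ← mul_assoc, e2]
  abel

variable (s) in
theorem summable_conj₂ (z : Completed 𝕜 c d) :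
    Summable fun p : OddIdx d × OddIdx d => pdc s p.1.1 (puc hP s p.1.1 (pdc s p.2.1 (puc hP s p.2.1 z))) := by
  obtain ⟨r, hr⟩ := exists_shift hP s
  refine summable_of_finite fun k => ?_
  have h1 : {j : OddIdx d | pdc s j.1 (puc hP s j.1 z) ∉ fil (k + r)}.Finite :=
    (finite_conj_notMem hP s z (k + r)).preimage Subtype.val_injective.injOn
  refine (h1.biUnion fun j _ =>
    (((finite_conj_notMem hP s (pdc s j.1 (puc hP s j.1 z)) k).preimage
      Subtype.val_injective.injOn).prod (Set.finite_singleton j))).subset ?_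
  rintro ⟨i, j⟩ hij
  simp only [Set.mem_iUnion]
  exact ⟨j, fun hc => hij (by simpa using hr i.1 _ _ hc), hij, rfl⟩

/-- The double sum changes sign when its two indices are exchanged: the `puc` commute with each
other and with the `pdc`, and the `pdc` anticommute. This is `Δ² = 0`, conjugated by `exp s`. -/
theorem conj_conj [CharZero 𝕜] (hs : Homog 0 s) (z : Completed 𝕜 c d) :
    ∑' i : OddIdx d, pdc s i.1 (puc hP s i.1 (∑' j : OddIdx d, pdc s j.1 (puc hP s j.1 z))) = 0 := by
  set A : OddIdx d × OddIdx d → Completed 𝕜 c d := fun p =>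
    pdc s p.1.1 (puc hP s p.1.1 (pdc s p.2.1 (puc hP s p.2.1 z))) with hA
  have hsum : Summable A := summable_conj₂ hP s z
  have hb : ∀ i : ι, IsBounded fun z : Completed 𝕜 c d => pdc s i (puc hP s i z) := fun i => by
    obtain ⟨r, hr⟩ := exists_shift hP s
    exact IsBounded.of_shift r fun k z hz => hr i k z hz
  have h1 : ∀ i : OddIdx d, HasSum (fun j => A (i, j))
      (pdc s i.1 (puc hP s i.1 (∑' j : OddIdx d, pdc s j.1 (puc hP s j.1 z)))) := fun i =>
    IsBounded.hasSum (L := ((pdc s i.1 ∘ₗ puc hP s i.1 : Completed 𝕜 c d →ₗ[𝕜] _)).toAddMonoidHom)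
      (hb i.1) (summable_conj hP s z).hasSum
  rw [(hsum.hasSum.prod_fiberwise h1).tsum_eq]
  have h2 : ∑' p, A p = -∑' p, A p := by
    conv_lhs => rw [← (Equiv.prodComm _ _).tsum_eq A]
    rw [← tsum_neg]
    refine tsum_congr fun p => ?_
    show A (p.2, p.1) = -A (p.1, p.2)
    simp only [hA]
    rw [← pdc_puc hP hs p.1.2 p.2.2, puc_puc hP hs p.2.2 p.1.2, pdc_pdc hs p.2.2 p.1.2,
      pdc_puc hP hs p.2.2 p.1.2]
  have h3 : (2 : 𝕜) • ∑' p, A p = 0 := by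
    rw [two_smul]
    nth_rewrite 1 [h2]
    exact neg_add_cancel _
  exact (smul_eq_zero.1 h3).resolve_left two_ne_zero

theorem pd_mul_pu_self (hs : Homog 0 s) : br hP s s = -((2 : 𝕜) • ∑' i : OddIdx d, pd i.1 s * pu hP i.1 s) := by
  have hsum : Summable fun i : OddIdx d => pd i.1 s * pu hP i.1 s := by
    have := summable_br₁ hP (rho 1 s) s
    refine this.neg.congr fun i => ?_
    rw [pd_rho_odd i.2, map_neg, rho_rho, neg_mul, neg_neg]
  rw [br_apply, ← tsum_smul' _ hsum, ← tsum_neg]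
  refine tsum_congr fun i => ?_
  have hev : Even (0 + 1 + d i.1) := by
    rw [zero_add]
    exact (show Odd (1 : ℤ) by decide).add_odd i.2
  rw [(hs.map_pu hP i.1).mul_comm, rho_of_even hev, (hs.map_pd i.1).rho_eq, one_mul, zero_sub,
    i.2.neg.neg_one_zpow, neg_smul, one_smul, two_smul, neg_mul]
  abel

/-- Expansion of `exp (-s) Δ exp s`. The term of order zero is the left side of the master equation
for `s`, so for a solution only `Δ + {s, -}` remains. -/
theorem tsum_conj [CharZero 𝕜] (hs : Homog 0 s) (z : Completed 𝕜 c d) :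
    -∑' i : OddIdx d, pdc s i.1 (puc hP s i.1 z) =
      lap hP z + br hP s z + (lap hP s + (2⁻¹ : 𝕜) • br hP s s) * z := by
  have hsum : Summable fun i : OddIdx d => pd i.1 s * pu hP i.1 s := by
    have := summable_br₁ hP (rho 1 s) s
    refine this.neg.congr fun i => ?_
    rw [pd_rho_odd i.2, map_neg, rho_rho, neg_mul, neg_neg]
  rw [pd_mul_pu_self hP hs, smul_neg, smul_smul, inv_mul_cancel₀ two_ne_zero, one_smul, add_mul, neg_mul,
    tsum_mul_right' _ hsum, lap_apply, lap_apply, neg_mul, tsum_mul_right' _ (summable_lap hP s), br_apply,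
    ← tsum_neg, ← tsum_neg, ← tsum_neg, ← tsum_neg, ← Summable.tsum_add (summable_lap hP z).neg
      (summable_br hP s z), ← Summable.tsum_add ((summable_lap hP s).mul_right z).neg (hsum.mul_right z).neg,
    ← Summable.tsum_add ((summable_lap hP z).neg.add (summable_br hP s z))
      (((summable_lap hP s).mul_right z).neg.add (hsum.mul_right z).neg)]
  refine tsum_congr fun i => ?_
  have hev : Even (0 + 1 + d i.1) := by
    rw [zero_add]
    exact (show Odd (1 : ℤ) by decide).add_odd i.2
  have e1 : rho 1 (pu hP i.1 s) = pu hP i.1 s := by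
    rw [(hs.map_pu hP i.1).rho_eq, one_mul, hev.neg_one_zpow, one_smul]
  have e2 : rho 1 (pd i.1 s) = -pd i.1 s := by
    rw [(hs.map_pd i.1).rho_eq, one_mul, zero_sub, i.2.neg.neg_one_zpow, neg_smul, one_smul]
  simp only [puc_apply, pdc_apply, map_add, pd_mul_odd i.2, e1, e2]
  noncomm_ring

end Conj

theorem lap_lap [CharZero 𝕜] (z : Completed 𝕜 c d) : lap hP (lap hP z) = 0 := by
  have h := conj_conj hP (s := (0 : Completed 𝕜 c d)) (Homog.zero 0) z
  have e : ∀ z : Completed 𝕜 c d, ∑' i : OddIdx d, pdc 0 i.1 (puc hP 0 i.1 z) = -lap hP z := fun z => by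
    rw [lap_apply, neg_neg]
    refine tsum_congr fun i => ?_
    simp [pdc_apply, puc_apply]
  rw [e, e, map_neg, neg_neg] at h
  exact h

/-- The master equation for `a`, in the form `Δ a + ½ {a, a} = 0`. -/
def IsMaster (a : Completed 𝕜 c d) : Prop := lap hP a + (2⁻¹ : 𝕜) • br hP a a = 0

theorem isMaster_iff [CharZero 𝕜] (S : Completed 𝕜 c d) :
    IsMaster hP (hb (-1) * S) ↔ MasterEquation d P S.1 := by
  have e : (2 • hbarPow 1 (laplacian d P S.1) + bracket d P S.1 S.1) =
      ((2 : 𝕜) • (hb 2 * (lap hP (hb (-1) * S) + (2⁻¹ : 𝕜) • br hP (hb (-1) * S) (hb (-1) * S)))).1 := by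
    rw [bracket_val hP, laplacian_val hP, ← hb_mul_val, lap_hb, br_hb_left, br_hb_right, mul_add,
      ← mul_assoc, hb_mul_hb, mul_smul_comm, ← mul_assoc, ← mul_assoc, hb_mul_hb, hb_mul_hb, smul_add, smul_smul,
      mul_inv_cancel₀ two_ne_zero, one_smul, show (2 : ℤ) + -1 = 1 by norm_num,
      show (1 : ℤ) + -1 = 0 by norm_num, hb_zero, one_mul, two_smul, two_smul]
    rfl
  rw [MasterEquation, e, IsMaster]
  constructor
  · intro h
    rw [h, mul_zero, smul_zero]
    rfl
  · intro h
    have h1 := (smul_eq_zero.1 (val_injective h : (2 : 𝕜) • _ = (0 : Completed 𝕜 c d))).resolve_left two_ne_zero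
    rw [← hb_mul_cancel 2 (lap hP _ + _), h1, mul_zero]

variable {S : Completed 𝕜 c d}

theorem tw_eq_conj [CharZero 𝕜] (hS : Homog 0 S) (hM : IsMaster hP (hb (-1) * S)) (z : Completed 𝕜 c d) :
    tw hP S z = -(hb 1 * ∑' i : OddIdx d, pdc (hb (-1) * S) i.1 (puc hP (hb (-1) * S) i.1 z)) := by
  have := tsum_conj hP (hS.hb_mul (-1)) z
  rw [show lap hP (hb (-1) * S) + (2⁻¹ : 𝕜) • br hP (hb (-1) * S) (hb (-1) * S) = 0 from hM, zero_mul,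
    add_zero] at this
  rw [← mul_neg, this, mul_add, br_hb_left, hb_mul_cancel', tw_apply, add_comm]

/-- By `tw_eq_conj` the operator is `ħ` times a conjugate of `Δ`, whose square is zero. -/
theorem tw_tw [CharZero 𝕜] (hS : Homog 0 S) (hM : IsMaster hP (hb (-1) * S)) (z : Completed 𝕜 c d) :
    tw hP S (tw hP S z) = 0 := by
  rw [tw_eq_conj hP hS hM z, map_neg, tw_hb, tw_eq_conj hP hS hM, conj_conj hP (hS.hb_mul (-1))]
  simp

/-- With `s = S / ħ`, one has `Δ exp b = (Δ b + ½ {b, b}) exp b` and `{s, exp b} = {s, b} exp b`.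
The resulting coefficient of `exp b` is the difference of the master expressions of `s + b` and of
`s`. -/
theorem tw_expC [CharZero 𝕜] (hS : Homog 0 S) (hM : IsMaster hP (hb (-1) * S)) {b : Completed 𝕜 c d}
    (hb' : Homog 0 b) (hb1 : b ∈ fil 1) (hM' : IsMaster hP (hb (-1) * S + b)) :
    tw hP S (expC b) = 0 := by
  set s := hb (-1) * S with hs
  have hs0 : Homog 0 s := hS.hb_mul (-1)
  have hsum : Summable fun i : OddIdx d => pd i.1 b * pu hP i.1 b := by
    have := summable_br₁ hP (rho 1 b) b
    refine this.neg.congr fun i => ?_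
    rw [pd_rho_odd i.2, map_neg, rho_rho, neg_mul, neg_neg]
  have h1 : lap hP (expC b) = (lap hP b + (2⁻¹ : 𝕜) • br hP b b) * expC b := by
    rw [pd_mul_pu_self hP hb', smul_neg, smul_smul, inv_mul_cancel₀ two_ne_zero, one_smul, add_mul, neg_mul,
      tsum_mul_right' _ hsum, lap_apply, lap_apply, neg_mul, tsum_mul_right' _ (summable_lap hP b), ← tsum_neg,
      ← tsum_neg, ← tsum_neg, ← Summable.tsum_add ((summable_lap hP b).mul_right _).neg (hsum.mul_right _).neg]
    refine tsum_congr fun i => ?_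
    have hev : Even (0 + 1 + d i.1) := by
      rw [zero_add]
      exact (show Odd (1 : ℤ) by decide).add_odd i.2
    have e1 : rho 1 (pu hP i.1 b) = pu hP i.1 b := by
      rw [(hb'.map_pu hP i.1).rho_eq, one_mul, hev.neg_one_zpow, one_smul]
    rw [(isDer_pu hP i.2).map_expC hb1 hb', pd_mul_odd i.2, e1, pd_expC i.1 hb1 hb', ← mul_assoc,
      (hb'.map_pu hP i.1).mul_comm, rho_of_even hev]
    abel
  have h2 : br hP s (expC b) = br hP s b * expC b := by
    have h3 : ∀ y, br hP s (b * y) = br hP s b * y + b * br hP s y := fun y => by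
      rw [br_mul hP hs0, hb'.rho_eq, mul_zero, zpow_zero, one_smul]
    refine map_expC_of_leibniz (isBounded_br hP s) ?_ h3 hb1 hb'
    have := br_mul hP hs0 1 1
    rw [map_one (rho (0 + 1)), mul_one, mul_one, one_mul] at this
    simpa using this
  have h4 : tw hP S (expC b) = hb 1 * (lap hP (expC b) + br hP s (expC b)) := by
    rw [tw_apply, mul_add, ← br_hb_left, hs, hb_mul_cancel', add_comm]
  have h5 : lap hP b + (2⁻¹ : 𝕜) • br hP b b + br hP s b = 0 := by
    have h6 : lap hP (s + b) + (2⁻¹ : 𝕜) • br hP (s + b) (s + b) = 0 := hM'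
    have h7 : lap hP s + (2⁻¹ : 𝕜) • br hP s s = 0 := hM
    rw [map_add, map_add, br_add_left, br_add_left, br_comm_zero hP hb' hs0] at h6
    have h8 : br hP s b = (2⁻¹ : 𝕜) • br hP s b + (2⁻¹ : 𝕜) • br hP s b := by
      rw [← add_smul, ← two_mul, mul_inv_cancel₀ two_ne_zero, one_smul]
    have h9 : ∀ x y : Completed 𝕜 c d, x = 0 → y = 0 → x - y = 0 := by simp_all
    rw [← h9 _ _ h6 h7]
    nth_rewrite 1 [h8]
    simp only [smul_add]
    abel
  rw [h4, h1, h2, ← add_mul, h5, zero_mul, mul_zero]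

/-- The master expression of `S / ħ` is homogeneous of weight `-2`, whereas every term involving `b`
has weight at least `-1`. So it is the lowest part of the given equation and vanishes separately. -/
theorem isMaster_kinetic [CharZero 𝕜] {S b : Completed 𝕜 2 d} (hS : S ∈ fil 2) (hS' : eul S = (2 : 𝕜) • S)
    (hb' : b ∈ fil 1) (hM : IsMaster hP (hb (-1) * S + b)) : IsMaster hP (hb (-1) * S) := by
  set s := hb (-1) * S with hs
  have hs0 : s ∈ fil 0 := by simpa using hb_mul_mem_fil (k := -1) hS
  have hse : eul s = 0 := by
    rw [hs, isDer_eul.leibniz, hS', eul_hb, mul_smul_comm, smul_mul_assoc, ← add_smul]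
    norm_num
  have h1 : lap hP (s + b) + (2⁻¹ : 𝕜) • br hP (s + b) (s + b) = 0 := hM
  show lap hP s + (2⁻¹ : 𝕜) • br hP s s = 0
  refine eq_zero_of_eul (w := -2) (z' := 0) ?_ (fun _ _ => Submodule.zero_mem _) ?_
  · have : lap hP s + (2⁻¹ : 𝕜) • br hP s s =
        -(lap hP b + (2⁻¹ : 𝕜) • (br hP s b + br hP b s + br hP b b)) := by
      rw [eq_neg_iff_add_eq_zero, ← h1, map_add, map_add, br_add_left, br_add_left]
      simp only [smul_add]
      abel
    rw [this]
    refine neg_mem (add_mem (lap_mem_fil hP hb') (Submodule.smul_mem _ _ (add_mem (add_mem ?_ ?_) ?_)))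
    · exact fil_anti (by norm_num) (br_mem_fil hP hs0 hb')
    · exact fil_anti (by norm_num) (br_mem_fil hP hb' hs0)
    · exact fil_anti (by norm_num) (br_mem_fil hP hb' hb')
  · have e1 := lap_eul hP s
    have e2 := eul_br hP s s
    rw [hse, map_zero] at e1
    rw [hse, map_zero, br_apply hP 0] at e2
    simp only [map_zero, zero_mul, sub_zero, tsum_zero, zero_add] at e2
    push_cast
    rw [map_add, map_smul, smul_add, smul_comm (-2 : 𝕜) (2⁻¹ : 𝕜), sub_eq_zero]
    rw [neg_smul, neg_smul, eq_neg_of_add_eq_zero_left e1.symm, eq_neg_of_add_eq_zero_left e2.symm]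

/-! ### Odd multiplication operators -/

/-- As `K` is odd, the left side is the graded commutator of a second order operator with a
multiplication, hence an operator of first order. -/
theorem tw_mul_add {K : Completed 𝕜 c d} (hS : Homog 0 S) (hK : Homog (-1) K) (z : Completed 𝕜 c d) :
    tw hP S (K * z) + K * tw hP S z = tw hP S K * z - hb 1 * br hP K z := by
  have e : rho 1 K = -K := by rw [hK.rho_eq]; simp
  rw [tw_apply, tw_apply, tw_apply, br_mul hP hS, zero_add, e, lap_mul, e, br_neg_left]
  simp only [mul_add, add_mul, mul_neg, neg_mul, ← mul_assoc, hb_comm 1 K]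
  abel

/-- Apply `Δ² = 0` to the product `H z` and expand twice with the second order product rule. -/
theorem lap_br [CharZero 𝕜] {H : Completed 𝕜 c d} (hH : Homog (-1) H) (z : Completed 𝕜 c d) :
    lap hP (br hP H z) = br hP H (lap hP z) + br hP (lap hP H) z := by
  have e : rho 1 H = -H := by rw [hH.rho_eq]; simp
  have h0 : Homog 0 (lap hP H) := hH.map_lap hP
  have e' : rho 1 (lap hP H) = lap hP H := by rw [h0.rho_eq]; simp
  have h1 : ∀ z, lap hP (H * z) = lap hP H * z - H * lap hP z - br hP H z := fun z => by
    rw [lap_mul, e, br_neg_left, neg_mul]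
    abel
  have h2 := lap_lap hP (H * z)
  rw [h1, map_sub, map_sub, h1, lap_mul, e', lap_lap, lap_lap] at h2
  rw [← sub_eq_zero, ← neg_eq_zero, ← h2]
  noncomm_ring

/-- The Jacobi identity. -/
theorem br_br [CharZero 𝕜] {H : Completed 𝕜 c d} (hH : Homog (-1) H) (a b : Completed 𝕜 c d) :
    br hP H (br hP a b) = br hP (br hP H a) b + br hP a (br hP H b) := by
  have h0 : Homog 0 (lap hP H) := hH.map_lap hP
  have hX := isDer_br hP hH
  -- The bracket is the defect of `Δ` from being a derivation. The derivation `{H, -}` commutes with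
  -- `Δ` up to `{Δ H, -}`, and the contributions of the latter cancel by its own product rule.
  have key : ∀ a b : Completed 𝕜 c d, br hP a b = lap hP (rho 1 a * b) - lap hP (rho 1 a) * b - a * lap hP b :=
    fun a b => by
      rw [lap_mul, rho_rho]
      abel
  have hl : ∀ z, br hP H (lap hP z) = lap hP (br hP H z) - br hP (lap hP H) z := fun z => by
    rw [lap_br hP hH]
    abel
  rw [key a b, key (br hP H a), key a (br hP H b), map_sub, map_sub, hX.leibniz, hX.leibniz, hl, hl, hl,
    hX.leibniz, ← rho_br hP hH, br_mul hP h0, zero_add, rho_rho, map_add]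
  noncomm_ring

end Completed

end BV

/-! ### Supermatrices, the logarithm of the Berezinian, and Hamiltonian vector fields -/

section Ber

variable {ι 𝕜 : Type*} [LinearOrder ι] [Field 𝕜]

namespace Completed

variable {c : ℤ} {d : ι → ℤ} {P : ι → ι → 𝕜}

/-! ### Matrices of formal functions -/

/-- A matrix of formal functions of total degree `0` and level at least `r`, with finitely many entries
below each level. -/
structure IsMtx (r : ℤ) (M : ι → ι → Completed 𝕜 c d) : Prop where
  homog : ∀ i j, Homog (d j - d i) (M i j)
  mem : ∀ i j, M i j ∈ fil r
  summable : Summable fun p : ι × ι => M p.1 p.2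

/-- The product of matrices. -/
def mm (M N : ι → ι → Completed 𝕜 c d) (i j : ι) : Completed 𝕜 c d := ∑' l, M i l * N l j

/-- The supertrace of a matrix. -/
def str (M : ι → ι → Completed 𝕜 c d) : Completed 𝕜 c d := ∑' i, ((-1) ^ d i : 𝕜) • M i i

theorem tsum_comm_of_summable {α β : Type*} {f : α → β → Completed 𝕜 c d}
    (h : Summable fun p : α × β => f p.1 p.2) : ∑' a, ∑' b, f a b = ∑' b, ∑' a, f a b := by
  refine Summable.tsum_comm' (f := fun b a => f a b) ?_ ?_ ?_
  · exact (Equiv.prodComm β α).summable_iff.2 h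
  · exact fun b => summable_iff.2 fun k => (summable_iff.1 h k).preimage
      (f := fun a => (a, b)) fun x _ y _ e => (Prod.ext_iff.1 e).1
  · exact fun a => summable_iff.2 fun k => (summable_iff.1 h k).preimage
      (f := fun b => (a, b)) fun x _ y _ e => (Prod.ext_iff.1 e).2

variable {r s t : ℤ} {A B C : ι → ι → Completed 𝕜 c d}

theorem IsMtx.summable_mul (hA : IsMtx r A) (hB : IsMtx s B) :
    Summable fun q : (ι × ι) × ι => A q.1.1 q.1.2 * B q.1.2 q.2 := by
  refine summable_of_finite fun k => ?_
  refine ((finite_of_summable hA.summable (k - s)).prod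
    ((finite_of_summable hB.summable (k - r)).image Prod.snd)).subset ?_
  rintro ⟨⟨i, l⟩, j⟩ h
  refine ⟨fun hc => h ?_, (l, j), fun hc => h ?_, rfl⟩
  · simpa using mul_mem_fil hc (hB.mem l j)
  · simpa using mul_mem_fil (hA.mem i l) hc

theorem IsMtx.summable_row (hA : IsMtx r A) (hB : IsMtx s B) (i j : ι) : Summable fun l => A i l * B l j :=
  summable_iff.2 fun k => (summable_iff.1 (hA.summable_mul hB) k).preimage (f := fun l => ((i, l), j))
    fun _ _ _ _ e => (Prod.ext_iff.1 (Prod.ext_iff.1 e).1).2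

theorem IsMtx.mm (hA : IsMtx r A) (hB : IsMtx s B) : IsMtx (r + s) (mm A B) where
  homog i j := Homog.tsum fun l => by
    have := (hA.homog i l).mul (hB.homog l j)
    rwa [show d l - d i + (d j - d l) = d j - d i by ring] at this
  mem i j := tsum_mem_fil fun l => mul_mem_fil (hA.mem i l) (hB.mem l j)
  summable := summable_of_finite fun k =>
    ((finite_of_summable (hA.summable_mul hB) k).image fun q => (q.1.1, q.2)).subset <| by
      rintro ⟨i, j⟩ h
      by_contra hc
      refine h (tsum_mem_fil fun l => ?_)
      by_contra hl
      exact hc ⟨((i, l), j), hl, rfl⟩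

theorem mm_assoc (hA : IsMtx r A) (hB : IsMtx s B) (hC : IsMtx t C) : mm (mm A B) C = mm A (mm B C) := by
  funext i j
  have h1 : mm (mm A B) C i j = ∑' l, ∑' k, A i k * B k l * C l j :=
    tsum_congr fun l => tsum_mul_right' _ (hA.summable_row hB i l)
  have h2 : mm A (mm B C) i j = ∑' k, ∑' l, A i k * B k l * C l j := tsum_congr fun k => by
    rw [mm, tsum_mul_left' _ (hB.summable_row hC k j)]
    exact tsum_congr fun l => (mul_assoc _ _ _).symm
  rw [h1, h2]
  refine tsum_comm_of_summable (f := fun l k => A i k * B k l * C l j) ?_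
  refine summable_of_finite fun k => ((finite_of_summable hB.summable (k - r - t)).image Prod.swap).subset ?_
  rintro ⟨l, m⟩ h
  refine ⟨(m, l), fun hc => h ?_, rfl⟩
  have := mul_mem_fil (mul_mem_fil (hA.mem i m) hc) (hC.mem l j)
  rwa [show r + (k - r - t) + t = k by ring] at this

theorem add_mm (hA : IsMtx r A) (hB : IsMtx s B) (hC : IsMtx t C) : mm (A + B) C = mm A C + mm B C := by
  funext i j
  rw [Pi.add_apply, Pi.add_apply, mm, mm, mm, ← (hA.summable_row hC i j).tsum_add (hB.summable_row hC i j)]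
  exact tsum_congr fun l => add_mul _ _ _

theorem IsMtx.summable_diag (hA : IsMtx r A) : Summable fun i => ((-1) ^ d i : 𝕜) • A i i :=
  summable_of_finite fun k => ((finite_of_summable hA.summable k).image Prod.fst).subset fun i hi =>
    ⟨(i, i), fun hc => hi (Submodule.smul_mem _ _ hc), rfl⟩

theorem str_add (hA : IsMtx r A) (hB : IsMtx s B) : str (A + B) = str A + str B := by
  rw [str, str, str, ← hA.summable_diag.tsum_add hB.summable_diag]
  exact tsum_congr fun i => smul_add _ _ _

theorem str_mem_fil (hA : IsMtx r A) : str A ∈ fil r :=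
  tsum_mem_fil fun i => Submodule.smul_mem _ _ (hA.mem i i)

theorem homog_str (hA : IsMtx r A) : Homog 0 (str A) := Homog.tsum fun i => Homog.smul (by
  have := hA.homog i i
  rwa [sub_self] at this) _

/-- Exchanging `A i l` and `B l i` costs a sign with the parity of `(d l - d i)²`, hence of `d l - d
i`; it turns the supertrace sign of `i` into that of `l`. -/
theorem str_mm_comm (hA : IsMtx r A) (hB : IsMtx s B) : str (mm A B) = str (mm B A) := by
  have h1 : str (mm A B) = ∑' i, ∑' l, ((-1) ^ d i : 𝕜) • (A i l * B l i) := tsum_congr fun i =>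
    (tsum_smul' _ (hA.summable_row hB i i)).symm
  have h2 : str (mm B A) = ∑' l, ∑' i, ((-1) ^ d l : 𝕜) • (B l i * A i l) := tsum_congr fun l =>
    (tsum_smul' _ (hB.summable_row hA l l)).symm
  rw [h1, h2, tsum_comm_of_summable]
  · refine tsum_congr fun l => tsum_congr fun i => ?_
    rw [(hA.homog i l).mul_comm, (hB.homog l i).rho_eq, smul_mul_assoc, smul_smul]
    congr 1
    have hne : (-1 : 𝕜) ≠ 0 := neg_ne_zero.2 one_ne_zero
    rw [← zpow_add₀ hne, show d i + (d l - d i) * (d i - d l) = d l + (-(d l - d i) * (d l - d i + 1)) by ring,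
      zpow_add₀ hne, show -(d l - d i) * (d l - d i + 1) = -((d l - d i) * (d l - d i + 1)) by ring,
      (Int.even_mul_succ_self _).neg.neg_one_zpow, mul_one]
  · refine summable_of_finite fun k => (finite_of_summable hA.summable (k - s)).subset ?_
    rintro ⟨i, l⟩ h hc
    exact h (Submodule.smul_mem _ _ (by simpa using mul_mem_fil hc (hB.mem l i)))

/-! ### Powers, and the logarithm of the Berezinian -/

/-- The power `N ^ (k + 1)` of a matrix. -/
def mpow (N : ι → ι → Completed 𝕜 c d) : ℕ → ι → ι → Completed 𝕜 c d
  -- The indexing starts with `N` because for infinite `ι` the identity matrix has infinitely many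
  -- entries of level `0` and is not an `IsMtx`.
  | 0 => N
  | k + 1 => mm N (mpow N k)

theorem IsMtx.mpow {N : ι → ι → Completed 𝕜 c d} (hN : IsMtx 1 N) (k : ℕ) : IsMtx (k + 1) (mpow N k) := by
  induction k with
  | zero => exact (by simpa using hN : IsMtx ((0 : ℕ) + 1) N)
  | succ k ih =>
    have := hN.mm ih
    rw [add_comm] at this
    push_cast
    exact this

theorem mpow_mm_mpow {N : ι → ι → Completed 𝕜 c d} (hN : IsMtx 1 N) (k m : ℕ) :
    mm (mpow N k) (mpow N m) = mpow N (k + m + 1) := by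
  induction k with
  | zero => rw [zero_add]; rfl
  | succ k ih =>
    rw [show k + 1 + m + 1 = (k + m + 1) + 1 by ring]
    show mm (mm N (mpow N k)) (mpow N m) = mm N (mpow N (k + m + 1))
    rw [mm_assoc hN (hN.mpow k) (hN.mpow m), ih]

theorem IsMtx.summable_str {N : ι → ι → Completed 𝕜 c d} (hN : IsMtx 1 N) (x : ℕ → 𝕜) :
    Summable fun k => x k • str (Completed.mpow N k) :=
  summable_of_finite fun k => (Set.finite_lt_nat k.toNat).subset fun n hn => by
    by_contra hc
    refine hn (Submodule.smul_mem _ _ (fil_anti ?_ (str_mem_fil (hN.mpow n))))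
    simp only [Set.mem_ofPred_eq, not_lt] at hc
    omega

/-- The supertrace of `log (1 + N)`. -/
def strLog (N : ι → ι → Completed 𝕜 c d) : Completed 𝕜 c d :=
  ∑' k : ℕ, ((-1) ^ k * ((k : 𝕜) + 1)⁻¹) • str (mpow N k)

theorem strLog_mem_fil {N : ι → ι → Completed 𝕜 c d} (hN : IsMtx 1 N) : strLog N ∈ fil 1 :=
  tsum_mem_fil fun k => Submodule.smul_mem _ _ (fil_anti (by omega) (str_mem_fil (hN.mpow k)))

theorem homog_strLog {N : ι → ι → Completed 𝕜 c d} (hN : IsMtx 1 N) : Homog 0 (strLog N) :=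
  Homog.tsum fun k => (homog_str (hN.mpow k)).smul _

section Der

variable {δ : Completed 𝕜 c d →ₗ[𝕜] Completed 𝕜 c d} (hδ : IsDer δ)
  (hδf : ∀ (k : ℤ) a, a ∈ fil k → δ a ∈ fil k) (hδh : ∀ (n : ℤ) a, Homog n a → Homog n (δ a))

include hδf hδh in
theorem IsMtx.map_der (hA : IsMtx r A) : IsMtx r fun i j => δ (A i j) where
  homog i j := hδh _ _ (hA.homog i j)
  mem i j := hδf _ _ (hA.mem i j)
  summable := summable_of_finite fun k => (finite_of_summable hA.summable k).subset
    fun _ hp hc => hp (hδf _ _ hc)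

include hδ in
theorem IsDer.map_tsum {α : Type*} {f : α → Completed 𝕜 c d} (hf : Summable f) :
    δ (∑' x, f x) = ∑' x, δ (f x) :=
  IsBounded.map_tsum (L := δ.toAddMonoidHom) hδ.bounded hf

include hδ hδf hδh in
theorem der_mm (hA : IsMtx r A) (hB : IsMtx s B) : (fun i j => δ (mm A B i j)) =
    mm (fun i j => δ (A i j)) B + mm A (fun i j => δ (B i j)) := by
  funext i j
  have h1 := (hA.map_der hδf hδh).summable_row hB i j
  have h2 := hA.summable_row (hB.map_der hδf hδh) i j
  rw [mm, hδ.map_tsum (hA.summable_row hB i j), Pi.add_apply, Pi.add_apply, mm, mm, ← h1.tsum_add h2]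
  exact tsum_congr fun l => hδ.leibniz _ _

include hδ in
theorem der_str (hA : IsMtx r A) : δ (str A) = str fun i j => δ (A i j) := by
  rw [str, hδ.map_tsum hA.summable_diag]
  exact tsum_congr fun i => map_smul _ _ _

include hδ hδf hδh in
-- The product rule gives `k + 1` terms, and cyclicity of the supertrace moves the differentiated
-- factor to the front of each.
theorem str_der_mpow_mm {N : ι → ι → Completed 𝕜 c d} (hN : IsMtx 1 N) (k m : ℕ) :
    str (mm (fun i j => δ (mpow N k i j)) (mpow N m)) =
      ((k : 𝕜) + 1) • str (mm (fun i j => δ (N i j)) (mpow N (k + m))) := by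
  have hN' := hN.map_der hδf hδh
  induction k generalizing m with
  | zero => simp [mpow]
  | succ k ih =>
    have hk := hN.mpow k
    have hk' := hk.map_der hδf hδh
    have hm := hN.mpow m
    have e1 : (fun i j => δ (mpow N (k + 1) i j)) =
      mm (fun i j => δ (N i j)) (mpow N k) + mm N (fun i j => δ (mpow N k i j)) :=
      der_mm hδ hδf hδh hN hk
    have e2 := mpow_mm_mpow hN m 0
    rw [e1, add_mm (hN'.mm hk) (hN.mm hk') hm, str_add ((hN'.mm hk).mm hm) ((hN.mm hk').mm hm),
      mm_assoc hN' hk hm, mpow_mm_mpow hN, mm_assoc hN hk' hm, str_mm_comm hN (hk'.mm hm),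
      mm_assoc hk' hm hN, show mm (mpow N m) N = mpow N (m + 1) from e2, ih (m + 1),
      show k + 1 + m = k + m + 1 by ring, show k + (m + 1) = k + m + 1 by ring]
    push_cast
    module

include hδ hδf hδh in
theorem str_der_mpow {N : ι → ι → Completed 𝕜 c d} (hN : IsMtx 1 N) (k : ℕ) :
    δ (str (mpow N (k + 1))) = ((k : 𝕜) + 2) • str (mm (fun i j => δ (N i j)) (mpow N k)) := by
  have hN' := hN.map_der hδf hδh
  have hk := hN.mpow k
  have hk' := hk.map_der hδf hδh
  have h1 := str_der_mpow_mm hδ hδf hδh hN k 0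
  rw [der_str hδ (hN.mpow (k + 1))]
  have e1 : (fun i j => δ (mpow N (k + 1) i j)) =
    mm (fun i j => δ (N i j)) (mpow N k) + mm N (fun i j => δ (mpow N k i j)) :=
    der_mm hδ hδf hδh hN hk
  rw [e1, str_add (hN'.mm hk) (hN.mm hk'), str_mm_comm hN hk', show mm _ N = mm _ (mpow N 0) from rfl, h1,
    add_zero]
  module

include hδ hδf hδh in
/-- If `δ N = Y (1 + N)` then `δ (str log (1 + N)) = str Y`. -/
theorem der_strLog [CharZero 𝕜] {N Y : ι → ι → Completed 𝕜 c d} (hN : IsMtx 1 N) (hY : IsMtx 1 Y)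
    (h : ∀ i j, δ (N i j) = Y i j + mm Y N i j) : δ (strLog N) = str Y := by
  have h' : (fun i j => δ (N i j)) = Y + mm Y N := by
    funext i j
    exact h i j
  -- `T k` stands for `str (Y N^k)`. The derivative of `str (N^(k+1))` is `(k + 1) (T k + T (k +
  -- 1))`, so the alternating series telescopes to `T 0 = str Y`.
  let T : ℕ → Completed 𝕜 c d := fun k => Nat.casesOn k (str Y) fun k => str (mm Y (mpow N k))
  have hT : ∀ k : ℕ, T k ∈ fil (k + 1) := fun k => by
    cases k with
    | zero => exact fil_anti (by simp) (str_mem_fil hY)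
    | succ k => exact fil_anti (by push_cast; omega) (str_mem_fil (hY.mm (hN.mpow k)))
  have hTs : Summable fun k : ℕ => ((-1) ^ k : 𝕜) • T k :=
    summable_of_finite fun k => (Set.finite_lt_nat k.toNat).subset fun n hn => by
      by_contra hc
      refine hn (Submodule.smul_mem _ _ (fil_anti ?_ (hT n)))
      simp only [Set.mem_ofPred_eq, not_lt] at hc
      omega
  have hd : ∀ k : ℕ, δ (str (mpow N k)) = ((k : 𝕜) + 1) • (T k + T (k + 1)) := fun k => by
    cases k with
    | zero =>
      rw [der_str hδ (hN.mpow 0)]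
      show str (fun i j => δ (N i j)) = _
      rw [h', str_add hY (hY.mm hN), Nat.cast_zero, zero_add, one_smul]
      rfl
    | succ k =>
      have e : mm (mm Y N) (mpow N k) = mm Y (mpow N (k + 1)) := mm_assoc hY hN (hN.mpow k)
      rw [str_der_mpow hδ hδf hδh hN, h', add_mm hY (hY.mm hN) (hN.mpow k), e,
        str_add (hY.mm (hN.mpow k)) (hY.mm (hN.mpow (k + 1)))]
      push_cast
      rw [add_assoc]
      norm_num
      rfl
  have hsplit := hTs.tsum_eq_zero_add
  have hTs' : Summable fun k : ℕ => ((-1) ^ (k + 1) : 𝕜) • T (k + 1) :=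
    summable_iff.2 fun k => (summable_iff.1 hTs k).preimage (f := fun n => n + 1) fun x _ y _ e => by
      simpa using e
  rw [pow_zero, one_smul] at hsplit
  rw [strLog, hδ.map_tsum (hN.summable_str _)]
  have : ∀ k : ℕ, δ (((-1) ^ k * ((k : 𝕜) + 1)⁻¹) • str (mpow N k)) =
      ((-1) ^ k : 𝕜) • T k - ((-1) ^ (k + 1) : 𝕜) • T (k + 1) := fun k => by
    have hk : (k : 𝕜) + 1 ≠ 0 := Nat.cast_add_one_ne_zero k
    rw [map_smul, hd, smul_smul, mul_assoc, inv_mul_cancel₀ hk]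
    module
  rw [tsum_congr this, hTs.tsum_sub hTs', hsplit]
  show T 0 + _ - _ = T 0
  abel

end Der

/-! ### Hamiltonian vector fields -/

section Ham

variable (hP : IsOddPoisson d P)

include hP in
theorem summable_br_pairs (a b : Completed 𝕜 c d) :
    Summable fun p : ι × ι => P p.1 p.2 • (rho (d p.1) (pd p.1 a) * pd p.2 b) := by
  obtain ⟨l, hl⟩ := a.exists_mem_fil
  exact summable_pairs hP (fun i j h => by simp [h]) fun k => (finite_pd_notMem b (k - (l - 1))).subset
    fun j ⟨i, hi⟩ hc => hi (Submodule.smul_mem _ _ (by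
      simpa using mul_mem_fil (rho_mem_fil (n := d i) (pd_mem_fil (i := i) hl)) hc))

theorem br_eq_tsum_pairs (a b : Completed 𝕜 c d) :
    br hP a b = ∑' p : ι × ι, P p.1 p.2 • (rho (d p.1) (pd p.1 a) * pd p.2 b) := by
  apply val_injective
  funext g m
  rw [← bracket_val hP, val_tsum (summable_br_pairs hP a b)]
  refine finsum_congr fun p => ?_
  rw [dR_val]
  rfl

theorem summable_pu_mul_pd (H z : Completed 𝕜 c d) : Summable fun l => pu hP l H * pd l z := by
  obtain ⟨k', hk'⟩ := z.exists_mem_fil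
  refine summable_of_finite fun k => (finite_pu_notMem hP H (k - (k' - 1))).subset fun l hl hc => hl ?_
  simpa using mul_mem_fil hc (pd_mem_fil (i := l) hk')

/-- The Hamiltonian vector field of a function of degree `-1`, in coordinates. -/
theorem br_eq_tsum {H : Completed 𝕜 c d} (hH : Homog (-1) H) (z : Completed 𝕜 c d) :
    br hP H z = -∑' l, pu hP l H * pd l z := by
  have h1 := (Equiv.prodComm ι ι).hasSum_iff.2 (summable_br_pairs hP H z).hasSum
  have h2 := h1.prod_fiberwise (g := fun l => -(pu hP l H * pd l z)) fun l => by
    have : -(pu hP l H * pd l z) = ∑ i ∈ (hP.finite l).toFinset,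
        P i l • (rho (d i) (pd i H) * pd l z) := by
      rw [pu_apply, Finset.sum_mul, ← Finset.sum_neg_distrib]
      refine Finset.sum_congr rfl fun i _ => ?_
      have hev : Even (d i * (-1 - d i)) := by
        rw [show d i * (-1 - d i) = -(d i * (d i + 1)) by ring]
        exact (Int.even_mul_succ_self _).neg
      rw [(hH.map_pd i).rho_eq, hev.neg_one_zpow, one_smul, hP.antisymm i l, neg_smul, smul_mul_assoc]
    rw [this]
    refine hasSum_sum_of_ne_finset_zero fun i hi => ?_
    have : P l i = 0 := by simpa using hi
    simp [hP.antisymm i l, this]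
  rw [br_eq_tsum_pairs, ← h2.tsum_eq, tsum_neg]

theorem br_crd {H : Completed 𝕜 c d} (hH : Homog (-1) H) (l : ι) : br hP H (crd l) = -pu hP l H := by
  rw [br_eq_tsum hP hH, tsum_eq_single l]
  · rw [pd_crd, if_pos rfl, mul_one]
  · intro j hj
    rw [pd_crd, if_neg hj, mul_zero]

/-- The Jacobian matrix of the Hamiltonian vector field. -/
def hess (H : Completed 𝕜 c d) (i l : ι) : Completed 𝕜 c d := -pd i (pu hP l H)

theorem isMtx_hess {H : Completed 𝕜 c d} (hH : Homog (-1) H) {k : ℤ} (hk : H ∈ fil k) :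
    IsMtx (k - 2) (hess hP H) where
  homog i l := by
    have := ((hH.map_pu hP l).map_pd i).neg
    rwa [neg_add_cancel, zero_add] at this
  mem i l := neg_mem (by
    have := pd_mem_fil (i := i) (pu_mem_fil hP (i := l) hk)
    rwa [sub_sub] at this)
  summable := summable_of_finite fun n =>
    ((finite_pu_notMem hP H (n + 1)).biUnion fun l _ =>
      (finite_pd_notMem (pu hP l H) n).prod (Set.finite_singleton l)).subset <| by
    rintro ⟨i, l⟩ h
    simp only [Set.mem_iUnion]
    refine ⟨l, fun hc => h (neg_mem (by simpa using pd_mem_fil (i := i) hc)), fun hc => h (neg_mem hc), rfl⟩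

/-- The derivative acts either on the coefficients of the vector field, which gives the matrix
`hess`, or on its argument, where it commutes with the partial derivatives up to sign. -/
theorem pd_br {H : Completed 𝕜 c d} (hH : Homog (-1) H) (i : ι) (z : Completed 𝕜 c d) :
    pd i (br hP H z) = ∑' l, hess hP H i l * pd l z + br hP H (pd i z) := by
  have h0 := summable_pu_mul_pd hP H z
  have h1 : pd i (∑' l, pu hP l H * pd l z) = ∑' l, pd i (pu hP l H * pd l z) :=
    IsBounded.map_tsum (L := (pd i : Completed 𝕜 c d →ₗ[𝕜] _).toAddMonoidHom) (isBounded_pd i) h0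
  have h2 : Summable fun l => pd i (pu hP l H * pd l z) :=
    IsBounded.summable (L := (pd i : Completed 𝕜 c d →ₗ[𝕜] _).toAddMonoidHom) (isBounded_pd i) h0
  have h3 := summable_pu_mul_pd hP H (pd i z)
  have e : ∀ l, hess hP H i l * pd l z = -pd i (pu hP l H * pd l z) + pu hP l H * pd l (pd i z) := fun l => by
    have h4 := (hH.map_pu hP l).rho_eq (d i)
    rw [neg_add_cancel, zero_add] at h4
    rw [pd_mul, h4, pd_pd i l, smul_mul_assoc, mul_smul_comm, smul_smul, neg_one_zpow_mul_self, one_smul, hess,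
      neg_mul]
    abel
  rw [br_eq_tsum hP hH, br_eq_tsum hP hH, map_neg, h1, tsum_congr e, h2.neg.tsum_add h3, tsum_neg]
  abel

theorem lap_eq_tsum_pairs [CharZero 𝕜] (a : Completed 𝕜 c d) :
    (2 : 𝕜) • lap hP a = ∑' p : ι × ι, ((-1) ^ d p.1 * P p.1 p.2) • pd p.1 (pd p.2 a) ∧
      Summable fun p : ι × ι => ((-1) ^ d p.1 * P p.1 p.2) • pd p.1 (pd p.2 a) := by
  have hs : Summable fun p : ι × ι => ((-1) ^ d p.1 * P p.1 p.2) • pd p.1 (pd p.2 a) :=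
    summable_pairs hP (fun i j h => by simp [h]) fun k => (finite_pd_notMem a (k + 1)).subset
      fun j ⟨i, hi⟩ hc => hi (Submodule.smul_mem _ _ (by simpa using pd_mem_fil (i := i) hc))
  refine ⟨?_, hs⟩
  apply val_injective
  funext g m
  show (2 : 𝕜) * (lap hP a).1 g m = _
  rw [← laplacian_val hP, val_tsum hs, laplacian, ← mul_assoc, mul_inv_cancel₀ two_ne_zero, one_mul]
  rfl

/-- The divergence of a Hamiltonian vector field is a multiple of the BV Laplacian of the
Hamiltonian; the factor `2` is the reason for working with half-densities. -/
theorem str_hess [CharZero 𝕜] (H : Completed 𝕜 c d) : str (hess hP H) = -((2 : 𝕜) • lap hP H) := by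
  obtain ⟨h1, h2⟩ := lap_eq_tsum_pairs hP H
  rw [h1, ← (h2.hasSum.prod_fiberwise (g := fun i => ((-1) ^ d i : 𝕜) • pd i (pu hP i H)) fun i => ?_).tsum_eq,
    ← tsum_neg]
  · refine tsum_congr fun i => ?_
    rw [hess, smul_neg]
  · have : ((-1) ^ d i : 𝕜) • pd i (pu hP i H) = ∑ j ∈ (hP.finite i).toFinset,
        ((-1) ^ d i * P i j) • pd i (pd j H) := by
      rw [pu_apply, map_sum, Finset.smul_sum]
      exact Finset.sum_congr rfl fun j _ => by rw [map_smul, smul_smul]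
    rw [this]
    refine hasSum_sum_of_ne_finset_zero fun j hj => ?_
    have : P i j = 0 := by simpa using hj
    simp [this]

end Ham

/-! ### Unipotent maps -/

/-- A map of the form `1 +` terms of positive level, with finitely many terms below each level. -/
structure IsUnip (f : ι → Completed 𝕜 c d) : Prop where
  homog : ∀ i, Homog (d i) (f i)
  mem : ∀ i, f i - crd i ∈ fil 2
  finite : ∀ k, {i | f i - crd i ∉ fil k}.Finite

theorem IsUnip.isMap {f : ι → Completed 𝕜 c d} (hf : IsUnip f) : IsMap f :=
  ⟨hf.homog, fun i => by
    have := add_mem (fil_anti (by norm_num) (hf.mem i)) (crd_mem_fil (𝕜 := 𝕜) (c := c) (d := d) i)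
    rwa [sub_add_cancel] at this⟩

/-- The Jacobian matrix of `f`, minus `1`. -/
def jac (f : ι → Completed 𝕜 c d) (i j : ι) : Completed 𝕜 c d := pd i (f j - crd j)

theorem isMtx_jac {f : ι → Completed 𝕜 c d} (hf : IsUnip f) : IsMtx 1 (jac f) where
  homog i j := ((hf.homog j).sub (homog_crd j)).map_pd i
  mem i j := pd_mem_fil (hf.mem j)
  summable := summable_of_finite fun n =>
    ((hf.finite (n + 1)).biUnion fun l _ =>
      (finite_pd_notMem (f l - crd l) n).prod (Set.finite_singleton l)).subset <| by
    rintro ⟨i, l⟩ h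
    simp only [Set.mem_iUnion]
    refine ⟨l, fun hc => h ?_, fun hc => h hc, rfl⟩
    have := pd_mem_fil (i := i) hc
    rwa [add_sub_cancel_right] at this

theorem jac_val (f : ι → Completed 𝕜 c d) (i j : ι) :
    (jac f i j).1 = jacobianSubOne d (fun i => (f i).1) i j := by
  rw [jac, map_sub, pd_crd, val_sub, pd_val, jacobianSubOne]
  split_ifs <;> rfl

theorem matPow_val {f : ι → Completed 𝕜 c d} (hf : IsUnip f) (k : ℕ) (i j : ι) :
    matPow d (jacobianSubOne d fun i => (f i).1) (k + 1) i j = (mpow (jac f) k i j).1 := by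
  induction k generalizing i j with
  | zero =>
    funext g m
    show ∑ᶠ l : ι, mul d (jacobianSubOne d (fun i => (f i).1) i l) (matPow d _ 0 l j) g m = _
    rw [finsum_eq_single _ j]
    · simp only [matPow, if_true]
      rw [← jac_val, ← val_one (𝕜 := 𝕜) (c := c) (d := d), ← val_mul, mul_one]
      rfl
    · intro l hl
      simp only [matPow, if_neg hl]
      rw [← jac_val, ← val_zero (𝕜 := 𝕜) (c := c) (d := d), ← val_mul, mul_zero]
      rfl
  | succ k ih =>
    funext g m
    have hN := isMtx_jac hf
    rw [matPow, mpow, mm, val_tsum (hN.summable_row (hN.mpow k) i j)]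
    refine finsum_congr fun l => ?_
    rw [ih, ← jac_val]
    rfl

theorem strLogJacobian_val {f : ι → Completed 𝕜 c d} (hf : IsUnip f) :
    strLogJacobian d (fun i => (f i).1) = (strLog (jac f)).1 := by
  have hN := isMtx_jac hf
  funext g m
  rw [strLogJacobian, strLog, val_tsum (hN.summable_str _)]
  refine finsum_congr fun k => ?_
  show _ = _ * (str (mpow (jac f) k)).1 g m
  rw [str, val_tsum (hN.mpow k).summable_diag, supertrace]
  congr 1
  refine finsum_congr fun i => ?_
  rw [matPow_val hf]
  rfl

/-- The square root of the Berezinian. -/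
def ber (f : ι → Completed 𝕜 c d) : Completed 𝕜 c d := expC ((2⁻¹ : 𝕜) • strLog (jac f))

theorem half_strLog_mem {f : ι → Completed 𝕜 c d} (hf : IsUnip f) :
    (2⁻¹ : 𝕜) • strLog (jac f) ∈ fil 1 := Submodule.smul_mem _ _ (strLog_mem_fil (isMtx_jac hf))

theorem homog_half_strLog {f : ι → Completed 𝕜 c d} (hf : IsUnip f) :
    Homog 0 ((2⁻¹ : 𝕜) • strLog (jac f)) := (homog_strLog (isMtx_jac hf)).smul _

theorem ber_val {f : ι → Completed 𝕜 c d} (hf : IsUnip f) :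
    berezinianPow d 2⁻¹ (fun i => (f i).1) = (ber f).1 := by
  rw [berezinianPow, strLogJacobian_val hf, ber, expC_val (half_strLog_mem hf)]
  rfl

/-- The derivation `E - {H, -}`. -/
def flow (hP : IsOddPoisson d P) (H : Completed 𝕜 c d) : Completed 𝕜 c d →ₗ[𝕜] Completed 𝕜 c d :=
  eul - br hP H

section Flow

variable (hP : IsOddPoisson d P) {H : Completed 𝕜 c d} (hH : Homog (-1) H) (hH3 : H ∈ fil 3)

theorem flow_apply (a : Completed 𝕜 c d) : flow hP H a = eul a - br hP H a := rfl

include hH in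
theorem isDer_flow : IsDer (flow hP H) := isDer_eul.sub (isDer_br hP hH)

include hH3 in
theorem flow_mem_fil (k : ℤ) (a : Completed 𝕜 c d) (ha : a ∈ fil k) : flow hP H a ∈ fil k :=
  sub_mem (eul_mem_fil ha) (fil_anti (by omega) (br_mem_fil hP hH3 ha))

include hH in
theorem homog_flow (n : ℤ) (a : Completed 𝕜 c d) (ha : Homog n a) : Homog n (flow hP H a) := by
  refine (ha.map_diag _).sub ?_
  have := hH.map_br hP ha
  rwa [show -1 + n + 1 = n by ring] at this

include hH hH3 in
/-- The variation of the Berezinian of the map generated by `H`. -/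
theorem flow_ber [CharZero 𝕜] {f : ι → Completed 𝕜 c d} (hf : IsUnip f) (h : ∀ i, flow hP H (f i) = f i) :
    flow hP H (ber f) = -(lap hP H * ber f) := by
  have hN := isMtx_jac hf
  have hY : IsMtx 1 (hess hP H) := isMtx_hess hP hH hH3
  have hδ := isDer_flow hP hH
  -- Differentiate `flow hP H (f j) = f j`. The commutator of `pd i` with the Euler operator cancels
  -- the right-hand side, which leaves `flow (∂Φ) = hess · ∂Φ`.
  have key : ∀ i j, flow hP H (jac f i j) = hess hP H i j + mm (hess hP H) (jac f) i j := by
    intro i j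
    have h1 : ∀ i j, pd i (f j) = jac f i j + if i = j then 1 else 0 := fun i j => by
      rw [jac, map_sub, pd_crd, sub_add_cancel]
    have hone : ∀ i j : ι, flow hP H (if i = j then 1 else 0) = 0 := fun i j => by
      split_ifs
      · exact hδ.map_one
      · exact map_zero _
    have h2 : flow hP H (pd i (f j)) = ∑' l, hess hP H i l * pd l (f j) := by
      have h3 := congrArg (pd i) (h j)
      rw [flow_apply, map_sub, pd_br hP hH, pd_eul] at h3
      rw [flow_apply, ← sub_eq_zero]
      rw [← sub_eq_zero] at h3
      rw [← h3]
      abel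
    rw [h1, map_add, hone, add_zero] at h2
    have hs : Summable fun l => hess hP H i l * (if l = j then (1 : Completed 𝕜 c d) else 0) :=
      summable_of_ne_finset_zero (s := {j}) fun l hl => by
        rw [if_neg (by simpa using hl), mul_zero]
    rw [h2, tsum_congr fun l => by rw [h1, mul_add], (hY.summable_row hN i j).tsum_add hs,
      tsum_eq_single (f := fun l => hess hP H i l * (if l = j then (1 : Completed 𝕜 c d) else 0)) j,
      if_pos rfl, mul_one, add_comm]
    · rfl
    · intro l hl
      rw [if_neg hl, mul_zero]
  have := der_strLog hδ (flow_mem_fil hP hH3) (homog_flow hP hH) hN hY key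
  rw [ber, hδ.map_expC (half_strLog_mem hf) (homog_half_strLog hf), map_smul, this, str_hess, smul_neg, smul_smul,
    inv_mul_cancel₀ two_ne_zero, one_smul, neg_mul]

end Flow

end Completed

end Ber

/-! ### The correspondence between unipotent symplectic maps and Hamiltonians -/

section Flow

variable {ι 𝕜 : Type*} [LinearOrder ι] [Field 𝕜]

/-- `W` is the matrix of an odd symplectic form, with inverse matrix `P`. -/
structure IsOddForm (d : ι → ℤ) (P W : ι → ι → 𝕜) : Prop where
  antisymm : ∀ i j, W i j = -W j i
  degree : ∀ i j, W i j ≠ 0 → d i + d j = -1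
  finite : ∀ i, {j | W i j ≠ 0}.Finite
  inverse : ∀ i k, ∑ᶠ j, P i j * W j k = open Classical in if i = k then 1 else 0

namespace Completed

variable {c : ℤ} {d : ι → ℤ} {P W : ι → ι → 𝕜}

/-! ### Completeness -/

theorem exists_limit {u : ℕ → Completed 𝕜 c d} {v : ℤ} (hu : ∀ n : ℕ, u (n + 1) - u n ∈ fil (v + n)) :
    ∃ z, ∀ n : ℕ, z - u n ∈ fil (v + n) := by
  have hs : Summable fun n => u (n + 1) - u n :=
    summable_of_finite fun k => (Set.finite_lt_nat (k - v).toNat).subset fun n hn => by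
      by_contra hc
      refine hn (fil_anti ?_ (hu n))
      simp only [Set.mem_ofPred_eq, not_lt] at hc
      omega
  refine ⟨u 0 + ∑' n, (u (n + 1) - u n), fun n => ?_⟩
  rw [← hs.sum_add_tsum_nat_add n, Finset.sum_range_sub, add_sub_assoc,
    show u 0 + (u n - u 0 + ∑' i, (u (i + n + 1) - u (i + n)) - u n) = ∑' i, (u (i + n + 1) - u (i + n)) by abel]
  exact tsum_mem_fil fun i => fil_anti (by push_cast; omega) (hu (i + n))

theorem homog_of_forall {n : ℤ} {z : Completed 𝕜 c d} (h : ∀ k, ∃ z', Homog n z' ∧ z - z' ∈ fil k) :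
    Homog n z := by
  intro g m hz
  obtain ⟨z', h1, h2⟩ := h (level c g m + 1)
  refine h1 g m ?_
  have := mem_fil'.1 h2 g m (by omega)
  rw [val_sub, Pi.sub_apply, Pi.sub_apply, sub_eq_zero] at this
  rwa [← this]

/-- A contraction of a space of families has a fixed point. -/
theorem exists_fixedPoint {α : Type*} (v e : α → ℤ) (z₀ : α → Completed 𝕜 c d)
    (hz₀ : ∀ a, Homog (e a) (z₀ a)) (T : (α → Completed 𝕜 c d) → α → Completed 𝕜 c d)
    (hT : ∀ z, (∀ a, Homog (e a) (z a) ∧ z a - z₀ a ∈ fil (v a)) →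
      ∀ a, Homog (e a) (T z a) ∧ T z a - z₀ a ∈ fil (v a))
    (hc : ∀ z z', (∀ a, Homog (e a) (z a) ∧ z a - z₀ a ∈ fil (v a)) →
      (∀ a, Homog (e a) (z' a) ∧ z' a - z₀ a ∈ fil (v a)) → ∀ n : ℕ, (∀ a, z a - z' a ∈ fil (v a + n)) →
      ∀ a, T z a - T z' a ∈ fil (v a + n + 1)) :
    ∃ z, (∀ a, Homog (e a) (z a) ∧ z a - z₀ a ∈ fil (v a)) ∧ T z = z := by
  -- Picard iteration from `z₀`: successive iterates agree to one more level at each step, relative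
  -- to the level `v a`, which may depend on the component.
  let u : ℕ → α → Completed 𝕜 c d := fun n => T^[n] z₀
  have hu : ∀ n, u (n + 1) = T (u n) := fun n => Function.iterate_succ_apply' T n z₀
  have hP : ∀ n a, Homog (e a) (u n a) ∧ u n a - z₀ a ∈ fil (v a) := by
    intro n
    induction n with
    | zero => exact fun a => ⟨hz₀ a, by simp [u]⟩
    | succ n ih => rw [hu]; exact hT _ ih
  have hs : ∀ (n : ℕ) a, u (n + 1) a - u n a ∈ fil (v a + n) := by
    intro n
    induction n with
    | zero => exact fun a => by simpa [u] using (hP 1 a).2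
    | succ n ih =>
      intro a
      rw [hu (n + 1), hu n]
      push_cast
      rw [← add_assoc]
      have := hc _ _ (hP (n + 1)) (hP n) n ih a
      rwa [hu n] at this
  choose z hz using fun a => exists_limit (u := fun n => u n a) (fun n => hs n a)
  have hPz : ∀ a, Homog (e a) (z a) ∧ z a - z₀ a ∈ fil (v a) := fun a =>
    ⟨homog_of_forall fun k => ⟨u (k - v a).toNat a, (hP _ a).1, fil_anti (by omega) (hz a _)⟩,
      by simpa [u] using hz a 0⟩
  refine ⟨z, hPz, funext fun a => eq_of_forall_sub_mem_fil fun k => ?_⟩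
  have h1 := hc _ _ hPz (hP (k - v a).toNat) (k - v a).toNat (fun a => hz a _) a
  have h2 := hz a ((k - v a).toNat + 1)
  rw [← hu] at h1
  have := sub_mem h1 (fil_anti (by push_cast; omega) h2)
  rw [sub_sub_sub_cancel_right] at this
  exact fil_anti (by omega) this

/-! ### The polynomial degree -/

/-- Multiplication of each monomial by its polynomial degree. -/
def pdeg : Completed 𝕜 c d →ₗ[𝕜] Completed 𝕜 c d := diag fun _ m => (m.degree : 𝕜)

/-- Division of each monomial by its polynomial degree. -/
def pdegInv : Completed 𝕜 c d →ₗ[𝕜] Completed 𝕜 c d := diag fun _ m => (m.degree : 𝕜)⁻¹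

theorem crd_mul_pd (l : ι) (a : Completed 𝕜 c d) : crd l * pd l a = diag (fun _ m => (m l : 𝕜)) a := by
  refine induction_mon (fun a => crd l * pd l a) (fun a => diag (fun _ m => (m l : 𝕜)) a)
    ((isBounded_pd l).mul_left _) (isBounded_diag _) (fun a b => by rw [map_add, mul_add])
    (fun a b => map_add _ a b) (fun g m x hm => ?_) a
  show crd l * pd l (mon c d g m x) = diag (fun _ m => (m l : 𝕜)) (mon c d g m x)
  rw [diag_mon]
  by_cases h : m l = 0
  · rw [pd_mon_of_eq_zero h, h, mul_zero, Nat.cast_zero, zero_mul, mon_zero]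
  · obtain ⟨m', rfl⟩ : ∃ m', m = m' + Finsupp.single l 1 :=
      ⟨m - Finsupp.single l 1, (tsub_add_cancel_of_le (by simpa [Nat.one_le_iff_ne_zero] using h)).symm⟩
    rw [pd_mon, if_pos hm, crd_mul_mon, ← mul_assoc, ← mul_assoc, koszul_mul_self, one_mul]
    simp

theorem summable_crd_mul_pd (a : Completed 𝕜 c d) : Summable fun l => crd l * pd l a :=
  summable_of_finite fun k => (finite_pd_notMem a (k - 1)).subset fun l hl hc => hl (by
    simpa using mul_mem_fil (crd_mem_fil (𝕜 := 𝕜) (c := c) (d := d) l) hc)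

/-- Euler's identity. -/
theorem tsum_crd_mul_pd (a : Completed 𝕜 c d) : ∑' l, crd l * pd l a = pdeg a := by
  ext g m
  rw [val_tsum (summable_crd_mul_pd a)]
  simp only [crd_mul_pd, pdeg, diag_val]
  rw [finsum_eq_sum_of_support_subset (s := m.support) _ fun l hl => by
      by_contra hc
      have : m l = 0 := by simpa using hc
      simp [this] at hl, ← Finset.sum_mul, Finsupp.degree_apply]
  push_cast
  rfl

/-- Constants have degree `0`, so a function of degree `-1` has no constant terms and `pdegInv`
inverts `pdeg` on it. -/
theorem coeff_zero_of_homog {a : Completed 𝕜 c d} (ha : Homog (-1) a) {g : ℤ} {m : ι →₀ ℕ}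
    (hm : m.degree = 0) : a.1 g m = 0 := by
  by_contra h
  have := ha g m h
  rw [(Finsupp.degree_eq_zero_iff m).1 hm] at this
  simp [monDeg] at this

theorem pdeg_pdegInv [CharZero 𝕜] {a : Completed 𝕜 c d} (ha : Homog (-1) a) : pdeg (pdegInv a) = a := by
  ext g m
  simp only [pdeg, pdegInv, diag_val]
  by_cases h : m.degree = 0
  · simp [coeff_zero_of_homog ha h]
  · rw [← mul_assoc, mul_inv_cancel₀ (by exact_mod_cast h), one_mul]

theorem mem_fil_of_pdeg_add_mem [CharZero 𝕜] {a : Completed 𝕜 c d} {k : ℤ} (h : pdeg a + a ∈ fil k) :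
    a ∈ fil k := by
  intro g m hm
  refine h g m ?_
  simp only [val_add, Pi.add_apply, pdeg, diag_val]
  rw [← add_one_mul]
  exact mul_ne_zero (Nat.cast_add_one_ne_zero _) hm

/-! ### The map generated by a Hamiltonian -/

section Ham

variable (hP : IsOddPoisson d P)

theorem br_crd_crd (i j : ι) : br hP (crd i : Completed 𝕜 c d) (crd j) = P i j • 1 := by
  rw [br_eq_tsum_pairs, tsum_eq_single (i, j)]
  · rw [pd_crd, pd_crd, if_pos rfl, if_pos rfl, map_one, mul_one]
  · rintro ⟨k, l⟩ h
    rw [pd_crd, pd_crd]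
    by_cases h1 : k = i
    · rw [if_neg (fun h2 : l = j => h (by rw [h1, h2])), mul_zero, smul_zero]
    · rw [if_neg h1, map_zero, zero_mul, smul_zero]

/-- The Jacobi identity makes `{H, -}` a derivation of the bracket; the correction appears because
the bracket lowers the level by two. -/
theorem flow_br [CharZero 𝕜] {H : Completed 𝕜 c d} (hH : Homog (-1) H) (a b : Completed 𝕜 c d) :
    flow hP H (br hP a b) = br hP (flow hP H a) b + br hP a (flow hP H b) - (2 : 𝕜) • br hP a b := by
  have := eul_br hP a b
  rw [flow_apply, flow_apply, flow_apply, br_br hP hH, map_sub, br_sub_left, eq_sub_of_add_eq this.symm]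
  abel

/-- A function `H` of degree `-1` generates a unipotent symplectic map. -/
theorem exists_unip_of_ham [CharZero 𝕜] {H : Completed 𝕜 c d} (hH : Homog (-1) H) (hH3 : H ∈ fil 3) :
    ∃ f : ι → Completed 𝕜 c d, IsUnip f ∧ (∀ i, flow hP H (f i) = f i) ∧
      ∀ i j, br hP (f i) (f j) = P i j • 1 := by
  have hbr : ∀ {k : ℤ} {a : Completed 𝕜 c d}, a ∈ fil k → br hP H a ∈ fil (k + 1) := fun ha =>
    fil_anti (by omega) (br_mem_fil hP hH3 ha)
  have hbh : ∀ {n : ℤ} {a : Completed 𝕜 c d}, Homog n a → Homog n (br hP H a) := fun {n a} ha => by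
    have := hH.map_br hP ha
    rwa [show -1 + n + 1 = n by ring] at this
  -- Since `(E - 1) φ^i = 0`, the equation `(E - 1) f = {H, f}` with leading term `φ^i` takes the
  -- form `f = φ^i + (E - 1)⁻¹ {H, f}`. The bracket with `H` raises the level because `H` has level
  -- at least `3`.
  obtain ⟨f, hf, hTf⟩ := exists_fixedPoint (fun _ : ι => 2) d (crd : ι → Completed 𝕜 c d) homog_crd
    (fun z i => crd i + eulInv 1 (br hP H (z i)))
    (fun z hz i => ⟨(homog_crd i).add ((hbh (hz i).1).map_diag _), by
      rw [add_sub_cancel_left]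
      exact eulInv_mem_fil_succ 1 _⟩)
    (fun z z' _ _ n hn i => by
      rw [add_sub_add_left_eq_sub, ← map_sub, ← map_sub]
      exact eulInv_mem_fil (hbr (hn i)))
  have hf1 : ∀ i, f i ∈ fil 1 := fun i => by
    have := add_mem (fil_anti (by norm_num) (hf i).2) (crd_mem_fil (𝕜 := 𝕜) (c := c) (d := d) i)
    rwa [sub_add_cancel] at this
  have hg : ∀ i, f i - crd i = eulInv 1 (br hP H (f i)) := fun i => by
    conv_lhs => rw [← hTf]
    rw [add_sub_cancel_left]
  have hfl : ∀ i, flow hP H (f i) = f i := fun i => by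
    have h1 := eul_eulInv (w := 1) (hbr (hf1 i) : br hP H (f i) ∈ fil (1 + 1))
    rw [← hg, map_sub, eul_crd, Int.cast_one, one_smul] at h1
    rw [flow_apply, ← sub_eq_zero]
    rw [← sub_eq_zero] at h1
    rw [← h1]
    abel
  refine ⟨f, ⟨fun i => (hf i).1, fun i => (hf i).2, fun k => ?_⟩, hfl, fun i j => ?_⟩
  -- `{H, φ^i} = -pu hP i H` has high level for almost all `i`, and the bracket of `H` with `f i -
  -- φ^i` gains one level, so finiteness propagates from level to level.
  · have key : ∀ n : ℕ, {i | f i - crd i ∉ fil (2 + n)}.Finite := by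
      intro n
      induction n with
      | zero =>
        convert Set.finite_empty
        exact Set.eq_empty_of_forall_notMem fun i hi => hi (by simpa using (hf i).2)
      | succ n ih =>
        refine (ih.union (finite_pu_notMem hP H (2 + n + 1))).subset fun i hi => ?_
        by_contra hc
        simp only [Set.mem_union, Set.mem_ofPred_eq, not_or, not_not] at hc
        refine hi ?_
        rw [hg, ← sub_add_cancel (f i) (crd i), map_add, br_crd hP hH]
        push_cast
        rw [← add_assoc]
        exact eulInv_mem_fil (add_mem (hbr hc.1) (neg_mem hc.2))
    exact (key (k - 2).toNat).subset fun i hi hc => hi (fil_anti (by omega) hc)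
  · rw [← sub_eq_zero]
    -- The defect of symplecticity has positive level and is annihilated by the flow derivation,
    -- hence vanishes by uniqueness.
    have h1 : flow hP H (br hP (f i) (f j) - P i j • 1) = 0 := by
      rw [map_sub, map_smul, (isDer_flow hP hH).map_one, flow_br hP hH, hfl, hfl, smul_zero, two_smul]
      abel
    rw [flow_apply, sub_eq_zero] at h1
    refine eq_zero_of_eul (w := 0) ?_ (fun n hn => hbr hn) (by rw [Int.cast_zero, zero_smul, sub_zero, h1])
    have h2 : br hP (f i) (f j) - P i j • 1 = br hP (f i - crd i) (f j) + br hP (crd i) (f j - crd j) := by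
      rw [← br_crd_crd (c := c) hP i j, br_sub_left, map_sub]
      abel
    rw [h2]
    exact add_mem (fil_anti (by norm_num) (br_mem_fil hP (hf i).2 (hf1 j)))
      (fil_anti (by norm_num) (br_mem_fil hP (crd_mem_fil i) (hf j).2))

end Ham

/-! ### The Hamiltonian of a unipotent symplectic map -/

section Poincare

variable (hP : IsOddPoisson d P) (hW : IsOddForm d P W)

/-- The linear function `∑_k W j k φ^k`. -/
def theta (j : ι) : Completed 𝕜 c d := ∑ k ∈ (hW.finite j).toFinset, W j k • crd k

theorem theta_mem_fil (j : ι) : (theta hW j : Completed 𝕜 c d) ∈ fil 1 :=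
  Submodule.sum_mem _ fun k _ => Submodule.smul_mem _ _ (crd_mem_fil k)

theorem homog_theta (j : ι) : Homog (-1 - d j) (theta hW j : Completed 𝕜 c d) :=
  Homog.sum fun k hk => Homog.smul (by
    have := hW.degree j k (by simpa using hk)
    rw [show -1 - d j = d k by omega]
    exact homog_crd k) _

theorem pd_theta (i j : ι) : pd i (theta hW j : Completed 𝕜 c d) = W j i • 1 := by
  rw [theta, map_sum, Finset.sum_eq_single i]
  · rw [map_smul, pd_crd, if_pos rfl]
  · intro k _ hk
    rw [map_smul, pd_crd, if_neg hk.symm, smul_zero]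
  · intro hi
    have : W j i = 0 := by simpa using hi
    rw [this, zero_smul, map_zero]

include hW in
theorem sum_P_W (i k : ι) : open Classical in
    ∑ j ∈ (hP.finite i).toFinset, P i j * W j k = if i = k then 1 else 0 := by
  rw [← hW.inverse i k, finsum_eq_sum_of_support_subset]
  intro j hj
  simpa using left_ne_zero_of_mul hj

theorem pu_theta (i j : ι) : open Classical in
    pu hP i (theta hW j : Completed 𝕜 c d) = -((if i = j then (1 : 𝕜) else 0) • 1) := by
  rw [pu_apply, ← sum_P_W hP hW i j, Finset.sum_smul, ← Finset.sum_neg_distrib]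
  refine Finset.sum_congr rfl fun l _ => ?_
  rw [pd_theta, hW.antisymm, smul_smul, mul_neg, neg_smul]

theorem sum_theta (l : ι) : ∑ j ∈ (hP.finite l).toFinset, P l j • theta hW j = (crd l : Completed 𝕜 c d) := by
  have h : ∀ (j : ι) (s : Finset ι), (hW.finite j).toFinset ⊆ s →
      (theta hW j : Completed 𝕜 c d) = ∑ k ∈ s, W j k • crd k := fun j s hs =>
    Finset.sum_subset hs fun k _ hk => by
      have : W j k = 0 := by simpa using hk
      rw [this, zero_smul]
  set s := (hP.finite l).toFinset.biUnion fun j => (hW.finite j).toFinset with hs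
  rw [Finset.sum_congr rfl fun j hj => by
    rw [h j s (Finset.subset_biUnion_of_mem (fun j => (hW.finite j).toFinset) hj), Finset.smul_sum],
    Finset.sum_comm]
  simp only [smul_smul, ← Finset.sum_smul, sum_P_W hP hW]
  by_cases hl : l ∈ s
  · rw [Finset.sum_eq_single l (fun b _ hb => by rw [if_neg hb.symm, zero_smul]) (fun h => absurd hl h), if_pos rfl,
      one_smul]
  · exfalso
    have := sum_P_W hP hW l l
    rw [if_pos rfl, Finset.sum_eq_zero] at this
    · exact zero_ne_one this
    · intro j hj
      have : l ∉ (hW.finite j).toFinset := fun hc => hl (Finset.mem_biUnion.2 ⟨j, hj, hc⟩)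
      rw [show W j l = 0 by simpa using this, mul_zero]

theorem summable_theta_mul {r : ι → Completed 𝕜 c d} (hr : ∀ k, {j | r j ∉ fil k}.Finite) :
    Summable fun j => theta hW j * r j :=
  summable_of_finite fun k => (hr (k - 1)).subset fun j hj hc => hj (by
    simpa using mul_mem_fil (theta_mem_fil (c := c) hW j) hc)

/-- Euler's identity in the frame dual under `P`: the coordinates are combinations `φ^l = ∑_j P l j
θ_j`, and antisymmetry of `P` gives the sign. -/
theorem tsum_theta_mul_pu (a : Completed 𝕜 c d) : ∑' j, theta hW j * pu hP j a = -pdeg a := by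
  have hs : Summable fun p : ι × ι => P p.1 p.2 • (theta hW p.2 * pd p.1 a) :=
    summable_of_finite fun k =>
      ((finite_pd_notMem a (k - 1)).biUnion fun l _ => (Set.finite_singleton l).prod (hP.finite l)).subset <| by
    rintro ⟨l, j⟩ h
    simp only [Set.mem_iUnion]
    refine ⟨l, fun hc => h (Submodule.smul_mem _ _ ?_), rfl, fun hc => h ?_⟩
    · simpa using mul_mem_fil (theta_mem_fil (c := c) hW j) hc
    · simp only [hc, zero_smul, Submodule.zero_mem]
  have h1 : ∀ l, ∑' j, P l j • (theta hW j * pd l a) = crd l * pd l a := fun l => by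
    rw [tsum_eq_sum (s := (hP.finite l).toFinset) fun j hj => by
      rw [show P l j = 0 by simpa using hj, zero_smul], ← sum_theta hP hW, Finset.sum_mul]
    exact Finset.sum_congr rfl fun j _ => (smul_mul_assoc _ _ _).symm
  have h2 : ∀ j, ∑' l, P l j • (theta hW j * pd l a) = -(theta hW j * pu hP j a) := fun j => by
    rw [tsum_eq_sum (s := (hP.finite j).toFinset) fun l hl => by
      rw [hP.antisymm, show P j l = 0 by simpa using hl, neg_zero, zero_smul], pu_apply, Finset.mul_sum,
      ← Finset.sum_neg_distrib]
    refine Finset.sum_congr rfl fun l _ => ?_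
    rw [hP.antisymm, neg_smul, mul_smul_comm]
  have h3 := tsum_comm_of_summable (f := fun l j => P l j • (theta hW j * pd l a)) hs
  rw [tsum_congr h1, tsum_congr h2, tsum_crd_mul_pd, tsum_neg] at h3
  rw [h3, neg_neg]

theorem finite_br_notMem {f : ι → Completed 𝕜 c d} (hf : ∀ k, {j | f j ∉ fil k}.Finite) (H : Completed 𝕜 c d)
    (k : ℤ) : {j | br hP H (f j) ∉ fil k}.Finite := by
  obtain ⟨l, hl⟩ := H.exists_mem_fil
  exact (hf (k - l + 2)).subset fun j hj hc => hj (fil_anti (by omega) (br_mem_fil hP hl hc))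

theorem br_crd_right {n : ℤ} {a : Completed 𝕜 c d} (ha : Homog n a) (j : ι) : br hP a (crd j) =
    ∑ k ∈ (hP.finite j).toFinset, ((-1) ^ (d k * (n - d k)) * P k j) • pd k a := by
  rw [br_eq_tsum_pairs, tsum_eq_sum (s := (hP.finite j).toFinset ×ˢ {j}), Finset.sum_product]
  · refine Finset.sum_congr rfl fun k _ => ?_
    rw [Finset.sum_singleton, pd_crd, if_pos rfl, mul_one, (ha.map_pd k).rho_eq, smul_smul, mul_comm]
  · rintro ⟨k, l⟩ h
    rw [pd_crd]
    by_cases h1 : l = j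
    · subst h1
      have : P l k = 0 := by simpa using h
      simp only [hP.antisymm k l, this, neg_zero, zero_smul]
    · rw [if_neg h1, mul_zero, smul_zero]

theorem br_crd_left (i : ι) (b : Completed 𝕜 c d) : br hP (crd i) b = pu hP i b := by
  rw [br_eq_tsum_pairs, tsum_eq_sum (s := {i} ×ˢ (hP.finite i).toFinset), Finset.sum_product, Finset.sum_singleton,
    pu_apply]
  · refine Finset.sum_congr rfl fun k _ => ?_
    rw [pd_crd, if_pos rfl, map_one, one_mul]
  · rintro ⟨k, l⟩ h
    rw [pd_crd]
    by_cases h1 : k = i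
    · subst h1
      have : P k l = 0 := by simpa using h
      simp only [this, zero_smul]
    · rw [if_neg h1, map_zero, zero_mul, smul_zero]

include hP hW in
/-- A closed one-form killed by the Poincaré homotopy vanishes to the next order. -/
theorem mem_fil_of_closed [CharZero 𝕜] {r : ι → Completed 𝕜 c d} {n : ℤ} (hr : ∀ j, Homog (d j) (r j))
    (hfin : ∀ k, {j | r j ∉ fil k}.Finite)
    (hcl : ∀ i j, br hP (r i) (crd j) + br hP (crd i) (r j) ∈ fil n) (h0 : ∑' j, theta hW j * r j = 0) (i : ι) :
    r i ∈ fil (n + 1) := by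
  classical
  have hs := summable_theta_mul hW hfin
  -- The Koszul sign of each term in row `j` of `P` depends only on `(i, j)`: it is the sign of the
  -- pair with both degrees shifted by one.
  have hev : ∀ {j k : ι}, P j k ≠ 0 → d k * (d i - d k) = (1 + d j) * (1 + d i) +
      (-(1 + d j) * (d j + 2 * d i + 3) + (1 + d j)) ∧ Even (-(1 + d j) * (d j + 2 * d i + 3) + (1 + d j)) := by
    intro j k h
    have := hP.degree j k h
    have hk : d k = -1 - d j := by omega
    refine ⟨by rw [hk]; ring, ?_⟩
    rw [show -(1 + d j) * (d j + 2 * d i + 3) + (1 + d j) = -((d j) * (d j + 1) + 2 * ((1 + d j) * (1 + d i))) by ring]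
    exact ((Int.even_mul_succ_self _).add (even_two_mul _)).neg
  -- Cartan's formula for the Euler vector field, one summand at a time: differentiate `θ_j r_j` and
  -- use closedness to replace `pu hP i (r j)` by `pu hP j (r i)` up to sign. Summed over `j`, this
  -- yields `pdeg (r i) + r i`.
  have key : ∀ j, pu hP i (theta hW j * r j) + (if i = j then (1 : 𝕜) else 0) • r j +
      theta hW j * -pu hP j (r i) ∈ fil (n + 1) := by
    intro j
    have h1 := hcl i j
    rw [br_crd_right hP (hr i), br_crd_left] at h1
    have h2 := mul_mem_fil (theta_mem_fil (c := c) hW j) h1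
    have e1 : (∑ k ∈ (hP.finite j).toFinset, ((-1) ^ (d k * (d i - d k)) * P k j) • pd k (r i)) =
        ((-1) ^ ((1 + d j) * (1 + d i)) : 𝕜) • -pu hP j (r i) := by
      rw [pu_apply, ← Finset.sum_neg_distrib, Finset.smul_sum]
      refine Finset.sum_congr rfl fun k hk => ?_
      obtain ⟨h3, h4⟩ := hev ((mem_row hP).1 hk)
      rw [h3, zpow_add₀ (by simp), h4.neg_one_zpow, mul_one, hP.antisymm k j, ← neg_smul, smul_smul]
    have e2 : pu hP i (theta hW j * r j) = -((if i = j then (1 : 𝕜) else 0) • r j) +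
        ((-1) ^ ((1 + d j) * (1 + d i)) : 𝕜) • (theta hW j * pu hP i (r j)) := by
      have h5 : pu hP i (theta hW j * r j) = pu hP i (theta hW j) * r j +
          ((-1) ^ ((1 + d j) * (1 + d i)) : 𝕜) • (theta hW j * pu hP i (r j)) := by
        rw [pu_apply, pu_apply, pu_apply, Finset.sum_mul, Finset.mul_sum, Finset.smul_sum, ← Finset.sum_add_distrib]
        refine Finset.sum_congr rfl fun k hk => ?_
        have hk' := hP.degree i k ((mem_row hP).1 hk)
        rw [pd_mul, (homog_theta hW j).rho_eq, show d k * (-1 - d j) = (1 + d j) * (1 + d i) by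
          rw [show d k = -1 - d i by omega]; ring, smul_add, smul_mul_assoc, smul_mul_assoc, mul_smul_comm,
          smul_comm]
      rw [h5, pu_theta hP hW, neg_mul, smul_mul_assoc, one_mul]
    rw [e1, mul_add, mul_smul_comm] at h2
    have h3 := Submodule.smul_mem _ ((-1) ^ ((1 + d j) * (1 + d i)) : 𝕜) h2
    rw [smul_add, smul_smul, neg_one_zpow_mul_self, one_smul, add_comm 1 n] at h3
    rw [e2, neg_add_cancel_comm, add_comm (((-1) ^ _ : 𝕜) • _)]
    exact h3
  have hb := isBounded_pu (c := c) hP i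
  have hs1 : Summable fun j => pu hP i (theta hW j * r j) :=
    IsBounded.summable (L := (pu hP i : Completed 𝕜 c d →ₗ[𝕜] _).toAddMonoidHom) hb hs
  have hs2 : Summable fun j => (if i = j then (1 : 𝕜) else 0) • r j :=
    summable_of_ne_finset_zero (s := {i}) fun j hj => by
      rw [if_neg fun h : i = j => hj (by simp [h]), zero_smul]
  have hs3 : Summable fun j => theta hW j * -pu hP j (r i) :=
    summable_theta_mul hW fun k => (finite_pu_notMem hP (r i) k).subset fun j hj hc => hj (neg_mem hc)
  have h1 : (∑' j, (pu hP i (theta hW j * r j) + (if i = j then (1 : 𝕜) else 0) • r j +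
      theta hW j * -pu hP j (r i))) = r i + pdeg (r i) := by
    rw [(hs1.add hs2).tsum_add hs3, hs1.tsum_add hs2]
    have e1 : ∑' j, pu hP i (theta hW j * r j) = 0 := by
      have := IsBounded.map_tsum (L := (pu hP i : Completed 𝕜 c d →ₗ[𝕜] _).toAddMonoidHom) hb hs
      rw [h0, map_zero] at this
      exact this.symm
    have e2 : ∑' j, (if i = j then (1 : 𝕜) else 0) • r j = r i := by
      rw [tsum_eq_single i fun j hj => by rw [if_neg hj.symm, zero_smul], if_pos rfl, one_smul]
    have e3 : ∑' j, theta hW j * -pu hP j (r i) = pdeg (r i) := by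
      rw [← neg_neg (pdeg (r i)), ← tsum_theta_mul_pu hP hW, ← tsum_neg]
      exact tsum_congr fun j => mul_neg _ _
    rw [e1, e2, e3, zero_add]
  refine mem_fil_of_pdeg_add_mem ?_
  rw [add_comm (pdeg _), ← h1]
  exact tsum_mem_fil key

include hW in
/-- Every unipotent symplectic map is generated by a Hamiltonian. -/
theorem exists_ham_of_unip [CharZero 𝕜] {f : ι → Completed 𝕜 c d} (hf : IsUnip f)
    (hsymp : ∀ i j, br hP (f i) (f j) = P i j • 1) :
    ∃ H : Completed 𝕜 c d, Homog (-1) H ∧ H ∈ fil 3 ∧ ∀ i, flow hP H (f i) = f i := by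
  set g : ι → Completed 𝕜 c d := fun i => f i - crd i with hg
  have hgh : ∀ i, Homog (d i) (g i) := fun i => (hf.homog i).sub (homog_crd i)
  have hbh : ∀ {H : Completed 𝕜 c d}, Homog (-1) H → ∀ {n : ℤ} {a : Completed 𝕜 c d}, Homog n a →
      Homog n (br hP H a) := fun {H} hH {n a} ha => by
    have := hH.map_br hP ha
    rwa [show -1 + n + 1 = n by ring] at this
  set q : ι → Completed 𝕜 c d := fun i => eul (g i) - g i with hq
  have hqf : ∀ k, {j | q j ∉ fil k}.Finite := fun k => (hf.finite k).subset fun j hj hc =>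
    hj (sub_mem (eul_mem_fil hc) hc)
  have hsum : ∀ H, Summable fun j => theta hW j * (q j - br hP H (g j)) := fun H =>
    summable_theta_mul hW fun k => ((hqf k).union (finite_br_notMem hP hf.finite H k)).subset fun j hj => by
      by_contra hc
      simp only [Set.mem_union, Set.mem_ofPred_eq, not_or, not_not] at hc
      exact hj (sub_mem hc.1 hc.2)
  have hRh : ∀ {H}, Homog (-1) H → Homog (-1) (∑' j, theta hW j * (q j - br hP H (g j))) := fun {H} hH =>
    Homog.tsum fun j => by
      have := (homog_theta (c := c) hW j).mul
        (((((hgh j).map_diag fun g m => (level c g m : 𝕜)).sub (hgh j)).sub (hbh hH (hgh j))))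
      rw [sub_add_cancel] at this
      exact this
  -- The flow equation says that the one-form with components `q j - {H, g j} + pu hP j H` vanishes.
  -- Its contraction with the Euler field vanishes exactly when `pdeg H = ∑_j θ_j (q j - {H, g j})`,
  -- and this is solved by iteration, since `g j` has level at least `2`.
  obtain ⟨z, hz, hTz⟩ := exists_fixedPoint (fun _ : Unit => 3) (fun _ => -1) (fun _ => (0 : Completed 𝕜 c d))
    (fun _ => Homog.zero _) (fun z _ => pdegInv (∑' j, theta hW j * (q j - br hP (z ()) (g j))))
    (fun z hz _ => ⟨(hRh (hz ()).1).map_diag _, by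
      rw [sub_zero]
      refine diag_mem_fil (tsum_mem_fil fun j => fil_anti (by norm_num : (3 : ℤ) ≤ 1 + 2)
        (mul_mem_fil (theta_mem_fil hW j) (sub_mem (sub_mem (eul_mem_fil (hf.mem j)) (hf.mem j)) ?_)))
      have := (hz ()).2
      rw [sub_zero] at this
      exact fil_anti (by norm_num) (br_mem_fil hP this (hf.mem j))⟩)
    (fun z z' _ _ n hn _ => by
      rw [← map_sub, ← (hsum _).tsum_sub (hsum _)]
      refine diag_mem_fil (tsum_mem_fil fun j => ?_)
      rw [← mul_sub, sub_sub_sub_cancel_left, ← br_sub_left]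
      have h1 := hn ()
      rw [← neg_mem_iff, neg_sub] at h1
      exact fil_anti (by omega) (mul_mem_fil (theta_mem_fil hW j) (br_mem_fil hP h1 (hf.mem j))))
  set H := z () with hH
  have hH1 : Homog (-1) H := (hz ()).1
  have hH3 : H ∈ fil 3 := by simpa using (hz ()).2
  have hHe : pdeg H = ∑' j, theta hW j * (q j - br hP H (g j)) := by
    conv_lhs => rw [hH, ← hTz]
    exact pdeg_pdegInv (hRh hH1)
  refine ⟨H, hH1, hH3, ?_⟩
  set r : ι → Completed 𝕜 c d := fun j => flow hP H (f j) - f j with hr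
  have hrq : ∀ j, r j = (q j - br hP H (g j)) + pu hP j H := fun j => by
    have : f j = g j + crd j := (sub_add_cancel _ _).symm
    simp only [hr, hq, flow_apply]
    rw [this, map_add, map_add, eul_crd, br_crd hP hH1]
    abel
  have hpus : Summable fun j => theta hW j * pu hP j H :=
    summable_theta_mul hW fun k => finite_pu_notMem hP H k
  have h0 : ∑' j, theta hW j * r j = 0 := by
    rw [tsum_congr fun j => by rw [hrq, mul_add], (hsum H).tsum_add hpus, ← hHe, tsum_theta_mul_pu hP hW]
    exact add_neg_cancel _
  have hrh : ∀ j, Homog (d j) (r j) := fun j => (homog_flow hP hH1 _ _ (hf.homog j)).sub (hf.homog j)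
  have hrf : ∀ k, {j | r j ∉ fil k}.Finite := fun k => by
    refine (((hqf k).union (finite_br_notMem hP hf.finite H k)).union (finite_pu_notMem hP H k)).subset fun j hj => ?_
    by_contra hc
    simp only [Set.mem_union, Set.mem_ofPred_eq, not_or, not_not] at hc
    rw [Set.mem_ofPred_eq, hrq] at hj
    exact hj (add_mem (sub_mem hc.1.1 hc.1.2) hc.2)
  -- Apply the flow derivation to the constant `{f i, f j}`: the one-form `r` is closed in the
  -- coordinates `f`.
  have hcl : ∀ i j, br hP (r i) (f j) + br hP (f i) (r j) = 0 := fun i j => by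
    have h1 := flow_br hP hH1 (f i) (f j)
    rw [hsymp, map_smul, (isDer_flow hP hH1).map_one, smul_zero, ← hsymp] at h1
    simp only [hr]
    rw [br_sub_left, map_sub, h1, two_smul]
    abel
  -- Replacing `f` by the coordinates in the closedness relation costs only terms in `fil n` when
  -- `r` has level `n`. Since the contraction of `r` is zero, `mem_fil_of_closed` then raises the
  -- level by one.
  have key : ∀ n : ℕ, ∀ j, r j ∈ fil n := by
    intro n
    induction n with
    | zero =>
      intro j
      have h1 := flow_mem_fil hP hH3 _ _ (hf.isMap.mem j)
      exact fil_anti (by norm_num) (sub_mem h1 (hf.isMap.mem j))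
    | succ n ih =>
      intro j
      push_cast
      refine mem_fil_of_closed hP hW hrh hrf (fun i j => ?_) h0 j
      have e : br hP (r i) (crd j) + br hP (crd i) (r j) = -(br hP (r i) (g j) + br hP (g i) (r j)) := by
        rw [eq_neg_iff_add_eq_zero, ← hcl i j]
        simp only [hg, map_sub, br_sub_left]
        abel
      rw [e]
      exact neg_mem (add_mem (fil_anti (by omega) (br_mem_fil hP (ih i) (hf.mem j)))
        (fil_anti (by omega) (br_mem_fil hP (hf.mem i) (ih j))))
  intro i
  refine sub_eq_zero.1 (eq_zero_of_forall_mem_fil (a := r i) fun k => ?_)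
  exact fil_anti (by omega : k ≤ (k.toNat : ℤ)) (key _ i)

end Poincare

end Completed

end Flow

/-! ### Transport of half-densities along flows, and exact variations of closed functions -/

section Transport

variable {ι 𝕜 : Type*} [LinearOrder ι] [Field 𝕜]

namespace Completed

variable {c : ℤ} {d : ι → ℤ} {P W : ι → ι → 𝕜}

/-! ### Level components -/

/-- The component of level `w`. -/
def comp (w : ℤ) : Completed 𝕜 c d →ₗ[𝕜] Completed 𝕜 c d := diag fun g m => if level c g m = w then 1 else 0

theorem comp_val (w : ℤ) (a : Completed 𝕜 c d) (g : ℤ) (m : ι →₀ ℕ) :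
    (comp w a).1 g m = if level c g m = w then a.1 g m else 0 := by
  rw [comp, diag_val, ite_mul, one_mul, zero_mul]

theorem comp_mem_fil (w : ℤ) (a : Completed 𝕜 c d) : comp w a ∈ fil w := fun g m h => by
  rw [comp_val] at h
  by_contra hc
  rw [if_neg (by omega)] at h
  exact h rfl

theorem isBounded_comp (w : ℤ) : IsBounded (comp w : Completed 𝕜 c d →ₗ[𝕜] Completed 𝕜 c d) := isBounded_diag _

theorem eul_comp (w : ℤ) (a : Completed 𝕜 c d) : eul (comp w a) = (w : 𝕜) • comp w a := by
  ext g m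
  simp only [eul_val, val_smul, Pi.smul_apply, smul_eq_mul, comp_val]
  split_ifs with h
  · rw [h]
  · simp

theorem comp_of_eul [CharZero 𝕜] {v : ℤ} {z : Completed 𝕜 c d} (h : eul z = (v : 𝕜) • z) (w : ℤ) :
    comp w z = if v = w then z else 0 := by
  have key : ∀ g m, z.1 g m ≠ 0 → level c g m = v := fun g m hz => by
    have h1 := congrFun (congrFun (congrArg val h) g) m
    simp only [eul_val, val_smul, Pi.smul_apply, smul_eq_mul] at h1
    exact_mod_cast mul_right_cancel₀ hz h1
  ext g m
  rw [comp_val]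
  by_cases h0 : z.1 g m = 0
  · split_ifs <;> simp [h0]
  · rw [key g m h0]
    split_ifs <;> rfl

theorem hasSum_comp {a : Completed 𝕜 c d} (ha : a ∈ fil 0) : HasSum (fun w : ℕ => comp w a) a := by
  have hs : Summable fun w : ℕ => comp w a :=
    summable_of_finite fun k => (Set.finite_lt_nat k.toNat).subset fun n hn => by
      by_contra hc
      refine hn (fil_anti ?_ (comp_mem_fil n a))
      simp only [Set.mem_ofPred_eq, not_lt] at hc
      omega
  convert hs.hasSum
  ext g m
  rw [val_tsum hs]
  simp only [comp_val]
  by_cases h0 : a.1 g m = 0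
  · simp [h0]
  · have h1 := ha g m h0
    rw [finsum_eq_single _ (level c g m).toNat fun n hn => if_neg (by omega), if_pos (by omega)]

theorem comp_zero_eq_one [CharZero 𝕜] {a : Completed 𝕜 c d} (ha : a - 1 ∈ fil 1) : comp 0 a = 1 := by
  have h1 : comp 0 (a - 1) = 0 := by
    ext g m
    rw [comp_val]
    split_ifs with h
    · exact mem_fil'.1 ha g m (by omega)
    · rfl
  have h2 : comp 0 (1 : Completed 𝕜 c d) = 1 := by
    rw [comp_of_eul (v := 0) (by rw [eul_one, Int.cast_zero, zero_smul]), if_pos rfl]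
  rw [map_sub, sub_eq_zero, h2] at h1
  exact h1

/-! ### Kinetic terms -/

theorem mem_fil_two_of_quadratic {S : Completed 𝕜 2 d} (hS : ∀ g m, S.1 g m ≠ 0 → g = 0 ∧ m.degree = 2) :
    S ∈ fil 2 := fun g m h => by
  obtain ⟨h1, h2⟩ := hS g m h
  rw [level, h1, h2]
  norm_num

theorem eul_of_quadratic {S : Completed 𝕜 2 d} (hS : ∀ g m, S.1 g m ≠ 0 → g = 0 ∧ m.degree = 2) :
    eul S = (2 : 𝕜) • S := by
  ext g m
  simp only [eul_val, val_smul, Pi.smul_apply, smul_eq_mul]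
  by_cases h : S.1 g m = 0
  · simp [h]
  · obtain ⟨h1, h2⟩ := hS g m h
    rw [level, h1, h2]
    norm_num

/-- `S` is quadratic of degree `0`, and solves the master equation. -/
structure IsKin (hP : IsOddPoisson d P) (S : Completed 𝕜 2 d) : Prop where
  homog : Homog 0 S
  supp : ∀ g m, S.1 g m ≠ 0 → g = 0 ∧ m.degree = 2
  master : IsMaster hP (hb (-1) * S)

section Kin

variable {hP : IsOddPoisson d P} {S : Completed 𝕜 2 d} (hS : IsKin hP S)

include hS

theorem IsKin.mem : S ∈ fil 2 := mem_fil_two_of_quadratic hS.supp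

theorem IsKin.eul : eul S = (2 : 𝕜) • S := eul_of_quadratic hS.supp

theorem IsKin.eul_div : Completed.eul (hb (-1) * S) = 0 := by
  rw [isDer_eul.leibniz, hS.eul, eul_hb, mul_smul_comm, smul_mul_assoc, ← add_smul]
  norm_num

/-- Terms of `S / ħ` have genus `-1` and two variables, so `g + n = 1` although the weight is zero.
This gives `exp (S / ħ)` a meaning in the completion by `g + n`. -/
theorem IsKin.incl_mem : incl (hb (-1) * S) ∈ fil 1 := fun g m h => by
  rw [incl_val, hb_mul_val_apply] at h
  obtain ⟨h1, h2⟩ := hS.supp _ m h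
  rw [level, h2]
  push_cast
  omega

theorem IsKin.tw_mem_fil {z : Completed 𝕜 2 d} {k : ℤ} (hz : z ∈ fil k) : tw hP S z ∈ fil k := by
  refine add_mem ?_ ?_
  · exact fil_anti (by omega) (br_mem_fil hP hS.mem hz)
  · exact fil_anti (by omega) (hb_mul_mem_fil (k := 1) (lap_mem_fil hP hz))

/-- Bracket and Laplacian lower the weight by two; the weight two of `S` and of `ħ` compensates
this. -/
theorem IsKin.tw_eul (z : Completed 𝕜 2 d) : tw hP S (Completed.eul z) = Completed.eul (tw hP S z) := by
  have h1 := eul_br hP S z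
  rw [hS.eul, br_smul_left, add_comm] at h1
  rw [tw_apply, tw_apply, add_right_cancel h1, lap_eul, map_add, isDer_eul.leibniz (hb 1), eul_hb, mul_add,
    mul_smul_comm, smul_mul_assoc]
  push_cast
  abel

theorem IsKin.tw_tw [CharZero 𝕜] (z : Completed 𝕜 2 d) : tw hP S (tw hP S z) = 0 :=
  Completed.tw_tw hP hS.homog hS.master z

theorem IsKin.tw_tsum {α : Type*} {f : α → Completed 𝕜 2 d} (hf : Summable f) :
    tw hP S (∑' x, f x) = ∑' x, tw hP S (f x) :=
  IsBounded.map_tsum (L := (tw hP S).toAddMonoidHom) (isBounded_tw hP S) hf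

theorem IsKin.tw_comp [CharZero 𝕜] {x : Completed 𝕜 2 d} (hx : x ∈ fil 0) (h : tw hP S x = 0) (w : ℕ) :
    tw hP S (comp w x) = 0 := by
  have hsum := hasSum_comp hx
  have h1 : comp w (tw hP S x) = ∑' v : ℕ, comp w (tw hP S (comp v x)) := by
    conv_lhs => rw [← hsum.tsum_eq]
    rw [hS.tw_tsum hsum.summable]
    exact IsBounded.map_tsum (L := (comp w : Completed 𝕜 2 d →ₗ[𝕜] _).toAddMonoidHom) (isBounded_comp _)
      (IsBounded.summable (L := (tw hP S).toAddMonoidHom) (isBounded_tw hP S) hsum.summable)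
  have h2 : ∀ v : ℕ, comp w (tw hP S (comp v x)) = if v = w then tw hP S (comp v x) else 0 := fun v => by
    rw [comp_of_eul (v := v) (by rw [← hS.tw_eul, eul_comp, map_smul])]
    simp only [Nat.cast_inj]
  rw [h, map_zero, tsum_congr h2, tsum_eq_single w fun v hv => if_neg hv, if_pos rfl] at h1
  exact h1.symm

end Kin

/-! ### The operator `-[{S, -} + ħ Δ, K]` -/

section OpL

variable (hP : IsOddPoisson d P) (S : Completed 𝕜 c d)

/-- The negative of the graded commutator of `{S, -} + ħ Δ` with the multiplication by `K`, for `K` of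
degree `-1`. -/
def opL (K : Completed 𝕜 c d) : Completed 𝕜 c d →ₗ[𝕜] Completed 𝕜 c d where
  toFun z := hb 1 * br hP K z - tw hP S K * z
  map_add' a b := by rw [map_add, mul_add, mul_add]; abel
  map_smul' x a := by rw [map_smul, mul_smul_comm, mul_smul_comm, smul_sub]; rfl

theorem opL_apply (K z : Completed 𝕜 c d) : opL hP S K z = hb 1 * br hP K z - tw hP S K * z := rfl

theorem opL_eq {K : Completed 𝕜 c d} (hS : Homog 0 S) (hK : Homog (-1) K) (z : Completed 𝕜 c d) :
    opL hP S K z = -(tw hP S (K * z) + K * tw hP S z) := by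
  rw [tw_mul_add hP hS hK, opL_apply, neg_sub]

theorem opL_sub_left (K K' z : Completed 𝕜 c d) : opL hP S (K - K') z = opL hP S K z - opL hP S K' z := by
  rw [opL_apply, opL_apply, opL_apply, br_sub_left, map_sub, mul_sub, sub_mul]
  abel

variable {S}

theorem Homog.map_opL {K z : Completed 𝕜 c d} {n : ℤ} (hS : Homog 0 S) (hK : Homog (-1) K) (hz : Homog n z) :
    Homog n (opL hP S K z) := by
  have h1 := (hK.map_br hP hz).hb_mul 1
  have h2 := (hS.map_tw hP hK).mul hz
  rw [show -1 + n + 1 = n by ring] at h1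
  rw [neg_add_cancel, zero_add] at h2
  exact h1.sub h2

theorem IsKin.opL_mem_fil {hP : IsOddPoisson d P} {S : Completed 𝕜 2 d} (hS : IsKin hP S) {K z : Completed 𝕜 2 d}
    {k n : ℤ} (hK : K ∈ fil n) (hz : z ∈ fil k) : opL hP S K z ∈ fil (k + n) := by
  refine sub_mem ?_ ?_
  · exact fil_anti (by omega) (hb_mul_mem_fil (k := 1) (br_mem_fil hP hK hz))
  · exact fil_anti (by omega) (mul_mem_fil (hS.tw_mem_fil hK) hz)

end OpL

section Exact

variable {hP : IsOddPoisson d P} {S : Completed 𝕜 2 d} (hS : IsKin hP S)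

theorem summable_eulInv {u : ℕ → Completed 𝕜 2 d} : Summable fun w : ℕ => eulInv (w : ℤ) (u w) :=
  summable_of_finite fun k => (Set.finite_lt_nat k.toNat).subset fun n hn => by
    by_contra hc
    refine hn (fil_anti ?_ (eulInv_mem_fil_succ n _))
    simp only [Set.mem_ofPred_eq, not_lt] at hc
    omega

include hS in
/-- If each level component of a closed function is transported along the flow of `K`, the sum changes by an
exact function. -/
theorem tsum_sub_eq_tw [CharZero 𝕜] {K x : Completed 𝕜 2 d} (hK : Homog (-1) K) (hK1 : K ∈ fil 1)
    (hx : x ∈ fil 0) (hx' : tw hP S x = 0) {u : ℕ → Completed 𝕜 2 d}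
    (hu : ∀ w : ℕ, u w - comp w x ∈ fil (w + 1))
    (h : ∀ w : ℕ, eul (u w) - (w : 𝕜) • u w = opL hP S K (u w)) :
    ∑' w, u w - x = tw hP S (∑' w : ℕ, eulInv (w : ℤ) (-(K * u w))) := by
  have hum : ∀ w : ℕ, u w ∈ fil w := fun w => by
    have := add_mem (fil_anti (by omega) (hu w)) (comp_mem_fil (w : ℤ) x)
    rwa [sub_add_cancel] at this
  -- Since `D² = 0`, `D` commutes with `L_K = -[D, K]`. So `D (u w)` solves the same flow equation,
  -- and its leading part `D (comp w x)` is zero.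
  have h1 : ∀ w : ℕ, tw hP S (u w) = 0 := fun w => by
    refine eq_zero_of_eul (w := w) (z' := opL hP S K (tw hP S (u w))) ?_
      (fun n hn => hS.opL_mem_fil hK1 hn) ?_
    · have := hS.tw_mem_fil (hu w)
      rwa [map_sub, hS.tw_comp hx hx', sub_zero] at this
    · rw [← hS.tw_eul, Int.cast_natCast, ← map_smul, ← map_sub, h, opL_eq hP S hS.homog hK,
        opL_eq hP S hS.homog hK, map_neg, map_add, hS.tw_tw, hS.tw_tw, mul_zero, zero_add, add_zero]
  -- For closed `u w` the right side `L_K (u w)` is `-D (K u w)`. The operator `E - w` annihilates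
  -- `comp w x` and commutes with `D`, so it can be inverted under `D`.
  have h2 : ∀ w : ℕ, u w - comp w x = tw hP S (eulInv (w : ℤ) (-(K * u w))) := fun w => by
    have hm : -(K * u w) ∈ fil ((w : ℤ) + 1) := neg_mem (by
      rw [add_comm]
      exact mul_mem_fil hK1 (hum w))
    refine eq_of_eul (w := w) 0 ?_ ?_ ?_ ?_ |> sub_eq_zero.1
    · exact sub_mem (sub_mem (hu w) (hS.tw_mem_fil (eulInv_mem_fil_succ _ _))) (Submodule.zero_mem _)
    · intro n a _
      exact Submodule.zero_mem _
    · have e1 : eul (comp (w : ℤ) x) = (w : 𝕜) • comp (w : ℤ) x := by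
        rw [eul_comp, Int.cast_natCast]
      have e2 := eul_eulInv hm
      have e3 := h w
      rw [opL_eq hP S hS.homog hK, h1, mul_zero, add_zero, ← map_neg, ← e2, map_sub, hS.tw_eul, map_smul,
        Int.cast_natCast] at e3
      rw [Int.cast_natCast, AddMonoidHom.zero_apply, map_sub, map_sub, e1, smul_sub, smul_sub]
      rw [← sub_eq_zero] at e3
      rw [← e3]
      abel
    · simp
  have hs : Summable u := summable_of_finite fun k => (Set.finite_lt_nat k.toNat).subset fun n hn => by
    by_contra hc
    refine hn (fil_anti ?_ (hum n))
    simp only [Set.mem_ofPred_eq, not_lt] at hc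
    omega
  rw [hS.tw_tsum summable_eulInv, ← tsum_congr h2, hs.tsum_sub (hasSum_comp hx).summable,
    (hasSum_comp hx).tsum_eq]

include hS in
/-- Every exact variation of a closed function is a transport along a flow. -/
theorem exists_flow_of_exact [CharZero 𝕜] {x F : Completed 𝕜 2 d} (hx : x - 1 ∈ fil 1) (hxh : Homog 0 x)
    (hF : Homog (-1) F) (hF1 : F ∈ fil 1) :
    ∃ (K : Completed 𝕜 2 d) (u : ℕ → Completed 𝕜 2 d), Homog (-1) K ∧ K ∈ fil 1 ∧
      (∀ w : ℕ, u w - comp w x ∈ fil (w + 1)) ∧ (∀ w : ℕ, eul (u w) - (w : 𝕜) • u w = opL hP S K (u w)) ∧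
      ∑' w : ℕ, eulInv (w : ℤ) (-(K * u w)) = F := by
  -- The unknowns form one family: `none` stands for `K` and `some w` for `u w`. The level
  -- prescribed for the deviation of `u w` is only `w`: an error of level `1 + n` in `K` affects `u
  -- w` at level `w + n + 1`, so a better prescription would not give a contraction.
  let z₀ : Option ℕ → Completed 𝕜 2 d := fun a => a.elim 0 fun w => comp w x
  let v : Option ℕ → ℤ := fun a => a.elim 1 fun w => w
  let e : Option ℕ → ℤ := fun a => a.elim (-1) fun _ => 0
  let T₁ : (Option ℕ → Completed 𝕜 2 d) → ℕ → Completed 𝕜 2 d := fun z w =>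
    comp w x + eulInv w (opL hP S (z none) (z (some w)))
  -- The equation `∑_w (E - w)⁻¹ (-K u_w) = F`, solved for `E⁻¹ K` by splitting off the leading term
  -- `1` of `u_0`. The updated functions `T₁ z` are used because they agree with `comp w x` to one
  -- level more than the given ones, so `T₁ z 0 - 1` has positive level.
  let R : (Option ℕ → Completed 𝕜 2 d) → Completed 𝕜 2 d := fun z =>
    -F - eulInv 0 (z none * (T₁ z 0 - 1)) - ∑' w : ℕ, eulInv ((w : ℤ) + 1) (z none * T₁ z (w + 1))
  let T : (Option ℕ → Completed 𝕜 2 d) → Option ℕ → Completed 𝕜 2 d := fun z a =>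
    a.elim (eul (R z)) fun w => T₁ z w
  have hcx : ∀ w : ℤ, Homog 0 (comp w x) := fun w => hxh.map_diag _
  have hsum : ∀ z, Summable fun w : ℕ => eulInv ((w : ℤ) + 1) (z none * T₁ z (w + 1)) := fun z =>
    summable_of_finite fun k => (Set.finite_lt_nat k.toNat).subset fun n hn => by
      by_contra hc
      refine hn (fil_anti ?_ (eulInv_mem_fil_succ ((n : ℤ) + 1) _))
      simp only [Set.mem_ofPred_eq, not_lt] at hc
      omega
  have hR1 : ∀ z, R z ∈ fil 1 := fun z =>
    sub_mem (sub_mem (neg_mem hF1) (eulInv_mem_fil_succ 0 _))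
      (tsum_mem_fil fun w => fil_anti (by omega) (eulInv_mem_fil_succ ((w : ℤ) + 1) _))
  have hT1 : ∀ z (w : ℕ), T₁ z w - comp w x ∈ fil (w + 1) := fun z w => by
    show comp w x + _ - comp w x ∈ _
    rw [add_sub_cancel_left]
    exact eulInv_mem_fil_succ _ _
  have hT1w : ∀ z (w : ℕ), T₁ z w ∈ fil w := fun z w => by
    have := add_mem (fil_anti (by omega) (hT1 z w)) (comp_mem_fil (w : ℤ) x)
    rwa [sub_add_cancel] at this
  have hT10 : ∀ z, T₁ z 0 - 1 ∈ fil 1 := fun z => by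
    have := hT1 z 0
    rwa [Nat.cast_zero, comp_zero_eq_one hx, zero_add] at this
  obtain ⟨z, hz, hTz⟩ := exists_fixedPoint v e z₀ (fun a => by
      cases a with
      | none => exact Homog.zero _
      | some w => exact hcx w) T (fun z hz a => by
    have hK : Homog (-1) (z none) := (hz none).1
    have hT1h : ∀ w : ℕ, Homog 0 (T₁ z w) := fun w =>
      (hcx w).add ((Homog.map_opL hP hS.homog hK (hz (some w)).1).map_diag _)
    cases a with
    | none =>
      refine ⟨?_, ?_⟩
      · refine Homog.map_diag ((hF.neg.sub (Homog.map_diag ?_ _)).sub (Homog.tsum fun w => Homog.map_diag ?_ _)) _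
        · exact hK.mul ((hT1h 0).sub Homog.one)
        · exact hK.mul (hT1h (w + 1))
      · show eul (R z) - 0 ∈ fil 1
        rw [sub_zero]
        exact eul_mem_fil (hR1 z)
    | some w => exact ⟨hT1h w, fil_anti (by show (w : ℤ) ≤ _; omega) (hT1 z w)⟩) (fun z z' hz hz' n hn a => by
    have hzK : z none ∈ fil 1 := by
      have := (hz none).2
      exact (by simpa [z₀, v] using this)
    have hzK' : z' none ∈ fil 1 := by
      have := (hz' none).2
      exact (by simpa [z₀, v] using this)
    have hzu : ∀ w : ℕ, z (some w) ∈ fil w := fun w => by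
      have := add_mem (hz (some w)).2 (comp_mem_fil (w : ℤ) x)
      rwa [show z₀ (some w) = comp w x from rfl, sub_add_cancel] at this
    have hKK : z none - z' none ∈ fil (1 + n) := hn none
    have hdiff : ∀ w : ℕ, T₁ z w - T₁ z' w ∈ fil (w + n + 1) := fun w => by
      show comp w x + _ - (comp w x + _) ∈ _
      rw [add_sub_add_left_eq_sub, ← map_sub]
      refine eulInv_mem_fil ?_
      have e : opL hP S (z none) (z (some w)) - opL hP S (z' none) (z' (some w)) =
          opL hP S (z none - z' none) (z (some w)) + opL hP S (z' none) (z (some w) - z' (some w)) := by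
        rw [opL_sub_left, map_sub]
        abel
      rw [e]
      exact add_mem (fil_anti (by omega) (hS.opL_mem_fil hKK (hzu w)))
        (hS.opL_mem_fil hzK' (hn (some w)))
    have hprod : ∀ {a b b' : Completed 𝕜 2 d} {k : ℤ}, (z none - z' none) * b ∈ fil k → z' none * (b - b') ∈ fil k →
        z none * b - z' none * b' ∈ fil k := fun {a b b' k} h1 h2 => by
      have := add_mem h1 h2
      rwa [sub_mul, mul_sub, sub_add_sub_cancel] at this
    cases a with
    | none =>
      show eul (R z) - eul (R z') ∈ fil (1 + n + 1)
      rw [← map_sub]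
      refine eul_mem_fil ?_
      show -F - _ - _ - (-F - _ - _) ∈ _
      have e : ∀ F A B A' B' : Completed 𝕜 2 d, -F - A - B - (-F - A' - B') = (A' - A) + (B' - B) := by
        intros
        abel
      rw [e, ← map_sub, ← (hsum z').tsum_sub (hsum z)]
      -- In `R` the unknown `K` is always multiplied by `u_0 - 1` or by some `u_{w+1}`, all of
      -- positive level; this makes the equation for `K` contracting.
      refine add_mem (eulInv_mem_fil ?_) (tsum_mem_fil fun w => ?_)
      · rw [← neg_mem_iff, neg_sub]
        refine hprod (a := 0) (fil_anti (by omega) (mul_mem_fil hKK (hT10 z))) ?_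
        rw [sub_sub_sub_cancel_right]
        have := mul_mem_fil hzK' (hdiff 0)
        exact fil_anti (by push_cast; omega) this
      · rw [← map_sub]
        refine eulInv_mem_fil ?_
        rw [← neg_mem_iff, neg_sub]
        refine hprod (a := 0) (fil_anti ?_ (mul_mem_fil hKK (hT1w z (w + 1)))) (fil_anti ?_
          (mul_mem_fil hzK' (hdiff (w + 1))))
        · push_cast; omega
        · push_cast; omega
    | some w => exact hdiff w)
  have hu : ∀ w : ℕ, T₁ z w = z (some w) := fun w => congrFun hTz (some w)
  have hK : eul (R z) = z none := congrFun hTz none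
  have hzu : ∀ w : ℕ, z (some w) ∈ fil w := fun w => by
    rw [← hu]
    exact hT1w z w
  have hK1 : z none ∈ fil 1 := by
    rw [← hK]
    exact eul_mem_fil (hR1 z)
  refine ⟨z none, fun w => z (some w), (hz none).1, hK1, fun w => ?_, fun w => ?_, ?_⟩
  · show z (some w) - _ ∈ _
    rw [← hu]
    exact hT1 z w
  · have h1 : z (some w) = comp w x + eulInv w (opL hP S (z none) (z (some w))) := (hu w).symm
    have h2 := eul_eulInv (hS.opL_mem_fil hK1 (hzu w))
    have h3 : (w : 𝕜) = ((w : ℤ) : 𝕜) := (Int.cast_natCast w).symm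
    have h4 : eulInv (w : ℤ) (opL hP S (z none) (z (some w))) = z (some w) - comp w x := by
      conv_rhs => rw [h1]
      rw [add_sub_cancel_left]
    rw [h4, map_sub, eul_comp] at h2
    rw [h3, ← h2, smul_sub]
    abel
  · have h1 : eulInv 0 (z none) = R z := by
      have h2 := eulInv_eul (w := 0) (hR1 z)
      rwa [Int.cast_zero, zero_smul, sub_zero, hK] at h2
    have h2 : R z = -F - eulInv 0 (z none * (z (some 0) - 1)) -
        ∑' w : ℕ, eulInv ((w : ℤ) + 1) (z none * z (some (w + 1))) := by
      show -F - eulInv 0 (z none * (T₁ z 0 - 1)) - ∑' w : ℕ, eulInv ((w : ℤ) + 1) (z none * T₁ z (w + 1)) = _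
      simp only [hu]
    rw [summable_eulInv.tsum_eq_zero_add]
    simp only [map_neg, tsum_neg, Nat.cast_zero, Nat.cast_add, Nat.cast_one]
    rw [mul_sub, mul_one, map_sub, h1] at h2
    rw [← sub_eq_zero] at h2 ⊢
    rw [← neg_eq_zero, ← h2]
    abel

end Exact

/-! ### Transport of half-densities -/

section Half

variable {hP : IsOddPoisson d P} [CharZero 𝕜] {S : Completed 𝕜 2 d} (hS : IsKin hP S)
  {f : ι → Completed 𝕜 2 d} (hf : IsUnip f)

/-- The variation of `S / ħ` under the pullback. -/
def varS (S : Completed 𝕜 2 d) (hf : IsUnip f) : Completed 𝕜 2 d := pull hf.isMap (hb (-1) * S) - hb (-1) * S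

/-- The pullback of the half-density with coefficient `exp (S / ħ) y`, divided by `exp (S / ħ)`. -/
def transport (S : Completed 𝕜 2 d) (hf : IsUnip f) (y : Completed 𝕜 2 d) : Completed 𝕜 2 d :=
  ber f * (expC (varS S hf) * pull hf.isMap y)

include hS in
-- The pullback changes a function only at higher level. So although `exp (S / ħ)` is not available
-- in the completion by weight, the exponential of its variation is.
theorem varS_mem_fil : varS S hf ∈ fil 1 := by
  have h : hb (-1) * S ∈ fil 0 := by simpa using hb_mul_mem_fil (k := -1) hS.mem
  have := pull_sub_self_mem hf.isMap hf.mem h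
  rwa [zero_add] at this

include hS in
theorem homog_varS : Homog 0 (varS S hf) :=
  (homog_pull hf.isMap (hS.homog.hb_mul (-1))).sub (hS.homog.hb_mul (-1))

include hf in
theorem homog_ber : Homog 0 (ber f) := homog_expC (homog_half_strLog hf)

include hS in
theorem transport_sub_self_mem {k : ℤ} {y : Completed 𝕜 2 d} (hy : y ∈ fil k) :
    transport S hf y - y ∈ fil (k + 1) := by
  have hb1 : ber f - 1 ∈ fil 1 := expC_sub_one_mem (half_strLog_mem hf)
  have hv1 : expC (varS S hf) - 1 ∈ fil 1 := expC_sub_one_mem (varS_mem_fil hS hf)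
  have hp := pull_mem_fil hf.isMap hy
  have e : transport S hf y - y = (ber f - 1) * (expC (varS S hf) * pull hf.isMap y) +
      (expC (varS S hf) - 1) * pull hf.isMap y + (pull hf.isMap y - y) := by
    rw [transport]
    noncomm_ring
  rw [e]
  refine add_mem (add_mem ?_ ?_) (pull_sub_self_mem hf.isMap hf.mem hy)
  · exact fil_anti (by omega) (mul_mem_fil hb1 (mul_mem_fil (mem_fil_zero_of_sub_one hv1) hp))
  · exact fil_anti (by omega) (mul_mem_fil hv1 hp)

include hS in
theorem hasSum_transport {α : Type*} {y : α → Completed 𝕜 2 d} {x : Completed 𝕜 2 d} (h : HasSum y x) :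
    HasSum (fun a => transport S hf (y a)) (transport S hf x) := by
  let L : Completed 𝕜 2 d →+ Completed 𝕜 2 d :=
    (mulL (ber f)).comp ((mulL (expC (varS S hf))).comp (pull hf.isMap : Completed 𝕜 2 d →ₐ[𝕜] _).toRingHom.toAddMonoidHom)
  have hL : IsBounded L :=
    (isBounded_mulL (ber f)).comp ((isBounded_mulL (expC (varS S hf))).comp (isBounded_pull hf.isMap))
  exact IsBounded.hasSum (L := L) hL h

include hS in
/-- The variation of a transported half-density along the flow. -/
theorem eul_transport {H : Completed 𝕜 2 d} (hH : Homog (-1) H) (hH3 : H ∈ fil 3)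
    (h : ∀ i, flow hP H (f i) = f i) (y : Completed 𝕜 2 d) :
    eul (transport S hf y) = transport S hf (eul y) + opL hP S (hb (-1) * H) (transport S hf y) := by
  have hδ := isDer_flow hP hH
  set s := hb (-1) * S with hs
  have hfl : ∀ y, flow hP H (pull hf.isMap y) = pull hf.isMap (eul y) := der_pull hf.isMap hδ h fun k => by
    have h1 : br hP H (hb k) = 0 := by
      rw [← mul_one (hb k), br_hb_right, (isDer_br hP hH).map_one, mul_zero]
    rw [flow_apply, h1, sub_zero, eul_hb]
  -- `S / ħ` has weight zero, so the Euler operator annihilates it, and the flow derivation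
  -- annihilates its pullback.
  have h1 : flow hP H (varS S hf) = br hP H s := by
    rw [varS, map_sub, hfl, ← hs, hS.eul_div, map_zero, flow_apply, hS.eul_div]
    abel
  -- The product rule over the three factors: the Berezinian contributes `-Δ H`, the exponential
  -- `{H, s}`, and the pullback `eul y`.
  have h2 : flow hP H (transport S hf y) = transport S hf (eul y) + (br hP H s - lap hP H) * transport S hf y := by
    have hs0 : Homog 0 (br hP H s) := by
      have := hH.map_br hP (hS.homog.hb_mul (-1))
      rwa [show (-1 : ℤ) + 0 + 1 = 0 by norm_num] at this
    rw [transport, transport, hδ.leibniz, hδ.leibniz, flow_ber hP hH hH3 hf h,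
      hδ.map_expC (varS_mem_fil hS hf) (homog_varS hS hf), h1, hfl, sub_mul, mul_add, ← mul_assoc (br hP H s) (ber f),
      (homog_ber hf).commute (br hP H s) |>.eq.symm]
    noncomm_ring
  -- The zeroth order part of `L_K` for `K = H / ħ` is `-D K = {H, s} - Δ H`, exactly the factor
  -- produced by the half-density.
  have h3 : opL hP S (hb (-1) * H) (transport S hf y) = br hP H (transport S hf y) +
      (br hP H s - lap hP H) * transport S hf y := by
    have h4 : tw hP S (hb (-1) * H) = lap hP H - br hP H s := by
      rw [tw_hb, tw_apply, mul_add, hb_mul_cancel, hs, br_hb_right, br_comm hP hS.homog hH, mul_neg]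
      abel
    rw [opL_apply, br_hb_left, hb_mul_cancel', h4, sub_mul, sub_mul]
    abel
  rw [flow_apply, sub_eq_iff_eq_add] at h2
  rw [h2, h3]
  abel

include hS in
/-- A transported closed function differs from the function by an exact one. -/
theorem exists_exact_of_transport {H : Completed 𝕜 2 d} (hH : Homog (-1) H) (hH3 : H ∈ fil 3)
    (h : ∀ i, flow hP H (f i) = f i) {x : Completed 𝕜 2 d} (hx : x ∈ fil 0) (hx' : tw hP S x = 0) :
    ∃ Q ∈ fil 1, transport S hf x - x = tw hP S Q := by
  have hK1 : hb (-1) * H ∈ fil 1 := by simpa using hb_mul_mem_fil (k := -1) hH3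
  have := tsum_sub_eq_tw hS (hH.hb_mul (-1)) hK1 hx hx' (u := fun w => transport S hf (comp w x))
    (fun w => transport_sub_self_mem hS hf (comp_mem_fil _ _)) fun w => by
      rw [eul_transport hS hf hH hH3 h, eul_comp, Int.cast_natCast]
      have : transport S hf ((w : 𝕜) • comp w x) = (w : 𝕜) • transport S hf (comp w x) := by
        rw [transport, transport, map_smul, mul_smul_comm, mul_smul_comm]
      rw [this, add_sub_cancel_left]
  rw [(hasSum_transport hS hf (hasSum_comp hx)).tsum_eq] at this
  exact ⟨_, tsum_mem_fil fun w => fil_anti (by omega) (eulInv_mem_fil_succ _ _), this⟩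

include hS in
/-- An exact variation of a closed function is a transport. -/
theorem exists_transport_of_exact {x F : Completed 𝕜 2 d} (hx : x - 1 ∈ fil 1) (hxh : Homog 0 x)
    (hx' : tw hP S x = 0) (hF : Homog (-1) F) (hF1 : F ∈ fil 1) :
    ∃ (f : ι → Completed 𝕜 2 d) (hf : IsUnip f), (∀ i j, br hP (f i) (f j) = P i j • 1) ∧
      transport S hf x - x = tw hP S F := by
  obtain ⟨K, u, hK, hK1, hu, hue, huF⟩ := exists_flow_of_exact hS hx hxh hF hF1
  have hH3 : hb 1 * K ∈ fil 3 := hb_mul_mem_fil (k := 1) hK1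
  obtain ⟨f, hf, hfl, hsymp⟩ := exists_unip_of_ham hP (hK.hb_mul 1) hH3
  refine ⟨f, hf, hsymp, ?_⟩
  have hx0 := mem_fil_zero_of_sub_one hx
  -- Both functions solve `(E - w) u = L_K u` with leading part `comp w x`.
  have hut : ∀ w : ℕ, transport S hf (comp w x) = u w := fun w => by
    refine eq_of_eul (w := w) (opL hP S K).toAddMonoidHom ?_ (fun n a ha => hS.opL_mem_fil hK1 ha) ?_ ?_
    · have := sub_mem (transport_sub_self_mem hS hf (comp_mem_fil (w : ℤ) x)) (hu w)
      rwa [sub_sub_sub_cancel_right] at this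
    · rw [eul_transport hS hf (hK.hb_mul 1) hH3 hfl, eul_comp, Int.cast_natCast, hb_mul_cancel]
      have : transport S hf ((w : 𝕜) • comp w x) = (w : 𝕜) • transport S hf (comp w x) := by
        rw [transport, transport, map_smul, mul_smul_comm, mul_smul_comm]
      rw [this, add_sub_cancel_left]
      rfl
    · rw [Int.cast_natCast, hue]
      rfl
  rw [← huF, ← tsum_sub_eq_tw hS hK hK1 hx0 hx' hu hue, ← (hasSum_transport hS hf (hasSum_comp hx0)).tsum_eq,
    tsum_congr hut]

include hS in
theorem exp_kin_add {b : Completed 𝕜 2 d} (hb1 : b ∈ fil 1) (hb0 : Homog 0 b) :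
    exp d ((hb (-1) * S).1 + b.1) = (expC (incl (hb (-1) * S)) * incl (expC b)).1 := by
  have h1 := hS.incl_mem
  have h2 := incl_mem_fil hb1
  rw [incl_expC hb1, ← expC_add h1 h2 (hS.homog.hb_mul (-1)) hb0, expC_val (add_mem h1 h2)]
  rfl

include hS in
-- The pullback of `exp (S / ħ)` is `exp (S / ħ)` times the exponential of the variation; all
-- remaining factors exist in the completion by weight and form `transport`.
theorem pullbackHalfDensity_exp {b : Completed 𝕜 2 d} (hb1 : b ∈ fil 1) (hb0 : Homog 0 b) :
    pullbackHalfDensity d (fun i => (f i).1) (exp d ((hb (-1) * S).1 + b.1)) =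
      (expC (incl (hb (-1) * S)) * incl (transport S hf (expC b))).1 := by
  have h1 := hS.incl_mem
  have h2 := varS_mem_fil hS hf
  have h3 : pull hf.isMap.incl (incl (hb (-1) * S)) = incl (hb (-1) * S) + incl (varS S hf) := by
    rw [← incl_pull hf.isMap, varS, map_sub incl (pull hf.isMap _)]
    abel
  have h4 : pull hf.isMap.incl (expC (incl (hb (-1) * S))) =
      expC (incl (hb (-1) * S)) * incl (expC (varS S hf)) := by
    rw [pull_expC hf.isMap.incl h1, h3, incl_expC h2,
      expC_add h1 (incl_mem_fil h2) (hS.homog.hb_mul (-1)) (homog_varS hS hf)]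
  have h5 : (pull hf.isMap.incl (expC (incl (hb (-1) * S)) * incl (expC b)) * incl (ber f)) =
      expC (incl (hb (-1) * S)) * incl (transport S hf (expC b)) := by
    rw [map_mul (pull hf.isMap.incl), h4, ← incl_pull hf.isMap, transport, map_mul incl (ber f), map_mul incl (expC _), mul_assoc,
      mul_assoc, ← mul_assoc (incl (expC (varS S hf))),
      (show Homog 0 (incl (ber f)) from homog_ber hf).commute (incl (expC (varS S hf)) * _) |>.eq.symm]
  rw [exp_kin_add hS hb1 hb0, ← h5, pullbackHalfDensity, ber_val hf]
  exact congrArg (fun F => mul d F (ber f).1) (pull_val hf.isMap.incl _).symm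

include hS in
-- In the completion by `g + n` the factor `exp (S / ħ)` is invertible and can be cancelled;
-- injectivity of `incl` brings the equation back to the completion by weight.
theorem exp_eq_pullback_iff {b b' : Completed 𝕜 2 d} (hb1 : b ∈ fil 1) (hb0 : Homog 0 b) (hb1' : b' ∈ fil 1)
    (hb0' : Homog 0 b') :
    exp d ((hb (-1) * S).1 + b.1) =
        pullbackHalfDensity d (fun i => (f i).1) (exp d ((hb (-1) * S).1 + b'.1)) ↔
      expC b = transport S hf (expC b') := by
  rw [exp_kin_add hS hb1 hb0, pullbackHalfDensity_exp hS hf hb1' hb0']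
  refine ⟨fun h => incl_injective ?_, fun h => by rw [h]⟩
  have h1 := val_injective h
  have h2 : expC (-incl (hb (-1) * S)) * expC (incl (hb (-1) * S)) = 1 := by
    have := expC_mul_expC_neg (neg_mem hS.incl_mem) (Homog.neg (hS.homog.hb_mul (-1)))
    rwa [neg_neg] at this
  have h3 := congrArg (fun z => expC (-incl (hb (-1) * S)) * z) h1
  simpa only [← mul_assoc, h2, one_mul] using h3

end Half

end Completed

end Transport

/-! ### Smooth families over the interval, exponentials of forms, and degree components -/

section Families

variable {ι 𝕜 : Type*} [LinearOrder ι] [RCLike 𝕜]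

namespace Completed

variable {c : ℤ} {d : ι → ℤ} {P : ι → ι → 𝕜}

/-! ### Smooth families -/

/-- A family on `[0, 1]` with smooth coefficients, involving finitely many monomials below each level. -/
structure IsSmooth (F : ℝ → Completed 𝕜 c d) : Prop where
  smooth : ∀ g m, ContDiffOn ℝ (⊤ : ℕ∞) (fun t => (F t).1 g m) (Set.Icc 0 1)
  finite : ∀ k, {p : ℤ × (ι →₀ ℕ) | level c p.1 p.2 < k ∧ ∃ t ∈ Set.Icc (0 : ℝ) 1, (F t).1 p.1 p.2 ≠ 0}.Finite

section

variable {F G : ℝ → Completed 𝕜 c d}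

theorem IsSmooth.exists_mem_fil (hF : IsSmooth F) : ∃ k, ∀ t ∈ Set.Icc (0 : ℝ) 1, F t ∈ fil k := by
  obtain ⟨b, hb⟩ := ((hF.finite 0).image fun p => level c p.1 p.2).bddBelow
  refine ⟨min b 0, fun t ht g m h => ?_⟩
  by_cases h0 : level c g m < 0
  · exact (min_le_left _ _).trans (hb ⟨(g, m), ⟨h0, t, ht, h⟩, rfl⟩)
  · exact (min_le_right _ _).trans (not_lt.1 h0)

/-- The monomials of a family below a level. -/
def IsSmooth.supp (hF : IsSmooth F) (k : ℤ) : Finset (ℤ × (ι →₀ ℕ)) := (hF.finite k).toFinset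

theorem sub_sum_mon_mem_fil {H : Completed 𝕜 c d} {k : ℤ} {s : Finset (ℤ × (ι →₀ ℕ))}
    (h : ∀ p : ℤ × (ι →₀ ℕ), level c p.1 p.2 < k → H.1 p.1 p.2 ≠ 0 → p ∈ s) :
    H - ∑ p ∈ s, H.1 p.1 p.2 • mon c d p.1 p.2 1 ∈ fil k := by
  classical
  rw [mem_fil']
  intro g m hg
  rw [val_sub, Pi.sub_apply, Pi.sub_apply, val_sum]
  simp only [val_smul, Pi.smul_apply, smul_eq_mul, mon_val]
  by_cases h0 : H.1 g m = 0
  · rw [h0, Finset.sum_eq_zero, sub_zero]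
    intro p _
    split_ifs with hp
    · rw [← hp.2.1, ← hp.2.2, h0, zero_mul]
    · rw [mul_zero]
  · rw [Finset.sum_eq_single (g, m), if_pos ⟨H.2 g m h0, rfl, rfl⟩, mul_one, sub_self]
    · intro p _ hp
      rw [if_neg fun hc => hp (Prod.ext hc.2.1.symm hc.2.2.symm), mul_zero]
    · exact fun hc => absurd (h (g, m) hg h0) hc

theorem IsSmooth.sub_sum_mem_fil (hF : IsSmooth F) (k : ℤ) {t : ℝ} (ht : t ∈ Set.Icc (0 : ℝ) 1) :
    F t - ∑ p ∈ hF.supp k, (F t).1 p.1 p.2 • mon c d p.1 p.2 1 ∈ fil k :=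
  sub_sum_mon_mem_fil fun _ h h0 => (hF.finite k).mem_toFinset.2 ⟨h, t, ht, h0⟩

/-- The coefficients of a bounded linear map on functions supported on the monomials of a family. -/
theorem IsSmooth.map_val (hF : IsSmooth F) {L : Completed 𝕜 c d →ₗ[𝕜] Completed 𝕜 c d} (hL : IsBounded L)
    (g : ℤ) (m : ι →₀ ℕ) : ∃ (s : Finset (ℤ × (ι →₀ ℕ))) (y : ℤ × (ι →₀ ℕ) → 𝕜), ∀ H : Completed 𝕜 c d,
      (∀ p : ℤ × (ι →₀ ℕ), (∀ t ∈ Set.Icc (0 : ℝ) 1, (F t).1 p.1 p.2 = 0) → H.1 p.1 p.2 = 0) →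
      (L H).1 g m = ∑ p ∈ s, H.1 p.1 p.2 * y p := by
  obtain ⟨l, hl⟩ := hL (level c g m + 1)
  refine ⟨hF.supp l, fun p => (L (mon c d p.1 p.2 1)).1 g m, fun H hH => ?_⟩
  have h1 : H - ∑ p ∈ hF.supp l, H.1 p.1 p.2 • mon c d p.1 p.2 1 ∈ fil l :=
    sub_sum_mon_mem_fil fun p h h0 => (hF.finite l).mem_toFinset.2 ⟨h, by
      by_contra hn
      push Not at hn
      exact h0 (hH p hn)⟩
  have h2 := mem_fil'.1 (hl _ h1) g m (by omega)
  rw [map_sub, map_sum, val_sub, Pi.sub_apply, Pi.sub_apply, val_sum, sub_eq_zero] at h2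
  rw [h2]
  refine Finset.sum_congr rfl fun p _ => ?_
  rw [map_smul]
  rfl

theorem IsSmooth.const (a : Completed 𝕜 c d) : IsSmooth fun _ => a where
  smooth _ _ := contDiffOn_const
  finite k := (a.levelFinite k).subset fun _ hp => ⟨hp.1.le, hp.2.choose_spec.2⟩

theorem IsSmooth.add (hF : IsSmooth F) (hG : IsSmooth G) : IsSmooth fun t => F t + G t where
  smooth g m := (hF.smooth g m).add (hG.smooth g m)
  finite k := ((hF.finite k).union (hG.finite k)).subset fun p ⟨h, t, ht, h1⟩ => by
    by_contra hc
    simp only [Set.mem_union, Set.mem_ofPred_eq, not_or, not_and, not_exists, not_not] at hc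
    refine h1 ?_
    rw [val_add, Pi.add_apply, Pi.add_apply, hc.1 h t ht, hc.2 h t ht, add_zero]

theorem IsSmooth.smul (hF : IsSmooth F) {x : ℝ → 𝕜} (hx : ContDiffOn ℝ (⊤ : ℕ∞) x (Set.Icc 0 1)) :
    IsSmooth fun t => x t • F t where
  smooth g m := hx.mul (hF.smooth g m)
  finite k := (hF.finite k).subset fun _ ⟨h, t, ht, h1⟩ => ⟨h, t, ht, right_ne_zero_of_mul h1⟩

theorem IsSmooth.sum {α : Type*} {s : Finset α} {F : α → ℝ → Completed 𝕜 c d} (h : ∀ a ∈ s, IsSmooth (F a)) :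
    IsSmooth fun t => ∑ a ∈ s, F a t := by
  classical
  induction s using Finset.induction_on with
  | empty => simpa using IsSmooth.const 0
  | insert a s ha ih =>
    simp only [Finset.sum_insert ha]
    exact (h a (Finset.mem_insert_self _ _)).add (ih fun b hb => h b (Finset.mem_insert_of_mem hb))

/-- A family which is approximated by smooth families is smooth. -/
theorem IsSmooth.of_approx (h : ∀ k, ∃ G : ℝ → Completed 𝕜 c d, IsSmooth G ∧
    ∀ t ∈ Set.Icc (0 : ℝ) 1, F t - G t ∈ fil k) : IsSmooth F := by
  have key : ∀ k, ∃ G : ℝ → Completed 𝕜 c d, IsSmooth G ∧ ∀ t ∈ Set.Icc (0 : ℝ) 1, ∀ g m, level c g m < k →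
      (F t).1 g m = (G t).1 g m := fun k => by
    obtain ⟨G, hG, hFG⟩ := h k
    refine ⟨G, hG, fun t ht g m hg => ?_⟩
    have := mem_fil'.1 (hFG t ht) g m hg
    rwa [val_sub, Pi.sub_apply, Pi.sub_apply, sub_eq_zero] at this
  refine ⟨fun g m => ?_, fun k => ?_⟩
  · obtain ⟨G, hG, hFG⟩ := key (level c g m + 1)
    exact (hG.smooth g m).congr fun t ht => hFG t ht g m (by omega)
  · obtain ⟨G, hG, hFG⟩ := key k
    exact (hG.finite k).subset fun p ⟨hp, t, ht, h1⟩ => ⟨hp, t, ht, by rwa [← hFG t ht _ _ hp]⟩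

theorem IsSmooth.mul (hF : IsSmooth F) (hG : IsSmooth G) : IsSmooth fun t => F t * G t := by
  obtain ⟨a, ha⟩ := hF.exists_mem_fil
  obtain ⟨b, hb⟩ := hG.exists_mem_fil
  refine IsSmooth.of_approx fun k => ?_
  have hF1 : ∀ t ∈ Set.Icc (0 : ℝ) 1, _ := fun t ht => hF.sub_sum_mem_fil (k - b) ht
  -- The truncation level is at least `b` so that the truncation of `G` stays in `fil b`.
  have hG1 : ∀ t ∈ Set.Icc (0 : ℝ) 1, _ := fun t ht =>
    hG.sub_sum_mem_fil (max b (k - a)) ht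
  refine ⟨fun t => (∑ p ∈ hF.supp (k - b), (F t).1 p.1 p.2 • mon c d p.1 p.2 1) *
    ∑ q ∈ hG.supp (max b (k - a)), (G t).1 q.1 q.2 • mon c d q.1 q.2 1, ?_, fun t ht => ?_⟩
  · simp only [Finset.sum_mul_sum, smul_mul_smul_comm]
    exact IsSmooth.sum fun p _ => IsSmooth.sum fun q _ =>
      (IsSmooth.const _).smul ((hF.smooth p.1 p.2).mul (hG.smooth q.1 q.2))
  · have e : ∀ x y x' y' : Completed 𝕜 c d, x * y - x' * y' = (x - x') * y' + x * (y - y') := by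
      intros
      noncomm_ring
    have hb' : ∑ q ∈ hG.supp (max b (k - a)), (G t).1 q.1 q.2 • mon c d q.1 q.2 (1 : 𝕜) ∈ fil b := by
      have := sub_mem (hb t ht) (fil_anti (le_max_left _ _) (hG1 t ht))
      rwa [sub_sub_cancel] at this
    rw [e]
    refine add_mem ?_ ?_
    · simpa using mul_mem_fil (hF1 t ht) hb'
    · have := mul_mem_fil (ha t ht) (fil_anti (le_max_right _ _) (hG1 t ht))
      rwa [add_sub_cancel] at this

theorem IsSmooth.pow (hF : IsSmooth F) (n : ℕ) : IsSmooth fun t => F t ^ n := by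
  induction n with
  | zero => simpa using IsSmooth.const 1
  | succ n ih => simpa only [pow_succ] using ih.mul hF

theorem IsSmooth.tsum_pow (hF : IsSmooth F) (h1 : ∀ t ∈ Set.Icc (0 : ℝ) 1, F t ∈ fil 1) (x : ℕ → 𝕜) :
    IsSmooth fun t => ∑' k, x k • F t ^ k := by
  refine IsSmooth.of_approx fun k => ⟨fun t => ∑ n ∈ Finset.range k.toNat, x n • F t ^ n,
    IsSmooth.sum fun n _ => (hF.pow n).smul contDiffOn_const, fun t ht => ?_⟩
  rw [← (summable_pow (h1 t ht) x).sum_add_tsum_nat_add k.toNat, add_sub_cancel_left]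
  refine tsum_mem_fil fun n => Submodule.smul_mem _ _ (fil_anti ?_ (pow_mem_fil (h1 t ht) _))
  push_cast
  omega

end

/-! ### Relation with families of arrays -/

theorem IsSmooth.isFunPosFamily {F : ℝ → Completed 𝕜 2 d} (hF : IsSmooth F)
    (h1 : ∀ t ∈ Set.Icc (0 : ℝ) 1, F t ∈ fil 1) : IsFunPosFamily d fun t => (F t).1 :=
  ⟨fun t ht => ⟨(F t).2, h1 t ht⟩, hF.smooth, fun w => (hF.finite (w + 1)).subset fun p hp =>
    ⟨by rw [level_two, hp.1]; omega, hp.2⟩⟩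

theorem levelFinite_of_isFunPos {F : Fun ι 𝕜} (hF : IsFunPos d F) : LevelFinite 2 F := fun k => by
  refine ((Set.finite_Icc 1 k).biUnion fun w _ => hF.2.2 w).subset fun p hp => ?_
  simp only [Set.mem_iUnion]
  exact ⟨weight p.1 p.2, ⟨hF.2.1 _ _ hp.2, hp.1⟩, rfl, hp.2⟩

/-- The element of the completed algebra given by a formal function of positive weight. -/
def ofFunPos (F : Fun ι 𝕜) (hF : IsFunPos d F) : Completed 𝕜 2 d := ⟨F, hF.1, levelFinite_of_isFunPos hF⟩

theorem ofFunPos_mem_fil {F : Fun ι 𝕜} (hF : IsFunPos d F) : ofFunPos F hF ∈ fil 1 := hF.2.1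

theorem isFunPos_val {a : Completed 𝕜 2 d} (ha : a ∈ fil 1) : IsFunPos d a.1 :=
  ⟨a.2, ha, fun w => (a.levelFinite (w + 1)).subset fun p hp => ⟨by rw [level_two, hp.1]; omega, hp.2⟩⟩

theorem exists_isSmooth {F : ℝ → Fun ι 𝕜} (hF : IsFunPosFamily d F) : ∃ a : ℝ → Completed 𝕜 2 d,
    IsSmooth a ∧ ∀ t ∈ Set.Icc (0 : ℝ) 1, (a t).1 = F t ∧ a t ∈ fil 1 := by
  classical
  have h : ∀ t ∈ Set.Icc (0 : ℝ) 1, IsFunPos d (F t) := fun t ht =>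
    ⟨(hF.1 t ht).1, (hF.1 t ht).2, fun w => (hF.2.2 w).subset fun p hp => ⟨hp.1, t, ht, hp.2⟩⟩
  let a : ℝ → Completed 𝕜 2 d := fun t => if ht : t ∈ Set.Icc (0 : ℝ) 1 then ofFunPos (F t) (h t ht) else 0
  have ha : ∀ t ∈ Set.Icc (0 : ℝ) 1, (a t).1 = F t := fun t ht => by
    simp only [a]
    rw [dif_pos ht]
    rfl
  have ha1 : ∀ t ∈ Set.Icc (0 : ℝ) 1, a t ∈ fil 1 := fun t ht => by
    simp only [a]
    rw [dif_pos ht]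
    exact ofFunPos_mem_fil _
  refine ⟨a, ⟨fun g m => (hF.2.1 g m).congr fun t ht => by rw [ha t ht], fun k => ?_⟩, fun t ht =>
    ⟨ha t ht, ha1 t ht⟩⟩
  refine ((Set.finite_Ico 1 k).biUnion fun w _ => hF.2.2 w).subset fun p ⟨hp, t, ht, h1⟩ => ?_
  simp only [Set.mem_iUnion]
  rw [ha t ht] at h1
  exact ⟨weight p.1 p.2, ⟨(hF.1 t ht).2 _ _ h1, hp⟩, rfl, t, ht, h1⟩

/-! ### Exponentials of forms -/

theorem parity_val (a : Completed 𝕜 c d) : parity d a.1 = (rho 1 a).1 := by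
  funext g m
  rw [rho_val, one_mul]
  rfl

/-- Since `dt² = 0`, at most one factor `b dt` survives, in `k` equal positions because `a` is even.
For `k = 0` the truncated exponent `k - 1` is harmless, as its coefficient is zero. -/
theorem formPow_val {a : Completed 𝕜 c d} (ha : Homog 0 a) (b : Completed 𝕜 c d) (k : ℕ) :
    formPow d (a.1, b.1) k = ((a ^ k).1, ((k : 𝕜) • (a ^ (k - 1) * b)).1) := by
  induction k with
  | zero => simp [formPow]
  | succ k ih =>
    have e : rho 1 (a ^ k) = a ^ k := by rw [(ha.pow k).rho_eq]; simp
    rw [formPow, ih, formMul, parity_val, e, ← val_mul, ← val_mul, ← val_mul, ← val_add, pow_succ' a k,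
      add_tsub_cancel_right, ← ((ha.pow k).commute b).eq]
    congr 2
    cases k with
    | zero => simp
    | succ k =>
      rw [add_tsub_cancel_right, mul_smul_comm, ← mul_assoc, ← pow_succ']
      push_cast
      module

theorem formExp_val {a : Completed 𝕜 c d} (ha : Homog 0 a) (ha1 : a ∈ fil 1) (b : Completed 𝕜 c d) :
    formExp d (a.1, b.1) = ((expC a).1, (expC a * b).1) := by
  have hs := summable_pow ha1 fun k => (k.factorial : 𝕜)⁻¹
  have hsb := hs.mul_right b
  set f : ℕ → Completed 𝕜 c d := fun k => (k.factorial : 𝕜)⁻¹ • ((k : 𝕜) • (a ^ (k - 1) * b)) with hf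
  have hf' : ∀ k, f (k + 1) = (k.factorial : 𝕜)⁻¹ • a ^ k * b := fun k => by
    have : ((k : 𝕜) + 1) ≠ 0 := Nat.cast_add_one_ne_zero k
    simp only [hf, add_tsub_cancel_right]
    rw [smul_smul, smul_mul_assoc, Nat.factorial_succ]
    congr 1
    push_cast
    field_simp
  have hfs : Summable f := summable_iff.2 fun k => by
    refine ((Set.finite_singleton 0).union ((summable_iff.1 hsb k).image (· + 1))).subset fun n hn => ?_
    cases n with
    | zero => exact Or.inl rfl
    | succ n =>
      refine Or.inr ⟨n, ?_, rfl⟩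
      rw [Set.mem_ofPred_eq, hf'] at hn
      exact hn
  have h2 : expC a * b = ∑' k, f k := by
    rw [hfs.tsum_eq_zero_add, expC, tsum_mul_right' _ hs]
    simp only [hf']
    simp [hf]
  rw [formExp, h2]
  refine Prod.ext ?_ ?_
  · funext g m
    show _ = (∑' k : ℕ, (k.factorial : 𝕜)⁻¹ • a ^ k).1 g m
    rw [val_tsum hs]
    refine finsum_congr fun k => ?_
    rw [formPow_val ha]
    rfl
  · funext g m
    show _ = (∑' k : ℕ, f k).1 g m
    rw [val_tsum hfs]
    refine finsum_congr fun k => ?_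
    rw [formPow_val ha]
    rfl

/-! ### Degree components -/

/-- The component of degree `n`. -/
def dcomp (n : ℤ) : Completed 𝕜 c d →ₗ[𝕜] Completed 𝕜 c d := diag fun _ m => if monDeg d m = n then 1 else 0

theorem homog_dcomp (n : ℤ) (a : Completed 𝕜 c d) : Homog n (dcomp n a) := fun g m h => by
  by_contra hc
  rw [dcomp, diag_val, if_neg hc, zero_mul] at h
  exact h rfl

theorem Homog.dcomp_eq {n : ℤ} {a : Completed 𝕜 c d} (ha : Homog n a) (k : ℤ) :
    dcomp k a = if n = k then a else 0 := by
  ext g m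
  rw [dcomp, diag_val]
  by_cases h0 : a.1 g m = 0
  · split_ifs <;> simp [h0]
  · rw [ha g m h0]
    split_ifs <;> simp

/-- The operator has degree `1`. Hence a primitive whose degree is not prescribed may be replaced by
its component of degree `-1` when the target has degree `0`. -/
theorem tw_dcomp (hP : IsOddPoisson d P) {S : Completed 𝕜 c d} (hS : Homog 0 S) (n : ℤ) (a : Completed 𝕜 c d) :
    tw hP S (dcomp n a) = dcomp (n + 1) (tw hP S a) := by
  refine induction_mon (fun a => tw hP S (dcomp n a)) (fun a => dcomp (n + 1) (tw hP S a))
    ((isBounded_tw hP S).comp (isBounded_diag _)) ((isBounded_diag _).comp (isBounded_tw hP S))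
    (fun a b => by rw [map_add, map_add]) (fun a b => by rw [map_add, map_add]) (fun g m x _ => ?_) a
  have h := homog_mon (c := c) (d := d) g m x
  show tw hP S (dcomp n (mon c d g m x)) = dcomp (n + 1) (tw hP S (mon c d g m x))
  rw [h.dcomp_eq, (Homog.map_tw hP hS h).dcomp_eq]
  by_cases hn : monDeg d m = n
  · rw [if_pos hn, if_pos (by rw [hn])]
  · rw [if_neg hn, if_neg (by omega), map_zero]

end Completed

end Families

/-! ### Homotopies of actions and exactness of the difference of exponentials -/

section Homotopy

variable {ι 𝕜 : Type*} [LinearOrder ι] [RCLike 𝕜]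

namespace Completed

variable {d : ι → ℤ} {P : ι → ι → 𝕜} {hP : IsOddPoisson d P} {S : Completed 𝕜 2 d}

theorem hasDerivAt_ofReal (t : ℝ) : HasDerivAt (fun s : ℝ => (s : 𝕜)) 1 t := by
  have := (RCLike.ofRealCLM (K := 𝕜)).hasDerivAt (x := t)
  simpa using this

theorem contDiff_ofReal : ContDiff ℝ (⊤ : ℕ∞) fun s : ℝ => (s : 𝕜) := (RCLike.ofRealCLM (K := 𝕜)).contDiff

/-- An exact variation of the exponential of an action gives a homotopy. -/
theorem exists_homotopy_of_exact {b₀ b₁ F : Completed 𝕜 2 d} (hb₀ : b₀ ∈ fil 1) (hb₁ : b₁ ∈ fil 1)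
    (hb₀' : Homog 0 b₀) (hb₁' : Homog 0 b₁) (hx₀ : tw hP S (expC b₀) = 0) (hx₁ : tw hP S (expC b₁) = 0)
    (hF : Homog (-1) F) (hF1 : F ∈ fil 1) (h : expC b₀ - expC b₁ = tw hP S F) :
    ∃ A B : ℝ → Fun ι 𝕜, IsHomotopy d P S.1 A B ∧ A 0 = (hb 1 * b₀).1 ∧ A 1 = (hb 1 * b₁).1 := by
  set x₀ := expC b₀ with hx₀'
  set x₁ := expC b₁ with hx₁'
  -- On exponentials the master equation is linear, so the endpoints are joined by a segment. Its
  -- points have leading term `1` and therefore a logarithm.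
  let x : ℝ → Completed 𝕜 2 d := fun t => x₀ + (t : 𝕜) • (x₁ - x₀)
  have hd : x₁ - x₀ ∈ fil 1 := by
    have := sub_mem (expC_sub_one_mem hb₁) (expC_sub_one_mem hb₀)
    rwa [sub_sub_sub_cancel_right] at this
  have hx1 : ∀ t, x t - 1 ∈ fil 1 := fun t => by
    show x₀ + (t : 𝕜) • (x₁ - x₀) - 1 ∈ fil 1
    rw [add_sub_right_comm]
    exact add_mem (expC_sub_one_mem hb₀) (Submodule.smul_mem _ _ hd)
  have hxh : ∀ t, Homog 0 (x t) := fun t =>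
    (homog_expC hb₀').add (((homog_expC hb₁').sub (homog_expC hb₀')).smul _)
  have hxs : IsSmooth x := (IsSmooth.const _).add ((IsSmooth.const _).smul contDiff_ofReal.contDiffOn)
  have hxs1 : IsSmooth fun t => x t - 1 := by
    simpa only [sub_eq_add_neg] using hxs.add (IsSmooth.const (-1))
  have hlog : IsSmooth fun t => logC (x t) := hxs1.tsum_pow (fun t _ => hx1 t) _
  have hinv : IsSmooth fun t => invC (x t) * F := (hxs1.tsum_pow (fun t _ => hx1 t) _).mul (IsSmooth.const F)
  have hdiv : ∀ a : Completed 𝕜 2 d, hbarPow (-1) (hb 1 * a).1 = a.1 := fun a => by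
    rw [← hb_mul_val, hb_mul_cancel]
  -- With `A / ħ = log x` and `B / ħ = x⁻¹ F` the exponential of the form is `x(t) + F dt`; its
  -- differential vanishes because `x(t)` is closed and `D F = x₀ - x₁ = -x'`.
  refine ⟨fun t => (hb 1 * logC (x t)).1, fun t => (hb 1 * (invC (x t) * F)).1, ⟨?_, ?_, fun t _ => ⟨?_, ?_⟩,
    fun t ht => ?_⟩, ?_, ?_⟩
  · simp only [hdiv]
    exact hlog.isFunPosFamily fun t _ => logC_mem_fil (hx1 t)
  · simp only [hdiv]
    refine hinv.isFunPosFamily fun t _ => ?_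
    simpa using mul_mem_fil (mem_fil_zero_of_sub_one (invC_sub_one_mem (hx1 t))) hF1
  · exact (homog_logC (hxh t)).hb_mul 1
  · have := ((homog_invC (hxh t)).mul hF).hb_mul 1
    rwa [zero_add] at this
  · have hE : ∀ s, formExp d (hbarPow (-1) (hb 1 * logC (x s)).1, hbarPow (-1) (hb 1 * (invC (x s) * F)).1) =
        ((x s).1, F.1) := fun s => by
      rw [hdiv, hdiv, formExp_val (homog_logC (hxh s)) (logC_mem_fil (hx1 s)), expC_logC (hx1 s) (hxh s),
        ← mul_assoc, mul_invC (hx1 s), one_mul]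
    have hdt : timeDeriv (fun s => (x s).1) t = (x₁ - x₀).1 := by
      funext g m
      have h1 : HasDerivAt (fun s : ℝ => (x s).1 g m) ((x₁ - x₀).1 g m) t := by
        have := ((hasDerivAt_ofReal (𝕜 := 𝕜) t).mul_const ((x₁ - x₀).1 g m)).const_add (x₀.1 g m)
        rwa [one_mul] at this
      exact h1.hasDerivWithinAt.derivWithin (uniqueDiffOn_Icc_zero_one t ht)
    have hp : parity d (x₁ - x₀).1 = (x₁ - x₀).1 := by
      rw [parity_val, ((homog_expC hb₁').sub (homog_expC hb₀')).rho_eq, mul_zero, zpow_zero, one_smul]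
    have h1 : tw hP S (x t) = 0 := by
      show tw hP S (x₀ + (t : 𝕜) • (x₁ - x₀)) = 0
      rw [map_add, map_smul, map_sub, hx₀, hx₁, sub_zero, smul_zero, zero_add]
    rw [formDiff]
    simp only [hE]
    rw [hdt, hp, twisted_val hP, twisted_val hP, h1, ← h, ← val_add, sub_add_sub_cancel, sub_self]
    rfl
  · show (hb 1 * logC (x₀ + ((0 : ℝ) : 𝕜) • (x₁ - x₀))).1 = _
    rw [RCLike.ofReal_zero, zero_smul, add_zero, logC_expC hb₀ hb₀']
  · show (hb 1 * logC (x₀ + ((1 : ℝ) : 𝕜) • (x₁ - x₀))).1 = _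
    rw [RCLike.ofReal_one, one_smul, add_sub_cancel, logC_expC hb₁ hb₁']

/-- The integral of a smooth family over `[0, 1]`. -/
def IsSmooth.integral {y : ℝ → Completed 𝕜 2 d} (hy : IsSmooth y) : Completed 𝕜 2 d where
  val g m := ∫ t in (0 : ℝ)..1, (y t).1 g m
  isGradedSymm g m h := by
    by_contra hc
    refine h ?_
    show ∫ t in (0 : ℝ)..1, (y t).1 g m = 0
    rw [intervalIntegral.integral_congr (g := fun _ => (0 : 𝕜)), intervalIntegral.integral_zero]
    intro t _
    by_contra h0
    exact hc ((y t).2 g m h0)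
  isLevelFinite k := (hy.finite (k + 1)).subset fun p ⟨hp, h0⟩ => by
    refine ⟨Int.lt_add_one_of_le hp, ?_⟩
    by_contra hc
    push Not at hc
    refine h0 ?_
    show ∫ t in (0 : ℝ)..1, (y t).1 p.1 p.2 = 0
    rw [intervalIntegral.integral_congr (g := fun _ => (0 : 𝕜)), intervalIntegral.integral_zero]
    intro t ht
    rw [Set.uIcc_of_le zero_le_one] at ht
    exact hc t ht

theorem IsSmooth.integral_val {y : ℝ → Completed 𝕜 2 d} (hy : IsSmooth y) (g : ℤ) (m : ι →₀ ℕ) :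
    hy.integral.1 g m = ∫ t in (0 : ℝ)..1, (y t).1 g m := rfl

theorem IsSmooth.integral_val_eq_zero {y : ℝ → Completed 𝕜 2 d} (hy : IsSmooth y) {g : ℤ} {m : ι →₀ ℕ}
    (h : ∀ t ∈ Set.Icc (0 : ℝ) 1, (y t).1 g m = 0) : hy.integral.1 g m = 0 := by
  rw [hy.integral_val, intervalIntegral.integral_congr (g := fun _ => (0 : 𝕜)), intervalIntegral.integral_zero]
  intro t ht
  rw [Set.uIcc_of_le zero_le_one] at ht
  exact h t ht

/-- A coefficient of `L y` depends on finitely many coefficients of the family, so the operator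
commutes with the integral as a finite sum does. -/
theorem IsSmooth.map_integral {y : ℝ → Completed 𝕜 2 d} (hy : IsSmooth y)
    {L : Completed 𝕜 2 d →ₗ[𝕜] Completed 𝕜 2 d} (hL : IsBounded L) (g : ℤ) (m : ι →₀ ℕ) :
    (L hy.integral).1 g m = ∫ t in (0 : ℝ)..1, (L (y t)).1 g m := by
  obtain ⟨s, z, hz⟩ := hy.map_val hL g m
  have h1 : ∫ t in (0 : ℝ)..1, (L (y t)).1 g m = ∫ t in (0 : ℝ)..1, ∑ p ∈ s, (y t).1 p.1 p.2 * z p := by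
    refine intervalIntegral.integral_congr fun t ht => ?_
    rw [Set.uIcc_of_le zero_le_one] at ht
    exact hz (y t) fun p hp => hp t ht
  rw [hz _ fun p hp => hy.integral_val_eq_zero hp, h1, intervalIntegral.integral_finsetSum]
  · exact Finset.sum_congr rfl fun p _ => (intervalIntegral.integral_mul_const _ _).symm
  · exact fun p _ => (((hy.smooth p.1 p.2).continuousOn.mul continuousOn_const)).intervalIntegrable_of_Icc zero_le_one

/-- The fundamental theorem of calculus for `C^∞` functions on `[0, 1]`. -/
theorem integral_derivWithin {u : ℝ → 𝕜} (hu : ContDiffOn ℝ (⊤ : ℕ∞) u (Set.Icc 0 1)) :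
    ∫ t in (0 : ℝ)..1, derivWithin u (Set.Icc 0 1) t = u 1 - u 0 := by
  refine intervalIntegral.integral_eq_sub_of_hasDeriv_right_of_le zero_le_one hu.continuousOn (fun t ht => ?_) ?_
  · have h1 := (hu.differentiableOn (by simp) t (Set.Ioo_subset_Icc_self ht)).hasDerivWithinAt
    exact (h1.hasDerivAt (Icc_mem_nhds ht.1 ht.2)).hasDerivWithinAt
  · exact (hu.continuousOn_derivWithin uniqueDiffOn_Icc_zero_one (by simp)).intervalIntegrable_of_Icc zero_le_one

theorem homog_of_hbarPow {n : ℤ} {a : Completed 𝕜 2 d} {A : Fun ι 𝕜} (h : a.1 = hbarPow (-1) A)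
    (hA : IsHomogeneous d n A) : Homog n a := fun g m h0 => hA (g - -1) m (by rwa [h] at h0)

/-- The endpoints of a homotopy have exponentials which differ by an exact function. -/
theorem exact_of_homotopy {A B : ℝ → Fun ι 𝕜} (hAB : IsHomotopy d P S.1 A B) {b₀ b₁ : Completed 𝕜 2 d}
    (h₀ : b₀.1 = hbarPow (-1) (A 0)) (h₁ : b₁.1 = hbarPow (-1) (A 1)) :
    ∃ F ∈ fil 1, expC b₀ - expC b₁ = tw hP S F := by
  obtain ⟨hA, hB, hdeg, heq⟩ := hAB
  obtain ⟨a, ha, ha'⟩ := exists_isSmooth hA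
  obtain ⟨b, hb, hb'⟩ := exists_isSmooth hB
  have ha0 : ∀ t ∈ Set.Icc (0 : ℝ) 1, Homog 0 (a t) := fun t ht => homog_of_hbarPow (ha' t ht).1 (hdeg t ht).1
  have hx : IsSmooth fun t => expC (a t) := ha.tsum_pow (fun t ht => (ha' t ht).2) _
  have hy : IsSmooth fun t => expC (a t) * b t := hx.mul hb
  have hE : ∀ s ∈ Set.Icc (0 : ℝ) 1, formExp d (hbarPow (-1) (A s), hbarPow (-1) (B s)) =
      ((expC (a s)).1, (expC (a s) * b s).1) := fun s hs => by
    rw [← (ha' s hs).1, ← (hb' s hs).1, formExp_val (ha0 s hs) (ha' s hs).2]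
  -- The `dt` component of the closedness of the exponential; the parity operator acts trivially
  -- because `exp (a t)` has degree `0`.
  have key : ∀ g m, ∀ t ∈ Set.Icc (0 : ℝ) 1, (tw hP S (expC (a t) * b t)).1 g m =
      -derivWithin (fun s => (expC (a s)).1 g m) (Set.Icc 0 1) t := by
    intro g m t ht
    have h1 := congrFun (congrFun (congrArg Prod.snd (heq t ht)) g) m
    have h2 : parity d (timeDeriv (fun s => (formExp d (hbarPow (-1) (A s), hbarPow (-1) (B s))).1) t) g m =
        derivWithin (fun s => (expC (a s)).1 g m) (Set.Icc 0 1) t := by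
      have h3 : timeDeriv (fun s => (formExp d (hbarPow (-1) (A s), hbarPow (-1) (B s))).1) t g m =
          derivWithin (fun s => (expC (a s)).1 g m) (Set.Icc 0 1) t :=
        derivWithin_congr (fun s hs => congrFun (congrFun (congrArg Prod.fst (hE s hs)) g) m)
          (congrFun (congrFun (congrArg Prod.fst (hE t ht)) g) m)
      rw [parity, h3]
      by_cases hm : monDeg d m = 0
      · rw [hm, zpow_zero, one_mul]
      · have h4 : derivWithin (fun s => (expC (a s)).1 g m) (Set.Icc 0 1) t =
            derivWithin (fun _ => (0 : 𝕜)) (Set.Icc 0 1) t := by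
          have h5 : ∀ s ∈ Set.Icc (0 : ℝ) 1, (expC (a s)).1 g m = 0 := fun s hs => by
            by_contra h6
            exact hm (homog_expC (ha0 s hs) g m h6)
          exact derivWithin_congr h5 (h5 t ht)
        rw [h4, derivWithin_fun_const, Pi.zero_apply, mul_zero]
    rw [formDiff] at h1
    simp only [Pi.add_apply, Prod.snd_zero, Pi.zero_apply] at h1
    rw [h2, hE t ht, twisted_val hP] at h1
    exact eq_neg_of_add_eq_zero_left h1
  -- The primitive is the integral of the `dt` component; closedness and the fundamental theorem of
  -- calculus give the difference of the endpoints.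
  refine ⟨hy.integral, fun g m h => ?_, ?_⟩
  · by_contra hc
    refine h (hy.integral_val_eq_zero fun t ht => ?_)
    have h1 : expC (a t) * b t ∈ fil (0 + 1) :=
      mul_mem_fil (mem_fil_zero_of_sub_one (expC_sub_one_mem (ha' t ht).2)) (hb' t ht).2
    exact mem_fil'.1 h1 g m (by omega)
  · have e0 : b₀ = a 0 := val_injective (h₀.trans (ha' 0 (by simp)).1.symm)
    have e1 : b₁ = a 1 := val_injective (h₁.trans (ha' 1 (by simp)).1.symm)
    ext g m
    rw [hy.map_integral (isBounded_tw hP S), intervalIntegral.integral_congr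
      (g := fun t => -derivWithin (fun s => (expC (a s)).1 g m) (Set.Icc 0 1) t),
      intervalIntegral.integral_neg, integral_derivWithin (hx.smooth g m), neg_sub, e0, e1]
    · rfl
    · intro t ht
      rw [Set.uIcc_of_le zero_le_one] at ht
      exact key g m t ht

end Completed

end Homotopy

/-! ### Antisymmetry and nondegeneracy of the odd symplectic form in a basis -/

section LinearAlgebra

variable {𝕜 V ι : Type*} [Field 𝕜] [AddCommGroup V] [Module 𝕜 V] {𝒱 : ℤ → Submodule 𝕜 V}
  {ω : V →ₗ[𝕜] V →ₗ[𝕜] 𝕜} (hω : IsOddSymplectic 𝒱 ω) (e : Module.Basis ι 𝕜 V) {deg : ι → ℤ}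
  (he : ∀ i, e i ∈ 𝒱 (deg i))

include hω he

theorem IsOddSymplectic.degree_basis {i j : ι} (h : ω (e i) (e j) ≠ 0) : deg i + deg j = 1 := by
  by_contra hc
  exact h (hω.degree _ _ _ (he i) _ (he j) hc)

/-- A nonzero pairing needs degrees with sum `1`; their product is even, so graded antisymmetry is
ordinary antisymmetry. -/
theorem IsOddSymplectic.antisymm_basis (i j : ι) : ω (e i) (e j) = -ω (e j) (e i) := by
  have h := hω.antisymm _ _ _ (he i) _ (he j)
  by_cases h0 : ω (e j) (e i) = 0
  · rw [h, h0, mul_zero]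
  · have h1 := hω.degree_basis e he h0
    have h2 : Even (deg i * deg j) := by
      rw [show deg i = -(deg j - 1) by omega, neg_mul, mul_comm]
      exact (Int.even_mul_pred_self _).neg
    rw [h, h2.neg_one_zpow, one_mul]

theorem IsOddSymplectic.antisymm' (x y : V) : ω x y = -ω y x := by
  have : ω = -ω.flip := e.ext fun i => e.ext fun j => by
    simpa using hω.antisymm_basis e he i j
  conv_lhs => rw [this]
  simp

theorem IsOddSymplectic.ext_right {x y : V} (h : ∀ i, ω (e i) x = ω (e i) y) : x = y := by
  refine sub_eq_zero.1 (hω.nondegenerate _ fun z => ?_)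
  have h1 : ω.flip x = ω.flip y := e.ext h
  have h2 := LinearMap.congr_fun h1 z
  rw [LinearMap.flip_apply, LinearMap.flip_apply] at h2
  rw [hω.antisymm' e he, map_sub, h2, sub_self, neg_zero]

end LinearAlgebra

/-! ### The inverse matrix of the symplectic form -/

section Inverse

variable {𝕜 V ι : Type*} [Field 𝕜] [AddCommGroup V] [Module 𝕜 V] {𝒱 : ℤ → Submodule 𝕜 V}
  [DirectSum.Decomposition 𝒱] (hfin : ∀ n, FiniteDimensional 𝕜 (𝒱 n))
  {ω : V →ₗ[𝕜] V →ₗ[𝕜] 𝕜} (hω : IsOddSymplectic 𝒱 ω) (e : Module.Basis ι 𝕜 V) {deg : ι → ℤ}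
  (he : ∀ i, e i ∈ 𝒱 (deg i))

theorem apply_eq_sum (i : ι) (u : V) : ω (e i) u = (e.repr u).sum fun k x => x * ω (e i) (e k) := by
  conv_lhs => rw [← e.linearCombination_repr u, Finsupp.linearCombination_apply, map_finsuppSum]
  simp

include hfin hω he

theorem exists_invForm_column (j : ι) : open Classical in
    ∃ u : V, (∀ i, ω (e i) u = if i = j then 1 else 0) ∧ ∀ k, invForm ω e k j = e.repr u k := by
  classical
  have h := exists_dual_vector 𝒱 hfin ω hω e deg he j
  refine ⟨h.choose, h.choose_spec, fun k => ?_⟩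
  unfold invForm
  rw [dif_pos]

/-- Pairing with the dual vector of `e i` reads off the `i`-th coordinate, so the two entries are
the pairings of the two dual vectors in the two orders. -/
theorem invForm_antisymm (i j : ι) : invForm ω e i j = -invForm ω e j i := by
  classical
  obtain ⟨u, hu, hu'⟩ := exists_invForm_column hfin hω e he i
  obtain ⟨v, hv, hv'⟩ := exists_invForm_column hfin hω e he j
  have key : ∀ (u v : V) (i j : ι), (∀ k, ω (e k) u = if k = i then 1 else 0) → ω v u = e.repr v i := by
    intro u v i _ hu
    have : ω.flip u = e.coord i := e.ext fun k => by
      rw [LinearMap.flip_apply, hu, e.coord_apply, e.repr_self, Finsupp.single_apply]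
    exact LinearMap.congr_fun this v
  rw [hu', hv', ← key v u j i (fun k => hv k), ← key u v i j (fun k => hu k), hω.antisymm' e he]

/-- Discarding the components of the dual vector in the wrong degrees does not change its pairings
with the basis, so by nondegeneracy these components are zero. -/
theorem invForm_degree {k j : ι} (h : invForm ω e k j ≠ 0) : deg k + deg j = 1 := by
  classical
  obtain ⟨u, hu, hu'⟩ := exists_invForm_column hfin hω e he j
  have hval : ∀ i, ω (e i) (e.repr.symm ((e.repr u).filter fun k => deg k + deg j = 1)) = ω (e i) u := by
    intro i
    rw [apply_eq_sum, LinearEquiv.apply_symm_apply]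
    by_cases hi : deg i = deg j
    · rw [apply_eq_sum e i u, Finsupp.sum, Finsupp.sum, Finsupp.support_filter, Finset.sum_filter]
      refine Finset.sum_congr rfl fun k _ => ?_
      by_cases hk : deg k + deg j = 1
      · rw [if_pos hk, Finsupp.filter_apply_pos (fun k => deg k + deg j = 1) _ hk]
      · rw [if_neg hk]
        by_contra h0
        have h1 := hω.degree_basis e he (right_ne_zero_of_mul (Ne.symm h0))
        omega
    · rw [hu, if_neg fun hc => hi (by rw [hc]), Finsupp.sum, Finset.sum_eq_zero]
      intro k hk
      rw [Finsupp.support_filter, Finset.mem_filter] at hk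
      by_contra h0
      have h1 := hω.degree_basis e he (right_ne_zero_of_mul h0)
      omega
  have h1 := hω.ext_right e he hval
  by_contra hc
  refine h ?_
  rw [hu', ← h1, LinearEquiv.apply_symm_apply, Finsupp.filter_apply_neg (fun k => deg k + deg j = 1) _ hc]

theorem finite_deg_eq (n : ℤ) : {i | deg i = n}.Finite := by
  have := hfin n
  have h1 : LinearIndependent 𝕜 fun i : {i // deg i = n} => (⟨e i.1, by have := he i.1; rwa [i.2] at this⟩ : 𝒱 n) := by
    refine LinearIndependent.of_comp (𝒱 n).subtype ?_
    exact e.linearIndependent.comp Subtype.val Subtype.val_injective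
  exact h1.finite

variable [LinearOrder ι] {d : ι → ℤ} (hd : ∀ i, d i = -deg i)

include hd

theorem isOddPoisson_invForm : IsOddPoisson d (invForm ω e) where
  antisymm := invForm_antisymm hfin hω e he
  degree i j h := by
    have := invForm_degree hfin hω e he h
    rw [hd, hd]
    omega
  finite i := by
    obtain ⟨u, hu, hu'⟩ := exists_invForm_column hfin hω e he i
    -- Up to sign, the row consists of the coordinates of one vector, hence is finitely supported.
    refine (e.repr u).hasFiniteSupport.subset fun j hj => ?_
    rw [Set.mem_ofPred_eq, invForm_antisymm hfin hω e he, hu', neg_ne_zero] at hj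
    exact hj

theorem isOddForm_invForm : IsOddForm d (invForm ω e) fun i j => ω (e i) (e j) where
  antisymm := hω.antisymm_basis e he
  degree i j h := by
    have := hω.degree_basis e he h
    rw [hd, hd]
    omega
  -- The row is supported on the indices of a single degree, finitely many by finite dimension.
  finite i := (finite_deg_eq hfin hω e he (1 - deg i)).subset fun j hj => by
    have := hω.degree_basis e he hj
    show deg j = 1 - deg i
    omega
  inverse i k := by
    classical
    obtain ⟨u, hu, hu'⟩ := exists_invForm_column hfin hω e he i
    have h1 : ∀ j, invForm ω e i j * ω (e j) (e k) = e.repr u j * ω (e k) (e j) := fun j => by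
      rw [invForm_antisymm hfin hω e he, hu', hω.antisymm_basis e he, neg_mul_neg]
    have h2 := hu k
    rw [apply_eq_sum, Finsupp.sum] at h2
    rw [finsum_congr h1, finsum_eq_sum_of_support_subset (s := (e.repr u).support), h2]
    · simp only [eq_comm]
    · intro j hj
      simpa using left_ne_zero_of_mul hj

end Inverse

/-! ### From coefficient arrays to the completed algebra -/

section Arrays

variable {ι 𝕜 : Type*} [LinearOrder ι] [RCLike 𝕜] {d : ι → ℤ} {P : ι → ι → 𝕜}

namespace Completed

/-! ### Kinetic terms, actions and formal maps given by arrays -/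

/-- The element of the completed algebra given by a kinetic term. -/
def ofKinetic (F : Fun ι 𝕜) (hF : IsKinetic d F) : Completed 𝕜 2 d where
  val := F
  isGradedSymm := hF.1
  isLevelFinite k := (hF.2.2.2.image fun m => ((0 : ℤ), m)).subset fun p hp => by
    obtain ⟨h1, -⟩ := hF.2.2.1 _ _ hp.2
    exact ⟨p.2, by rw [Set.mem_ofPred_eq, ← h1]; exact hp.2, Prod.ext h1.symm rfl⟩

theorem hbarPow_hbarPow (k l : ℤ) (F : Fun ι 𝕜) : hbarPow k (hbarPow l F) = hbarPow (k + l) F := by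
  funext g m
  simp only [hbarPow]
  congr 1
  ring

theorem hbarPow_zero (F : Fun ι 𝕜) : hbarPow 0 F = F := by
  funext g m
  simp only [hbarPow, sub_zero]

theorem isMaster_of_isAction (hP : IsOddPoisson d P) {S b : Completed 𝕜 2 d} {F : Fun ι 𝕜}
    (hF : IsAction d P S.1 F) (h : b.1 = hbarPow (-1) F) : IsMaster hP (hb (-1) * S + b) := by
  have h1 : (hb 1 * b).1 = F := by
    rw [hb_mul_val, h, hbarPow_hbarPow, show (1 : ℤ) + -1 = 0 by norm_num, hbarPow_zero]
  have h2 := (isMaster_iff hP (S + hb 1 * b)).2 (by rw [val_add, h1]; exact hF.2.2)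
  rwa [mul_add, ← mul_assoc, hb_mul_hb, show (-1 : ℤ) + 1 = 0 by norm_num, hb_zero, one_mul] at h2

/-- The master equation for the kinetic term is extracted as the lowest weight part of the master
equation for an action. -/
theorem isKin_ofKinetic (hP : IsOddPoisson d P) {S F : Fun ι 𝕜} (hS : IsKinetic d S)
    (hF : IsAction d P S F) : IsKin hP (ofKinetic S hS) := by
  have h1 : ∀ g m, (ofKinetic S hS).1 g m ≠ 0 → g = 0 ∧ m.degree = 2 := hS.2.2.1
  have h2 : IsMaster hP (hb (-1) * ofKinetic S hS + ofFunPos (hbarPow (-1) F) hF.2.1) :=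
    isMaster_of_isAction hP hF rfl
  exact ⟨hS.2.1, h1, isMaster_kinetic hP (mem_fil_two_of_quadratic h1) (eul_of_quadratic h1)
    (ofFunPos_mem_fil hF.2.1) h2⟩

theorem exists_isUnip {f : ι → Fun ι 𝕜} (hf : IsUnipotent d f) :
    ∃ f' : ι → Completed 𝕜 2 d, IsUnip f' ∧ (fun i => (f' i).1) = f := by
  have hg : ∀ i, IsFunPos d (f i - coord i) := fun i => by
    refine ⟨fun g m h => ?_, fun g m h => le_trans (by norm_num) ((hf.1 i).2.2 g m h), fun w => ?_⟩
    · by_cases h0 : f i g m = 0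
      · refine (crd (𝕜 := 𝕜) (c := 2) (d := d) i).2 g m fun h1 => h ?_
        rw [crd_val] at h1
        rw [Pi.sub_apply, Pi.sub_apply, h0, h1, sub_zero]
      · exact (hf.1 i).1 g m h0
    · refine ((hf.2 w).preimage (f := fun p => (i, p)) fun _ _ _ _ h => (Prod.ext_iff.1 h).2).subset ?_
      exact fun p hp => ⟨hp.1, sub_ne_zero.1 hp.2⟩
  have hval : ∀ i, (crd i + ofFunPos (f i - coord i) (hg i)).1 = f i := fun i => by
    rw [val_add, crd_val]
    exact add_sub_cancel _ _
  refine ⟨fun i => crd i + ofFunPos (f i - coord i) (hg i), ⟨fun i => ?_, fun i => ?_, fun k => ?_⟩, funext hval⟩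
  · rw [Homog, hval]
    exact (hf.1 i).2.1
  · rw [add_sub_cancel_left]
    exact (hf.1 i).2.2
  · refine ((Set.finite_Ico 2 k).biUnion fun w _ => (hf.2 w).image Prod.fst).subset fun i hi => ?_
    rw [Set.mem_ofPred_eq, add_sub_cancel_left, mem_fil] at hi
    push Not at hi
    obtain ⟨g, m, h1, h2⟩ := hi
    simp only [Set.mem_iUnion]
    exact ⟨weight g m, ⟨(hf.1 i).2.2 g m h1, h2⟩, ⟨(i, g, m), ⟨rfl, sub_ne_zero.1 h1⟩, rfl⟩⟩

theorem IsUnip.isUnipotent {f : ι → Completed 𝕜 2 d} (hf : IsUnip f) : IsUnipotent d fun i => (f i).1 := by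
  have hsub : ∀ i g m, (f i).1 g m - coord i g m = (f i - crd i).1 g m := fun i g m => by
    rw [val_sub, crd_val]
    rfl
  refine ⟨fun i => ⟨(f i).2, hf.homog i, fun g m h => hf.mem i g m (by rwa [← hsub])⟩, fun w => ?_⟩
  refine ((hf.finite (w + 1)).biUnion fun i _ => ((f i - crd i).levelFinite w).image fun p => (i, p)).subset ?_
  rintro ⟨i, p⟩ ⟨h1, h2⟩
  have h3 : (f i - crd i).1 p.1 p.2 ≠ 0 := by
    rw [← hsub]
    exact sub_ne_zero.2 h2
  simp only [Set.mem_iUnion]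
  refine ⟨i, fun hc => ?_, ⟨p, ⟨h1.le, h3⟩, rfl⟩⟩
  have h4 := hc _ _ h3
  rw [level_two, h1] at h4
  omega

theorem isSymplectic_iff (hP : IsOddPoisson d P) (f : ι → Completed 𝕜 2 d) :
    IsSymplectic d P (fun i => (f i).1) ↔ ∀ i j, br hP (f i) (f j) = P i j • 1 := by
  refine forall₂_congr fun i j => ?_
  rw [bracket_val hP, ← val_one (c := 2) (d := d), ← val_smul]
  exact val_injective.eq_iff

end Completed

end Arrays

end QuantumBV

end

/-! ### The equivalence of exactness, homotopy and symplectic transport -/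

theorem mainTheorem4 {𝕜 : Type*} [RCLike 𝕜] {V : Type*} [AddCommGroup V] [Module 𝕜 V]
    (𝒱 : ℤ → Submodule 𝕜 V) [DirectSum.Decomposition 𝒱]
    (hfin : ∀ n, FiniteDimensional 𝕜 (𝒱 n))
    (ω : V →ₗ[𝕜] V →ₗ[𝕜] 𝕜) (hω : QuantumBV.IsOddSymplectic 𝒱 ω)
    {ι : Type*} [LinearOrder ι] (e : Module.Basis ι 𝕜 V) (deg : ι → ℤ)
    (he : ∀ i, e i ∈ 𝒱 (deg i))
    (d : ι → ℤ) (hd : ∀ i, d i = -deg i)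
    (P : ι → ι → 𝕜) (hP : P = QuantumBV.invForm ω e)
    (Sfree S₀ S₁ : QuantumBV.Fun ι 𝕜) (hfree : QuantumBV.IsKinetic d Sfree)
    (h₀ : QuantumBV.IsAction d P Sfree S₀) (h₁ : QuantumBV.IsAction d P Sfree S₁) :
    List.TFAE [
      ∃ F : QuantumBV.Fun ι 𝕜, QuantumBV.IsFunPos d F ∧
        QuantumBV.exp d (QuantumBV.hbarPow (-1) S₀) - QuantumBV.exp d (QuantumBV.hbarPow (-1) S₁)
          = QuantumBV.twisted d P Sfree F,
      ∃ A B : ℝ → QuantumBV.Fun ι 𝕜,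
        QuantumBV.IsHomotopy d P Sfree A B ∧ A 0 = S₀ ∧ A 1 = S₁,
      ∃ f : ι → QuantumBV.Fun ι 𝕜,
        QuantumBV.IsUnipotent d f ∧ QuantumBV.IsSymplectic d P f ∧
        QuantumBV.exp d (QuantumBV.hbarPow (-1) (Sfree + S₀)) =
          QuantumBV.pullbackHalfDensity d f
            (QuantumBV.exp d (QuantumBV.hbarPow (-1) (Sfree + S₁)))] := by
  subst hP
  have hP : QuantumBV.IsOddPoisson d (QuantumBV.invForm ω e) :=
    QuantumBV.isOddPoisson_invForm hfin hω e he hd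
  have hW := QuantumBV.isOddForm_invForm hfin hω e he hd
  have hS := QuantumBV.Completed.isKin_ofKinetic hP hfree h₀
  set S := QuantumBV.Completed.ofKinetic Sfree hfree
  set b₀ := QuantumBV.Completed.ofFunPos _ h₀.2.1
  set b₁ := QuantumBV.Completed.ofFunPos _ h₁.2.1
  have hb₀ : b₀ ∈ QuantumBV.Completed.fil 1 := QuantumBV.Completed.ofFunPos_mem_fil _
  have hb₁ : b₁ ∈ QuantumBV.Completed.fil 1 := QuantumBV.Completed.ofFunPos_mem_fil _
  have hd₀ : QuantumBV.Completed.Homog 0 b₀ := QuantumBV.Completed.homog_of_hbarPow rfl h₀.1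
  have hd₁ : QuantumBV.Completed.Homog 0 b₁ := QuantumBV.Completed.homog_of_hbarPow rfl h₁.1
  have hx₀ := QuantumBV.Completed.tw_expC hP hS.homog hS.master hd₀ hb₀
    (QuantumBV.Completed.isMaster_of_isAction hP h₀ rfl)
  have hx₁ := QuantumBV.Completed.tw_expC hP hS.homog hS.master hd₁ hb₁
    (QuantumBV.Completed.isMaster_of_isAction hP h₁ rfl)
  have hexp : QuantumBV.exp d (QuantumBV.hbarPow (-1) S₀) - QuantumBV.exp d (QuantumBV.hbarPow (-1) S₁) =
      (QuantumBV.Completed.expC b₀ - QuantumBV.Completed.expC b₁).1 := by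
    rw [QuantumBV.Completed.val_sub, QuantumBV.Completed.expC_val hb₀, QuantumBV.Completed.expC_val hb₁]
    rfl
  have hexact : ∀ F ∈ QuantumBV.Completed.fil 1,
      QuantumBV.Completed.expC b₀ - QuantumBV.Completed.expC b₁ = QuantumBV.Completed.tw hP S F →
      ∃ F : QuantumBV.Fun ι 𝕜, QuantumBV.IsFunPos d F ∧ QuantumBV.exp d (QuantumBV.hbarPow (-1) S₀) -
        QuantumBV.exp d (QuantumBV.hbarPow (-1) S₁) = QuantumBV.twisted d (QuantumBV.invForm ω e) Sfree F :=
    fun F hF h => ⟨F.1, QuantumBV.Completed.isFunPos_val hF, by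
      rw [hexp, h]; exact (QuantumBV.Completed.twisted_val hP S F).symm⟩
  have hexact' : (∃ F : QuantumBV.Fun ι 𝕜, QuantumBV.IsFunPos d F ∧ QuantumBV.exp d (QuantumBV.hbarPow (-1) S₀) -
        QuantumBV.exp d (QuantumBV.hbarPow (-1) S₁) = QuantumBV.twisted d (QuantumBV.invForm ω e) Sfree F) →
      ∃ F : QuantumBV.Completed 𝕜 2 d, QuantumBV.Completed.Homog (-1) F ∧ F ∈ QuantumBV.Completed.fil 1 ∧
        QuantumBV.Completed.expC b₀ - QuantumBV.Completed.expC b₁ = QuantumBV.Completed.tw hP S F := by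
    rintro ⟨F, hF, h⟩
    have h1 : QuantumBV.Completed.expC b₀ - QuantumBV.Completed.expC b₁ =
        QuantumBV.Completed.tw hP S (QuantumBV.Completed.ofFunPos F hF) :=
      QuantumBV.Completed.val_injective
        (hexp.symm.trans (h.trans (QuantumBV.Completed.twisted_val hP S (QuantumBV.Completed.ofFunPos F hF))))
    -- The degree of the primitive is not prescribed in condition 1. The difference of exponentials
    -- has degree `0` and the operator has degree `1`, so the component of degree `-1` is already a
    -- primitive.
    refine ⟨QuantumBV.Completed.dcomp (-1) (QuantumBV.Completed.ofFunPos F hF),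
      QuantumBV.Completed.homog_dcomp _ _,
      QuantumBV.Completed.diag_mem_fil (QuantumBV.Completed.ofFunPos_mem_fil hF), ?_⟩
    rw [QuantumBV.Completed.tw_dcomp hP hS.homog, ← h1,
      ((QuantumBV.Completed.homog_expC hd₀).sub (QuantumBV.Completed.homog_expC hd₁)).dcomp_eq, if_pos (by norm_num)]
  have hcancel : ∀ F : QuantumBV.Fun ι 𝕜, ∀ b : QuantumBV.Completed 𝕜 2 d, b.1 = QuantumBV.hbarPow (-1) F →
      (QuantumBV.Completed.hb 1 * b).1 = F := fun F b h => by
    rw [QuantumBV.Completed.hb_mul_val, h, QuantumBV.Completed.hbarPow_hbarPow,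
      show (1 : ℤ) + -1 = 0 by norm_num, QuantumBV.Completed.hbarPow_zero]
  have hhalf : ∀ (f : ι → QuantumBV.Completed 𝕜 2 d) (hf : QuantumBV.Completed.IsUnip f),
      QuantumBV.exp d (QuantumBV.hbarPow (-1) (Sfree + S₀)) = QuantumBV.pullbackHalfDensity d (fun i => (f i).1)
        (QuantumBV.exp d (QuantumBV.hbarPow (-1) (Sfree + S₁))) ↔
      QuantumBV.Completed.expC b₀ = QuantumBV.Completed.transport S hf (QuantumBV.Completed.expC b₁) :=
    fun f hf => by
      rw [← QuantumBV.Completed.exp_eq_pullback_iff hS hf hb₀ hd₀ hb₁ hd₁, QuantumBV.Completed.hb_mul_val]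
      rfl
  tfae_have 1 → 2 := fun h => by
    obtain ⟨F, hF, hF1, h⟩ := hexact' h
    obtain ⟨A, B, hAB, hA0, hA1⟩ :=
      QuantumBV.Completed.exists_homotopy_of_exact hb₀ hb₁ hd₀ hd₁ hx₀ hx₁ hF hF1 h
    exact ⟨A, B, hAB, hA0.trans (hcancel _ _ rfl), hA1.trans (hcancel _ _ rfl)⟩
  tfae_have 2 → 1 := by
    rintro ⟨A, B, hAB, rfl, rfl⟩
    obtain ⟨F, hF, h⟩ := QuantumBV.Completed.exact_of_homotopy (hP := hP) (S := S) hAB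
      (b₀ := b₀) (b₁ := b₁) rfl rfl
    exact hexact F hF h
  tfae_have 1 → 3 := fun h => by
    obtain ⟨F, hF, hF1, h⟩ := hexact' h
    obtain ⟨f, hf, hsymp, hfx⟩ := QuantumBV.Completed.exists_transport_of_exact hS
      (QuantumBV.Completed.expC_sub_one_mem hb₁) (QuantumBV.Completed.homog_expC hd₁) hx₁ hF hF1
    refine ⟨fun i => (f i).1, hf.isUnipotent, (QuantumBV.Completed.isSymplectic_iff hP f).2 hsymp,
      (hhalf f hf).2 ?_⟩
    rw [← sub_left_inj (a := QuantumBV.Completed.expC b₁), h, hfx]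
  tfae_have 3 → 1 := by
    rintro ⟨f, hf, hsymp, h⟩
    obtain ⟨f, hf', rfl⟩ := QuantumBV.Completed.exists_isUnip hf
    obtain ⟨H, hH, hH3, hfl⟩ := QuantumBV.Completed.exists_ham_of_unip hP hW hf'
      ((QuantumBV.Completed.isSymplectic_iff hP f).1 hsymp)
    obtain ⟨Q, hQ, hQx⟩ := QuantumBV.Completed.exists_exact_of_transport hS hf' hH hH3 hfl
      (QuantumBV.Completed.mem_fil_zero_of_sub_one (QuantumBV.Completed.expC_sub_one_mem hb₁)) hx₁
    exact hexact Q hQ (by rw [(hhalf f hf').1 h, hQx])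
  tfae_finish
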